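/- For polynomials $f,g:\mathbb C\to\mathbb C$ consider the polynomial skew product $P:\mathbb C^2\to\mathbb C^2$, $$P(z,w)=\Bigl(f(z)+\tfrac{\pi^2}{4}\,w,\;g(w)\Bigr).$$ The Fatou set $\mathcal F_P\subset\mathbb C^2$ is the largest open subset of $\mathbb C^2$ on which the sequence of iterates $(P^{\circ n})_{n\ge 0}$, viewed as maps into $\mathbb P^2(\mathbb C)\supset\mathbb C^2$, is equicontinuous; a Fatou component is a connected component of $\mathcal F_P$; a Fatou component $\Omega$ is wandering if it is not (pre)periodic, that is, if the images $P^{\circ i}(\Omega)$, $i\ge 0$, lie in pairwise distinct Fatou components. There exists a real number $b\in(-8/27,0)$ such that, with $f(z)=z+z^2+bz^4$, the following holds: for every polynomial $g$ with complex (in particular, real) coefficients of the form $g(w)=w-w^2+\mathrm O(w^3)$ as $w\to 0$, the polynomial skew product $P$ has a wandering Fatou component that intersects $\mathbb R^2$. -/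

import Mathlib

/-- The chordal (Fubini–Study) distance `‖x ∧ y‖ / (‖x‖ ‖y‖)` of the projective plane `ℙ²(ℂ)` between
the points `x = [1 : z : w]` and `y = [1 : z' : w']`, for `p = (z, w)` and `q = (z', w')` in the
affine chart `ℂ²`. It induces on `ℂ²` the uniform structure of the compact space `ℙ²(ℂ)`. -/
noncomputable def chordalDist (p q : ℂ × ℂ) : ℝ :=
  Real.sqrt (‖p.1 - q.1‖ ^ 2 + ‖p.2 - q.2‖ ^ 2 + ‖p.1 * q.2 - p.2 * q.1‖ ^ 2) /
    (Real.sqrt (1 + ‖p.1‖ ^ 2 + ‖p.2‖ ^ 2) * Real.sqrt (1 + ‖q.1‖ ^ 2 + ‖q.2‖ ^ 2))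

/-- The iterates of `P : ℂ² → ℂ²`, as maps into `ℙ²(ℂ)`, are equicontinuous at the point `p`. -/
def IteratesEquicontinuousAt (P : ℂ × ℂ → ℂ × ℂ) (p : ℂ × ℂ) : Prop :=
  ∀ ε : ℝ, 0 < ε → ∀ᶠ q in nhds p, ∀ n : ℕ, chordalDist (P^[n] p) (P^[n] q) < ε

/-- The Fatou set in `ℂ²`: the largest open subset of `ℂ²` on which the iterates of `P`, as maps
into `ℙ²(ℂ)`, are equicontinuous. -/
def fatouSet (P : ℂ × ℂ → ℂ × ℂ) : Set (ℂ × ℂ) :=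
  interior {p | IteratesEquicontinuousAt P p}

/-- A Fatou component is a connected component of the Fatou set. -/
def IsFatouComponent (P : ℂ × ℂ → ℂ × ℂ) (Ω : Set (ℂ × ℂ)) : Prop :=
  ∃ p ∈ fatouSet P, Ω = connectedComponentIn (fatouSet P) p

/-- A wandering Fatou component is a Fatou component `Ω` that is not (pre)periodic: the Fatou
components containing the images `P^[i] '' Ω`, `i = 0, 1, 2, …`, are pairwise distinct.
(In particular each image lies in the Fatou set and the images are pairwise disjoint.) -/
def IsWanderingFatouComponent (P : ℂ × ℂ → ℂ × ℂ) (Ω : Set (ℂ × ℂ)) : Prop :=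
  IsFatouComponent P Ω ∧ (∀ i : ℕ, P^[i] '' Ω ⊆ fatouSet P) ∧
    ∀ i j : ℕ, i ≠ j → ∀ p ∈ Ω, ∀ q ∈ Ω,
      connectedComponentIn (fatouSet P) (P^[i] p) ≠ connectedComponentIn (fatouSet P) (P^[j] q)

/-- The polynomial skew product `P(z, w) = (f(z) + (π² / 4) w, g(w))`. -/
noncomputable def skewProduct (f g : Polynomial ℂ) (p : ℂ × ℂ) : ℂ × ℂ :=
  (f.eval p.1 + (Real.pi : ℂ) ^ 2 / 4 * p.2, g.eval p.2)

/-! The mechanism is parabolic implosion. Start with `w` near `1/n₀²`. The base orbit then behaves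
like `1/(n₀² + k)` at time `k`, so on the block of `2n + 1` steps leading from time `n² - n₀²` to
time `(n+1)² - n₀²` the first coordinate follows `z ↦ f(z) + π²/(4(n² + k)) + error`. This small
perturbation of the parabolic map `f` opens a gate at `0` which takes about `2n` steps to cross, and
the constant `π²/4` synchronises the crossing with the gap between consecutive squares.

The limit of these blocks is computed explicitly. With `s = √(n² + k)` and `y = s z + 1/(4s)`, the
recursion is close to `y' = y + (y² + π²/4)/s`, which the Cayley coordinate `(y - a)/(y + a)`, `a =
iπ/2`, turns into a rotation of total angle `2π`. Once that rotation is removed, the coordinate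
changes at each step by about `-2a` times a cotangent orbit whose sum over a symmetric range
vanishes. Hence `gate_transit`: if `z_m` is the point `m` steps into the block and `z'` the point
`m` steps before its end, then `1/z' ≈ 2m - (-1/z_m)`, with an error that is `O(1/√m)`.

The parameter `b` is chosen so that the limit return map has a superattracting fixed point. Let `c >
0` be a critical point of `f` on the repelling side, `x_m` the forward orbit of `f(f(c))` on the
attracting side, and `u_j` a backward orbit of `c`. If the asymptotic phases match
(`CriticalReturn.matching`), the gate sends `x_m` to approximately `u_{m-2}`, then `m - 2` steps
lead to `c` and two more back to `x_0`. Since `c` is critical, the return map is quadratically small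
near `x_0`, and `return_contracts` gives `d ↦ d/2 + ε` for the distance to `x_0`. A matching
parameter exists by the intermediate value theorem: the mismatch of phases depends continuously on
`c`, is positive at `c = 3/2` and negative at `c = 33/20` (`mismatchLimit_pos`,
`mismatchLimit_neg`).

Consequently a product of discs around `(x_0, 1/n₀²)` has bounded orbits, and along the times `n² -
n₀²` it converges uniformly to `(x_0, 0)`, which is not periodic. If two images of its component lay
in one Fatou component, propagating the convergence across that component
(`tendstoUniformlyOn_propagates`) would force `(x_0, 0)` to be periodic. Hence the component wanders
(`isWandering_of_return`), and its centre is real. -/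

namespace ParabolicImplosion
open Filter Topology Metric Set

/-! ### The chordal metric compared with the norm on bounded sets. -/

section ChordalDistance

theorem chordalDist_comm (p q : ℂ × ℂ) : chordalDist p q = chordalDist q p := by
  unfold chordalDist
  rw [norm_sub_rev p.1, norm_sub_rev p.2, norm_sub_rev (p.1 * q.2), mul_comm (Real.sqrt _),
    mul_comm p.1, mul_comm p.2]

theorem chordalDist_le {R : ℝ} {p q : ℂ × ℂ} (hp : ‖p‖ ≤ R) :
    chordalDist p q ≤ (2 + 2 * R) * ‖p - q‖ := by
  have hR : 0 ≤ R := (norm_nonneg p).trans hp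
  have hp1 : ‖p.1‖ ≤ R := (norm_fst_le p).trans hp
  have hp2 : ‖p.2‖ ≤ R := (norm_snd_le p).trans hp
  have h1 : ‖p.1 - q.1‖ ≤ ‖p - q‖ := norm_fst_le (p - q)
  have h2 : ‖p.2 - q.2‖ ≤ ‖p - q‖ := norm_snd_le (p - q)
  set d := ‖p - q‖
  have hd : 0 ≤ d := norm_nonneg _
  have h3 : ‖p.1 * q.2 - p.2 * q.1‖ ≤ 2 * R * d := by
    have e : p.1 * q.2 - p.2 * q.1 = p.2 * (p.1 - q.1) - p.1 * (p.2 - q.2) := by ring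
    rw [e]
    refine (norm_sub_le _ _).trans ?_
    rw [norm_mul, norm_mul]
    have a1 : ‖p.2‖ * ‖p.1 - q.1‖ ≤ R * d := by gcongr
    have a2 : ‖p.1‖ * ‖p.2 - q.2‖ ≤ R * d := by gcongr
    linarith
  unfold chordalDist
  have hn : Real.sqrt (‖p.1 - q.1‖ ^ 2 + ‖p.2 - q.2‖ ^ 2 + ‖p.1 * q.2 - p.2 * q.1‖ ^ 2) ≤
      (2 + 2 * R) * d := by
    rw [Real.sqrt_le_left (by positivity)]
    calc _ ≤ d ^ 2 + d ^ 2 + (2 * R * d) ^ 2 := by gcongr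
      _ ≤ _ := by nlinarith [mul_nonneg hR (sq_nonneg d), sq_nonneg d]
  have hden : 1 ≤ Real.sqrt (1 + ‖p.1‖ ^ 2 + ‖p.2‖ ^ 2) * Real.sqrt (1 + ‖q.1‖ ^ 2 + ‖q.2‖ ^ 2) := by
    refine one_le_mul_of_one_le_of_one_le ?_ ?_ <;> rw [Real.one_le_sqrt] <;>
      nlinarith [sq_nonneg ‖p.1‖, sq_nonneg ‖p.2‖, sq_nonneg ‖q.1‖, sq_nonneg ‖q.2‖]
  exact (div_le_self (Real.sqrt_nonneg _) hden).trans hn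

/-- Bounded points stay a definite chordal distance away from the line at infinity. This converts
equicontinuity into `ℙ²` into local boundedness in `ℂ²` of those iterates that are bounded at one
point. -/
theorem norm_le_of_chordalDist_lt {R : ℝ} {p q : ℂ × ℂ} (hp : ‖p‖ ≤ R)
    (h : chordalDist p q < 1 / (6 * (1 + 2 * R))) : ‖q‖ ≤ 2 * R + 1 := by
  by_contra! hq
  have hR : 0 ≤ R := (norm_nonneg p).trans hp
  have hsq : ∀ v : ℂ × ℂ, Real.sqrt (1 + ‖v.1‖ ^ 2 + ‖v.2‖ ^ 2) ≤ 1 + 2 * ‖v‖ := by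
    intro v
    have h1 : ‖v.1‖ ≤ ‖v‖ := norm_fst_le v
    have h2 : ‖v.2‖ ≤ ‖v‖ := norm_snd_le v
    rw [Real.sqrt_le_left (by positivity)]
    calc _ ≤ 1 + ‖v‖ ^ 2 + ‖v‖ ^ 2 := by gcongr
      _ ≤ _ := by nlinarith [norm_nonneg v]
  have hn : ‖q‖ / 2 ≤
      Real.sqrt (‖p.1 - q.1‖ ^ 2 + ‖p.2 - q.2‖ ^ 2 + ‖p.1 * q.2 - p.2 * q.1‖ ^ 2) := by
    have h1 : ‖q‖ - ‖p‖ ≤ ‖p - q‖ := by rw [norm_sub_rev]; exact norm_sub_norm_le q p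
    refine le_trans (by linarith) (h1.trans ?_)
    rw [Prod.norm_def]
    refine max_le ?_ ?_
    · exact Real.le_sqrt_of_sq_le (by
        show ‖p.1 - q.1‖ ^ 2 ≤ _
        nlinarith [sq_nonneg ‖p.2 - q.2‖, sq_nonneg ‖p.1 * q.2 - p.2 * q.1‖])
    · exact Real.le_sqrt_of_sq_le (by
        show ‖p.2 - q.2‖ ^ 2 ≤ _
        nlinarith [sq_nonneg ‖p.1 - q.1‖, sq_nonneg ‖p.1 * q.2 - p.2 * q.1‖])
  have hq0 : 0 < ‖q‖ := by linarith
  have hlow : 1 / (6 * (1 + 2 * R)) ≤ chordalDist p q := by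
    unfold chordalDist
    have hden : Real.sqrt (1 + ‖p.1‖ ^ 2 + ‖p.2‖ ^ 2) * Real.sqrt (1 + ‖q.1‖ ^ 2 + ‖q.2‖ ^ 2) ≤
        (1 + 2 * R) * (3 * ‖q‖) := by
      have := hsq p
      have := hsq q
      gcongr <;> linarith
    calc 1 / (6 * (1 + 2 * R)) = (‖q‖ / 2) / ((1 + 2 * R) * (3 * ‖q‖)) := by field_simp; norm_num
      _ ≤ _ := by
        gcongr
  linarith

end ChordalDistance

/-! ### Forward invariance of the Fatou set and the criterion of bounded orbits. -/

section FatouSet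

theorem isOpenMap_iterate {X : Type*} [TopologicalSpace X] {P : X → X} (ho : IsOpenMap P) (n : ℕ) :
    IsOpenMap P^[n] := by
  induction n with
  | zero => exact IsOpenMap.id
  | succ n ih => rw [Function.iterate_succ]; exact ih.comp ho

theorem fatouSet_mapsTo {P : ℂ × ℂ → ℂ × ℂ} (ho : IsOpenMap P) {p : ℂ × ℂ} (hp : p ∈ fatouSet P) :
    P p ∈ fatouSet P := by
  refine mem_interior.2 ⟨P '' fatouSet P, ?_, ho _ isOpen_interior, mem_image_of_mem _ hp⟩
  rintro _ ⟨q, hq, rfl⟩ ε hε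
  have hq' := interior_subset hq
  filter_upwards [ho.image_mem_nhds (hq' ε hε)]
  rintro _ ⟨y, hy, rfl⟩ n
  exact hy (n + 1)

theorem fatouSet_iterate_mem {P : ℂ × ℂ → ℂ × ℂ} (ho : IsOpenMap P) {p : ℂ × ℂ}
    (hp : p ∈ fatouSet P) (n : ℕ) : P^[n] p ∈ fatouSet P := by
  induction n with
  | zero => exact hp
  | succ n ih => rw [Function.iterate_succ_apply']; exact fatouSet_mapsTo ho ih

/-- An open set with uniformly bounded orbits lies in the Fatou set. -/
theorem subset_fatouSet_of_bounded {P : ℂ × ℂ → ℂ × ℂ} (hP : Differentiable ℂ P) {U : Set (ℂ × ℂ)}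
    (hU : IsOpen U) {R : ℝ} (hb : ∀ p ∈ U, ∀ n, ‖P^[n] p‖ ≤ R) : U ⊆ fatouSet P := by
  refine interior_maximal (fun p hp ε hε => ?_) hU
  obtain ⟨r, hr, hball⟩ := Metric.isOpen_iff.1 hU p hp
  have hR : 0 ≤ R := (norm_nonneg _).trans (hb p hp 0)
  set L := (2 + 2 * R) * (2 * R / r) with hL
  have hL0 : 0 ≤ L := by positivity
  filter_upwards [ball_mem_nhds p (show 0 < min r (ε / (L + 1)) by positivity)] with q hq n
  have hqr : q ∈ ball p r := ball_subset_ball (min_le_left _ _) hq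
  -- The Schwarz lemma gives all iterates the same Lipschitz constant `2R/r` at `p`.
  have h1 := Complex.dist_le_div_mul_dist_of_mapsTo_ball (R₂ := 2 * R) (f := P^[n]) (c := p)
    (R₁ := r) (z := q) (hP.iterate n).differentiableOn (fun y hy => by
      rw [mem_closedBall, dist_eq_norm]
      refine (norm_sub_le _ _).trans ?_
      linarith [hb y (hball hy) n, hb p hp n]) hqr
  have h2 : dist q p < ε / (L + 1) := lt_of_lt_of_le hq (min_le_right _ _)
  rw [lt_div_iff₀ (by positivity)] at h2
  calc chordalDist (P^[n] p) (P^[n] q) ≤ (2 + 2 * R) * ‖P^[n] p - P^[n] q‖ :=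
        chordalDist_le (hb p hp n)
    _ ≤ (2 + 2 * R) * (2 * R / r * dist q p) := by
        rw [← dist_eq_norm, dist_comm]; gcongr
    _ = dist q p * L := by rw [hL]; ring
    _ ≤ dist q p * (L + 1) := by gcongr; linarith
    _ < ε := h2

end FatouSet

/-! ### A quantitative Vitali theorem from Taylor series. -/

section Vitali

variable {F : Type*} [NormedAddCommGroup F] [NormedSpace ℂ F] [CompleteSpace F]

/-- Cauchy estimates on the circle of radius `s/2` make every Taylor coefficient at `0` tend to `0`.
Those on the circle of radius `3/2` dominate the coefficients by `R (2/3)^k`, so dominated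
convergence applies to the series at `1`. The index type is arbitrary so that it can carry a point
as well as a time. -/
theorem tendsto_zero_of_tendstoUniformly_near_center {ι : Type*} {l : Filter ι} {φ : ι → ℂ → F}
    {R s : ℝ} (hs : 0 < s) (hs2 : s ≤ 1)
    (hd : ∀ᶠ i in l, DifferentiableOn ℂ (φ i) (ball 0 2))
    (hb : ∀ᶠ i in l, ∀ t ∈ ball (0 : ℂ) 2, ‖φ i t‖ ≤ R)
    (h0 : ∀ ε > 0, ∀ᶠ i in l, ∀ t ∈ ball (0 : ℂ) s, ‖φ i t‖ ≤ ε) :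
    Tendsto (fun i => φ i 1) l (𝓝 0) := by
  have hdc : ∀ {ψ : ℂ → F} {r : ℝ}, DifferentiableOn ℂ ψ (ball 0 2) → r < 2 →
      DiffContOnCl ℂ ψ (ball 0 r) := fun h hr =>
    (h.mono (closedBall_subset_ball hr)).diffContOnCl_ball (subset_refl _)
  have hterm : ∀ k : ℕ, Tendsto (fun i => ((k.factorial : ℂ)⁻¹ • ((1 : ℂ) - 0) ^ k •
      iteratedDeriv k (φ i) 0)) l (𝓝 0) := by
    intro k
    rw [Metric.tendsto_nhds]
    intro ε hε
    filter_upwards [hd, h0 (ε / 2 * (s / 2) ^ k) (by positivity)] with i h1 h2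
    have h3 := Complex.norm_iteratedDeriv_le_of_forall_mem_sphere_norm_le k (half_pos hs)
      (hdc h1 (by linarith)) (fun z hz => h2 z (by
        rw [mem_ball, mem_sphere.1 hz]; linarith))
    rw [dist_zero_right, sub_zero, one_pow, one_smul, norm_smul, norm_inv, Complex.norm_natCast]
    have hk : (0 : ℝ) < k.factorial := by exact_mod_cast k.factorial_pos
    rw [inv_mul_lt_iff₀ hk]
    refine h3.trans_lt ?_
    rw [← mul_assoc, mul_div_assoc, div_self (by positivity), mul_one]
    gcongr
    linarith
  have hsum : Tendsto (fun i => ∑' k : ℕ, ((k.factorial : ℂ)⁻¹ • ((1 : ℂ) - 0) ^ k •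
      iteratedDeriv k (φ i) 0)) l (𝓝 (∑' _ : ℕ, (0 : F))) := by
    refine tendsto_tsum_of_dominated_convergence (bound := fun k : ℕ => R * (2 / 3 : ℝ) ^ k) ?_
      hterm ?_
    · exact (summable_geometric_of_lt_one (by norm_num) (by norm_num)).mul_left R
    · filter_upwards [hd, hb] with i h1 h2 k
      have h3 := Complex.norm_iteratedDeriv_le_of_forall_mem_sphere_norm_le k
        (by norm_num : (0 : ℝ) < 3 / 2) (hdc h1 (by norm_num)) (fun z hz => h2 z (by
          rw [mem_ball, mem_sphere.1 hz]; norm_num))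
      rw [sub_zero, one_pow, one_smul, norm_smul, norm_inv, Complex.norm_natCast]
      have hk : (0 : ℝ) < k.factorial := by exact_mod_cast k.factorial_pos
      rw [inv_mul_le_iff₀ hk]
      refine h3.trans (le_of_eq ?_)
      rw [mul_div_assoc, div_eq_mul_inv R, ← inv_pow]
      norm_num
  rw [tsum_zero] at hsum
  refine hsum.congr' ?_
  filter_upwards [hd] with i h1
  exact (Complex.hasSum_taylorSeries_on_ball h1 (z := 1) (by simp)).tsum_eq

variable {E : Type*} [NormedAddCommGroup E] [NormedSpace ℂ E]

/-- Vitali's theorem on a ball: bounded holomorphic maps converging to a constant near the centre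
converge on a ball of half the radius. -/
theorem tendstoUniformlyOn_half_ball {h : ℕ → E → F} {q : E} {a : F} {r s R : ℝ}
    (hr : 0 < r) (hs : 0 < s) (hd : ∀ n, Differentiable ℂ (h n))
    (hb : ∀ᶠ n in atTop, ∀ y ∈ ball q r, ‖h n y‖ ≤ R)
    (hlim : TendstoUniformlyOn h (fun _ => a) atTop (ball q s)) :
    TendstoUniformlyOn h (fun _ => a) atTop (ball q (r / 2)) := by
  have hmem : ∀ᶠ i : ℕ × E in atTop ×ˢ 𝓟 (ball q (r / 2)), i.2 ∈ ball q (r / 2) :=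
    tendsto_snd.eventually (eventually_mem_set.2 (mem_principal_self _))
  have hpt : ∀ (t : ℂ) (y : E), q + t • (y - q) ∈ ball q (‖t‖ * ‖y - q‖ + 1) := by
    intro t y
    rw [mem_ball, dist_eq_norm, add_sub_cancel_left, norm_smul]; linarith
  have key : Tendsto (fun i : ℕ × E => h i.1 (q + (1 : ℂ) • (i.2 - q)) - a)
      (atTop ×ˢ 𝓟 (ball q (r / 2))) (𝓝 0) := by
    -- Each map is restricted to the complex line through `q` and `y`, with `y` at parameter `1`. As
    -- `y` is part of the index, convergence along the product filter is uniform in `y`.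
    refine tendsto_zero_of_tendstoUniformly_near_center
      (φ := fun (i : ℕ × E) t => h i.1 (q + t • (i.2 - q)) - a) (R := R + ‖a‖)
      (s := min 1 (s / r)) (by positivity) (min_le_left _ _) ?_ ?_ ?_
    · refine Eventually.of_forall fun i => Differentiable.differentiableOn ?_
      exact ((hd i.1).comp (by fun_prop)).sub_const a
    · filter_upwards [hmem, tendsto_fst.eventually hb] with i h1 h2 t ht
      refine norm_sub_le_of_le (h2 _ ?_) le_rfl
      rw [mem_ball, dist_eq_norm] at h1 ⊢
      rw [mem_ball_zero_iff] at ht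
      rw [add_sub_cancel_left, norm_smul]
      nlinarith [norm_nonneg t, norm_nonneg (i.2 - q)]
    · intro ε hε
      filter_upwards [hmem, tendsto_fst.eventually (Metric.tendstoUniformlyOn_iff.1 hlim ε hε)]
        with i h1 h2 t ht
      have := h2 (q + t • (i.2 - q)) (by
        rw [mem_ball, dist_eq_norm] at h1 ⊢
        rw [mem_ball_zero_iff] at ht
        rw [add_sub_cancel_left, norm_smul]
        have h3 : ‖t‖ < s / r := lt_of_lt_of_le ht (min_le_right _ _)
        calc ‖t‖ * ‖i.2 - q‖ ≤ s / r * (r / 2) := by gcongr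
          _ = s / 2 := by field_simp
          _ < s := by linarith)
      rw [dist_eq_norm, norm_sub_rev] at this
      exact this.le
  rw [Metric.tendstoUniformlyOn_iff]
  intro ε hε
  have h1 := (Metric.tendsto_nhds.1 key) ε hε
  rw [eventually_prod_principal_iff] at h1
  filter_upwards [h1] with n hn y hy
  have := hn y hy
  rwa [dist_zero_right, one_smul, add_sub_cancel, ← dist_eq_norm, dist_comm] at this

end Vitali

/-! ### Wandering components from convergence to a non-periodic point. -/

section Wandering

variable {P : ℂ × ℂ → ℂ × ℂ}

/-- On a connected subset of the Fatou set, local convergence of a sequence of iterates to a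
constant propagates. -/
theorem tendstoUniformlyOn_propagates (hP : Differentiable ℂ P) {k : ℕ → ℕ} {a : ℂ × ℂ}
    {Ω : Set (ℂ × ℂ)} (hΩ : IsPreconnected Ω) (hΩF : Ω ⊆ fatouSet P) {p : ℂ × ℂ} (hp : p ∈ Ω)
    {s : ℝ} (hs : 0 < s)
    (hlim : TendstoUniformlyOn (fun n => P^[k n]) (fun _ => a) atTop (ball p s)) {q : ℂ × ℂ}
    (hq : q ∈ Ω) : Tendsto (fun n => P^[k n] q) atTop (𝓝 a) := by
  set V := {q | ∃ s > 0, TendstoUniformlyOn (fun n => P^[k n]) (fun _ => a) atTop (ball q s)}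
    with hV
  have hsub : ∀ {x : ℂ × ℂ} {s : ℝ}, TendstoUniformlyOn (fun n => P^[k n]) (fun _ => a) atTop
      (ball x s) → ball x s ⊆ V := by
    intro x s h y hy
    refine ⟨s - dist y x, by linarith [mem_ball.1 hy], h.mono ?_⟩
    exact ball_subset_ball' (by linarith)
  have hVo : IsOpen V := by
    rw [Metric.isOpen_iff]
    rintro x ⟨s, hs, h⟩
    exact ⟨s, hs, hsub h⟩
  -- `V` is closed in `Ω`. Near a limit point `x`, choose `y ∈ V`: its iterates are eventually
  -- bounded by `R₀`, hence those of `x` by `R₁`, hence those on a whole ball around `y`, by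
  -- equicontinuity at `x` used twice. Vitali on half of that ball, which still contains `x`,
  -- concludes.
  have hcl : closure V ∩ Ω ⊆ V := by
    rintro x ⟨hx, hxΩ⟩
    set R₀ := ‖a‖ + 1 with hR₀
    set R₁ := 2 * R₀ + 1 with hR₁
    have h0 : 0 ≤ R₀ := by positivity
    obtain ⟨r, hr, hrx⟩ := Metric.eventually_nhds_iff.1
      (interior_subset (hΩF hxΩ) (1 / (6 * (1 + 2 * R₁))) (by positivity))
    obtain ⟨y, ⟨s, hs, hy⟩, hxy⟩ := Metric.mem_closure_iff.1 hx (r / 4) (by positivity)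
    have hya : ∀ᶠ n in atTop, ‖P^[k n] y‖ ≤ R₀ := by
      have := hy.tendsto_at (mem_ball_self hs)
      filter_upwards [Metric.tendsto_nhds.1 this 1 one_pos] with n hn
      rw [dist_eq_norm] at hn
      have := norm_sub_norm_le (P^[k n] y) a
      linarith
    have hbd : ∀ᶠ n in atTop, ∀ z ∈ ball y (r / 2), ‖P^[k n] z‖ ≤ 2 * R₁ + 1 := by
      filter_upwards [hya] with n hn z hz
      have h1 : ‖P^[k n] x‖ ≤ R₁ := by
        refine norm_le_of_chordalDist_lt hn ?_
        rw [chordalDist_comm]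
        refine (hrx (y := y) (by rw [dist_comm]; linarith) (k n)).trans_le ?_
        gcongr
        linarith
      refine norm_le_of_chordalDist_lt h1 (hrx (y := z) ?_ (k n))
      rw [mem_ball] at hz
      have := dist_triangle z y x
      rw [dist_comm y x] at this
      linarith
    have hlim' := tendstoUniformlyOn_half_ball (half_pos hr) hs
      (fun n => hP.iterate (k n)) hbd hy
    exact hsub hlim' (by rw [mem_ball]; linarith)
  have := hΩ.subset_of_closure_inter_subset hVo ⟨p, hp, s, hs, hlim⟩ hcl hq
  obtain ⟨s', hs', h⟩ := this
  exact h.tendsto_at (mem_ball_self hs')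

/-- If an open set has bounded orbits and some sequence of iterates converges on it to a
non-periodic point, then it lies in wandering components. -/
theorem isWandering_of_return (hP : Differentiable ℂ P) (ho : IsOpenMap P) {U : Set (ℂ × ℂ)}
    (hU : IsOpen U) {p : ℂ × ℂ} (hp : p ∈ U) {R : ℝ} (hb : ∀ q ∈ U, ∀ n, ‖P^[n] q‖ ≤ R)
    {k : ℕ → ℕ} (hk : Tendsto k atTop atTop) {a : ℂ × ℂ}
    (hlim : TendstoUniformlyOn (fun n => P^[k n]) (fun _ => a) atTop U)
    (ha : ∀ d, d ≠ 0 → P^[d] a ≠ a) :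
    IsWanderingFatouComponent P (connectedComponentIn (fatouSet P) p) := by
  have hUF := subset_fatouSet_of_bounded hP hU hb
  have hpF := hUF hp
  set Ω := connectedComponentIn (fatouSet P) p with hΩ
  have hΩF : Ω ⊆ fatouSet P := connectedComponentIn_subset _ _
  have himg : ∀ i : ℕ, P^[i] '' Ω ⊆ fatouSet P := by
    rintro i _ ⟨q, hq, rfl⟩
    exact fatouSet_iterate_mem ho (hΩF hq) i
  have hcomp : ∀ i : ℕ, ∀ q ∈ Ω, connectedComponentIn (fatouSet P) (P^[i] q) =
      connectedComponentIn (fatouSet P) (P^[i] p) := by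
    intro i q hq
    refine (connectedComponentIn_eq ?_).symm
    refine IsPreconnected.subset_connectedComponentIn (s := P^[i] '' Ω)
      (isPreconnected_connectedComponentIn.image _ (hP.iterate i).continuous.continuousOn)
      (mem_image_of_mem _ (mem_connectedComponentIn hpF)) (himg i) (mem_image_of_mem _ hq)
  have hne : ∀ i j : ℕ, i < j → connectedComponentIn (fatouSet P) (P^[i] p) ≠
      connectedComponentIn (fatouSet P) (P^[j] p) := by
    intro i j hij heq
    -- On the open set `P^[i] '' U` the iterates `P^[k n - i]` converge to `a`. Propagated to `P^[j]
    -- p`, the limit is again `a`, but there it also equals `P^[j - i] a`.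
    have hopen : IsOpen (P^[i] '' U) := isOpenMap_iterate ho i _ hU
    obtain ⟨s, hs, hsU⟩ := Metric.isOpen_iff.1 hopen _ (mem_image_of_mem (P^[i]) hp)
    have hlim' : TendstoUniformlyOn (fun n => P^[k n - i]) (fun _ => a) atTop
        (ball (P^[i] p) s) := by
      refine TendstoUniformlyOn.mono ?_ hsU
      rw [Metric.tendstoUniformlyOn_iff] at hlim ⊢
      intro ε hε
      filter_upwards [hlim ε hε, hk.eventually_ge_atTop i] with n h1 h2
      rintro _ ⟨u, hu, rfl⟩
      rw [← Function.iterate_add_apply, Nat.sub_add_cancel h2]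
      exact h1 u hu
    have hj : P^[j] p ∈ connectedComponentIn (fatouSet P) (P^[i] p) := by
      rw [heq]; exact mem_connectedComponentIn (fatouSet_iterate_mem ho hpF j)
    have h1 := tendstoUniformlyOn_propagates hP isPreconnected_connectedComponentIn
      (connectedComponentIn_subset _ _) (mem_connectedComponentIn (fatouSet_iterate_mem ho hpF i))
      hs hlim' hj
    have h2 : Tendsto (fun n => P^[j - i] (P^[k n] p)) atTop (𝓝 (P^[j - i] a)) :=
      ((hP.iterate (j - i)).continuous.tendsto a).comp (hlim.tendsto_at hp)
    have h3 : Tendsto (fun n => P^[k n - i] (P^[j] p)) atTop (𝓝 (P^[j - i] a)) := by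
      refine h2.congr' ?_
      filter_upwards [hk.eventually_ge_atTop i] with n hn
      rw [← Function.iterate_add_apply, ← Function.iterate_add_apply]
      congr 1
      omega
    exact ha (j - i) (by omega) (tendsto_nhds_unique h3 h1)
  refine ⟨⟨p, hpF, rfl⟩, himg, fun i j hij x hx y hy => ?_⟩
  rw [hcomp i x hx, hcomp j y hy]
  rcases lt_or_gt_of_ne hij with h | h
  · exact hne i j h
  · exact (hne j i h).symm

end Wandering

/-! ### Holomorphy and openness of the skew product. -/

section SkewProduct

theorem differentiable_skewProduct (f g : Polynomial ℂ) : Differentiable ℂ (skewProduct f g) := by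
  have h1 : Differentiable ℂ (fun p : ℂ × ℂ => f.eval p.1) := f.differentiable.comp differentiable_fst
  have h2 : Differentiable ℂ (fun p : ℂ × ℂ => g.eval p.2) := g.differentiable.comp differentiable_snd
  exact (h1.add (differentiable_snd.const_mul _)).prodMk h2

theorem isOpenMap_polynomial_eval {f : Polynomial ℂ} (hf : f.coeff 1 ≠ 0) :
    IsOpenMap (fun z => f.eval z) := by
  have han : AnalyticOnNhd ℂ (fun z => f.eval z) univ :=
    f.differentiable.differentiableOn.analyticOnNhd isOpen_univ
  refine han.is_constant_or_isOpenMap.resolve_left ?_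
  rintro ⟨w, hw⟩
  apply hf
  have : f = Polynomial.C w := Polynomial.funext fun z => by rw [hw z, Polynomial.eval_C]
  rw [this, Polynomial.coeff_C_of_ne_zero one_ne_zero]

/-- The map factors as `f × id`, then a linear shear, then `id × g`, and nonconstant polynomials are
open. -/
theorem isOpenMap_skewProduct {f g : Polynomial ℂ} (hf : f.coeff 1 ≠ 0) (hg : g.coeff 1 ≠ 0) :
    IsOpenMap (skewProduct f g) := by
  set A : ℂ := (Real.pi : ℂ) ^ 2 / 4 with hA
  let shear : ℂ × ℂ ≃ₜ ℂ × ℂ :=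
    { toFun := fun p => (p.1 + A * p.2, p.2)
      invFun := fun p => (p.1 - A * p.2, p.2)
      left_inv := fun p => by simp
      right_inv := fun p => by simp
      continuous_toFun := by fun_prop
      continuous_invFun := by fun_prop }
  have e : skewProduct f g = Prod.map id (fun z => g.eval z) ∘ shear ∘
      Prod.map (fun z => f.eval z) id := by
    funext p; rfl
  rw [e]
  exact (IsOpenMap.id.prodMap (isOpenMap_polynomial_eval hg)).comp
    (shear.isOpenMap.comp ((isOpenMap_polynomial_eval hf).prodMap IsOpenMap.id))

end SkewProduct

end ParabolicImplosion

/-! ### One-step estimates in the scaled and Cayley variables. -/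

namespace ParabolicImplosion
open Complex

/-- One step of the recursion in the scaled variable `y = s z + 1 / (4 s)`. -/
theorem scaled_step_bound {s s' : ℝ} (hs : 1 ≤ s) (hs' : 0 < s') (hss : s' ^ 2 = s ^ 2 + 1)
    {b z e y y' : ℂ} (hb : ‖b‖ ≤ 1) (hz : ‖z‖ ≤ 1)
    (hy : y = s * z + 1 / (4 * s))
    (hy' : y' = s' * (z + z ^ 2 + b * z ^ 4 + (Real.pi : ℂ) ^ 2 / 4 / (s : ℂ) ^ 2 + e)
      + 1 / (4 * s')) :
    ‖y' - y - (y ^ 2 + (Real.pi : ℂ) ^ 2 / 4) / s‖ ≤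
      s * ‖z‖ ^ 4 + 2 * s * ‖e‖ + ‖z‖ ^ 2 / s + 4 / s ^ 3 := by
  have hs0 : 0 < s := by linarith
  have hsC : (s : ℂ) ≠ 0 := by exact_mod_cast hs0.ne'
  have hsC' : (s' : ℂ) ≠ 0 := by exact_mod_cast hs'.ne'
  set h : ℝ := s' - s with hh
  have hlt : s < s' := by nlinarith
  have hpos : 0 < h := by simp [hh, hlt]
  have hprod : h * (s' + s) = 1 := by rw [hh]; nlinarith
  have hle : h ≤ 1 / (2 * s) := by
    rw [le_div_iff₀ (by positivity)]; nlinarith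
  have hdiff : 1 / (2 * s) - h = h ^ 2 / (2 * s) := by
    field_simp; nlinarith
  have hsq : h ^ 2 ≤ 1 / (4 * s ^ 2) := by
    calc h ^ 2 ≤ (1 / (2 * s)) ^ 2 := by gcongr
      _ = _ := by field_simp; norm_num
  have hs's : (s' : ℂ) = s + h := by rw [hh]; push_cast; ring
  -- The shift `1/(4s)` in `y` is chosen for this identity: `y²/s` contributes `z/(2s)`, which
  -- absorbs the drift `h z` due to the change of scale up to `h - 1/(2s) = -h²/(2s)`.
  have hid : y' - y - (y ^ 2 + (Real.pi : ℂ) ^ 2 / 4) / s =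
      s * b * z ^ 4 + s * e + h * (z ^ 2 + b * z ^ 4 + (Real.pi : ℂ) ^ 2 / 4 / (s : ℂ) ^ 2 + e)
      + (h - 1 / (2 * s)) * z - h / (4 * s * s') - 1 / (16 * s ^ 3) := by
    have h1 : (1 : ℂ) / (4 * s') = 1 / (4 * s) - h / (4 * s * s') := by
      rw [hh]; push_cast; field_simp; ring
    rw [hy', hy, h1, hs's]
    field_simp
    ring
  rw [hid]
  have hpi : Real.pi ^ 2 / 4 ≤ 3 := by nlinarith [Real.pi_lt_d2, Real.pi_pos]
  have b1 : ‖(s : ℂ) * b * z ^ 4‖ ≤ s * ‖z‖ ^ 4 := by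
    rw [norm_mul, norm_mul, norm_pow, Complex.norm_real, Real.norm_of_nonneg hs0.le]
    have : s * ‖b‖ ≤ s := by nlinarith
    gcongr
  have b2 : ‖(s : ℂ) * e‖ = s * ‖e‖ := by
    rw [norm_mul, Complex.norm_real, Real.norm_of_nonneg hs0.le]
  have b3 : ‖(h : ℂ) * (z ^ 2 + b * z ^ 4 + (Real.pi : ℂ) ^ 2 / 4 / (s : ℂ) ^ 2 + e)‖ ≤
      1 / (2 * s) * (2 * ‖z‖ ^ 2 + 3 / s ^ 2 + ‖e‖) := by
    rw [norm_mul, Complex.norm_real, Real.norm_of_nonneg hpos.le]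
    have c1 : ‖z ^ 2 + b * z ^ 4 + (Real.pi : ℂ) ^ 2 / 4 / (s : ℂ) ^ 2 + e‖ ≤
        ‖z‖ ^ 2 + ‖z‖ ^ 2 + 3 / s ^ 2 + ‖e‖ := by
      refine norm_add_le_of_le (norm_add_le_of_le (norm_add_le_of_le ?_ ?_) ?_) le_rfl
      · rw [norm_pow]
      · rw [norm_mul, norm_pow]
        have : ‖z‖ ^ 4 ≤ ‖z‖ ^ 2 := pow_le_pow_of_le_one (norm_nonneg _) hz (by norm_num)
        nlinarith [norm_nonneg b, pow_nonneg (norm_nonneg z) 4]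
      · rw [norm_div, norm_div, norm_pow, norm_pow, Complex.norm_real, Complex.norm_real,
          Real.norm_of_nonneg Real.pi_pos.le, Real.norm_of_nonneg hs0.le]
        norm_num
        gcongr
    calc h * _ ≤ 1 / (2 * s) * (‖z‖ ^ 2 + ‖z‖ ^ 2 + 3 / s ^ 2 + ‖e‖) := by gcongr
      _ = _ := by ring
  have b4 : ‖((h : ℂ) - 1 / (2 * s)) * z‖ ≤ 1 / (8 * s ^ 3) := by
    have c : ((h : ℂ) - 1 / (2 * s)) = (((h - 1 / (2 * s) : ℝ)) : ℂ) := by push_cast; ring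
    rw [c, norm_mul, Complex.norm_real, norm_sub_rev, hdiff, Real.norm_of_nonneg (by positivity)]
    calc h ^ 2 / (2 * s) * ‖z‖ ≤ 1 / (4 * s ^ 2) / (2 * s) * 1 := by gcongr
      _ = _ := by field_simp; norm_num
  have b5 : ‖(h : ℂ) / (4 * s * s')‖ ≤ 1 / (8 * s ^ 3) := by
    rw [norm_div, norm_mul, norm_mul, Complex.norm_real, Complex.norm_real, Complex.norm_real,
      Real.norm_of_nonneg hpos.le, Real.norm_of_nonneg hs0.le, Real.norm_of_nonneg hs'.le]
    norm_num
    calc h / (4 * s * s') ≤ 1 / (2 * s) / (4 * s * s) := by gcongr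
      _ = _ := by field_simp; norm_num
  have b6 : ‖(1 : ℂ) / (16 * s ^ 3)‖ = 1 / (16 * s ^ 3) := by
    rw [norm_div, norm_mul, norm_pow, Complex.norm_real, Real.norm_of_nonneg hs0.le]; norm_num
  have hfin : ∀ p q r t u v : ℂ, ‖p + q + r + t - u - v‖ ≤ ‖p‖ + ‖q‖ + ‖r‖ + ‖t‖ + ‖u‖ + ‖v‖ := by
    intro p q r t u v
    exact norm_sub_le_of_le (norm_sub_le_of_le (norm_add_le_of_le (norm_add_le_of_le
      (norm_add_le _ _) le_rfl) le_rfl) le_rfl) le_rfl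
  refine (hfin _ _ _ _ _ _).trans ?_
  rw [b2, b6]
  have hlast : 1 / (2 * s) * (2 * ‖z‖ ^ 2 + 3 / s ^ 2 + ‖e‖) ≤
      ‖z‖ ^ 2 / s + 3 / (2 * s ^ 3) + s * ‖e‖ := by
    have : 1 / (2 * s) * ‖e‖ ≤ s * ‖e‖ := by
      gcongr
      rw [div_le_iff₀ (by positivity)]; nlinarith
    calc _ = ‖z‖ ^ 2 / s + 3 / (2 * s ^ 3) + 1 / (2 * s) * ‖e‖ := by field_simp
      _ ≤ _ := by linarith
  have hsum : 1 / (8 * s ^ 3) + 1 / (8 * s ^ 3) + 1 / (16 * s ^ 3) + 3 / (2 * s ^ 3) ≤ 4 / s ^ 3 := by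
    have h3 : 0 < 1 / s ^ 3 := by positivity
    have e1 : 1 / (8 * s ^ 3) = 1 / 8 * (1 / s ^ 3) := by field_simp
    have e2 : 1 / (16 * s ^ 3) = 1 / 16 * (1 / s ^ 3) := by field_simp
    have e3 : 3 / (2 * s ^ 3) = 3 / 2 * (1 / s ^ 3) := by field_simp
    have e4 : 4 / s ^ 3 = 4 * (1 / s ^ 3) := by field_simp
    rw [e1, e2, e3, e4]; nlinarith
  linarith

/-- One step in the Cayley variable `ω = (y - a) / (y + a) = 1 - 2 a / (y + a)`. -/
theorem cayley_step {a s E y y' : ℂ} (hs : s ≠ 0) (hA : y + a ≠ 0)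
    (hy' : y' = y + (y ^ 2 - a ^ 2) / s + E)
    (hτ : 1 + ((y - a) / s + E / (y + a)) ≠ 0) :
    y' + a = (y + a) * (1 + ((y - a) / s + E / (y + a))) ∧
    1 - 2 * a / (y' + a) = (1 - 2 * a / (y + a)) +
      (2 * a / s * (1 - 2 * a / (y + a)) + 2 * a * E / (y + a) ^ 2) /
        (1 + ((y - a) / s + E / (y + a))) := by
  have h1 : y' + a = (y + a) * (1 + ((y - a) / s + E / (y + a))) := by
    rw [hy']; field_simp; ring
  refine ⟨h1, ?_⟩
  rw [h1]
  set τ := (y - a) / s + E / (y + a) with hτd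
  have h2 : 2 * a / s * (1 - 2 * a / (y + a)) + 2 * a * E / (y + a) ^ 2 =
      2 * a / (y + a) * τ := by
    rw [hτd]; field_simp; ring
  rw [h2]
  field_simp
  ring

set_option maxHeartbeats 1000000 in
/-- The relative increment of the phase-corrected Cayley variable is `-(2 a / s) z` up to a
small error. -/
theorem phase_step_bound {a s z t e ω E A G R : ℂ} {x N ρ CE : ℝ}
    (ha : ‖a‖ ≤ 8 / 5) (hs0 : s ≠ 0) (hs : ‖s⁻¹‖ ≤ N) (hN : 0 < N) (hNx : N ≤ x) (hx : x ≤ 1 / 100)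
    (hxρ : x ^ 2 ≤ ρ) (hρ : ρ ≤ x) (hCE : 1 ≤ CE) (hCx : CE * x ≤ 1)
    (hE : ‖E‖ ≤ CE * (ρ * x ^ 2 / N)) (hA0 : A ≠ 0) (hA : ‖A⁻¹‖ ≤ 2 * N / x)
    (ht : ‖t‖ ≤ 10 * x) (htz : t = z + 1 / (4 * s ^ 2) - a / s)
    (hω : 1 / 2 ≤ ‖ω‖)
    (he1 : ‖e‖ ≤ 1) (he : ‖e - (1 - 2 * a / s + 2 * a ^ 2 / s ^ 2)‖ ≤ 10 * N ^ 3)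
    (hG : G = 2 * a * E / (A ^ 2 * ω)) (hR : R = 1 / (1 + (t + E / A)) - 1 + t) :
    1 + (t + E / A) ≠ 0 ∧
    ‖e * (1 + (2 * a / s + G) / (1 + (t + E / A))) - 1 + 2 * a / s * z‖ ≤
      (220 * CE + 2000) * (ρ * N) := by
  -- The values in use are `x = 1/j`, `N = 1/n` and `ρ = 1/(j√j)`, where `j` is the number of steps
  -- to the nearer end of the gate.
  have hx0 : 0 < x := by linarith
  have hρ0 : 0 < ρ := by nlinarith
  have hε : ‖E / A‖ ≤ 2 * CE * (ρ * x) := by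
    rw [div_eq_mul_inv, norm_mul]
    calc ‖E‖ * ‖A⁻¹‖ ≤ CE * (ρ * x ^ 2 / N) * (2 * N / x) := by gcongr
      _ = _ := by field_simp
  have hε2 : ‖E / A‖ ≤ 2 * x := by
    refine hε.trans ?_
    nlinarith
  have hτ : ‖t + E / A‖ ≤ 12 * x := (norm_add_le_of_le ht hε2).trans (by linarith)
  have hτ2 : ‖t + E / A‖ ≤ 1 / 2 := by linarith
  have hinv : 1 / 2 ≤ ‖1 + (t + E / A)‖ := by
    have := norm_sub_le (1 + (t + E / A)) (t + E / A)
    simp only [add_sub_cancel_right, norm_one] at this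
    linarith
  have hne : 1 + (t + E / A) ≠ 0 := by
    intro h0; rw [h0] at hinv; norm_num at hinv
  refine ⟨hne, ?_⟩
  have hR' : R = - (E / A) + (t + E / A) ^ 2 / (1 + (t + E / A)) := by
    rw [hR]
    generalize E / A = q at hne
    field_simp
    ring
  have hRb : ‖R‖ ≤ (2 * CE + 288) * ρ := by
    rw [hR']
    refine (norm_add_le_of_le (norm_neg _).le le_rfl).trans ?_
    have h0 : ‖(t + E / A) ^ 2 / (1 + (t + E / A))‖ =
      ‖t + E / A‖ ^ 2 / ‖1 + (t + E / A)‖ := by rw [norm_div, norm_pow]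
    rw [h0]
    have h1 : ‖t + E / A‖ ^ 2 / ‖1 + (t + E / A)‖ ≤ (12 * x) ^ 2 / (1 / 2) := by gcongr
    have h2 : (12 * x) ^ 2 / (1 / 2) = 288 * x ^ 2 := by ring
    have h3 : 2 * CE * (ρ * x) ≤ 2 * CE * ρ := by
      have : ρ * x ≤ ρ := by nlinarith
      nlinarith
    nlinarith
  have hω0 : ω ≠ 0 := by intro h0; rw [h0] at hω; norm_num at hω
  have hωi : ‖ω⁻¹‖ ≤ 2 := by
    rw [norm_inv]
    rw [inv_le_comm₀ (by linarith) (by norm_num)]; linarith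
  have hGb : ‖G‖ ≤ 26 * CE * (ρ * N) := by
    have : G = 2 * a * E * (A⁻¹) ^ 2 * ω⁻¹ := by rw [hG]; field_simp
    rw [this, norm_mul, norm_mul, norm_mul, norm_mul, norm_pow]
    calc ‖(2 : ℂ)‖ * ‖a‖ * ‖E‖ * ‖A⁻¹‖ ^ 2 * ‖ω⁻¹‖
        ≤ 2 * (8 / 5) * (CE * (ρ * x ^ 2 / N)) * (2 * N / x) ^ 2 * 2 := by
          gcongr; norm_num
      _ = (128 / 5) * CE * (ρ * N) := by field_simp; norm_num
      _ ≤ _ := by gcongr; norm_num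
  have hs2 : ∀ k : ℕ, ‖(1 : ℂ) / s ^ k‖ ≤ N ^ k := by
    intro k
    rw [one_div, ← inv_pow, norm_pow]; gcongr
  set η := e - (1 - 2 * a / s + 2 * a ^ 2 / s ^ 2) with hη
  -- The orders `1/s` and `1/s²` cancel. The rotation `e` removes `2a/s`, and the second-order terms
  -- `2a²/s²` from `e`, `-4a²/s²` from the product and `2a²/s²` from `t = z + 1/(4s²) - a/s` add up
  -- to zero. Every remaining term is at most a constant times `ρ N`.
  have hkey : e * (1 + (2 * a / s + G) / (1 + (t + E / A))) - 1 + 2 * a / s * z =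
      - (a / 2) * (1 / s ^ 3) + 4 * a ^ 2 * (1 / s ^ 2) * t + 4 * a ^ 3 * (1 / s ^ 3) * (1 - t)
      + η * (1 + 2 * a * (1 / s ^ 1) * (1 - t)) + e * (2 * a * (1 / s ^ 1)) * R
      + e * G * (1 - t + R) := by
    have h1 : (2 * a / s + G) / (1 + (t + E / A)) = (2 * a / s + G) * (1 - t + R) := by
      rw [hR]; ring
    have hz : z = t - 1 / (4 * s ^ 2) + a / s := by rw [htz]; ring
    have he' : e = η + (1 - 2 * a / s + 2 * a ^ 2 / s ^ 2) := by rw [hη]; ring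
    rw [h1, hz]
    have : e * (1 + (2 * a / s + G) * (1 - t + R)) =
      e * (1 + 2 * a / s * (1 - t)) + e * (2 * a * (1 / s ^ 1)) * R + e * G * (1 - t + R) := by
      ring
    rw [this]
    have h3 : e * (1 + 2 * a / s * (1 - t)) = (η + (1 - 2 * a / s + 2 * a ^ 2 / s ^ 2)) *
      (1 + 2 * a / s * (1 - t)) := by rw [← he']
    rw [h3]
    field_simp
    ring
  rw [hkey]
  have ha2 : ‖a‖ ^ 2 ≤ 3 := by nlinarith [norm_nonneg a]
  have ha3 : ‖a‖ ^ 3 ≤ 5 := by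
    calc ‖a‖ ^ 3 ≤ (8 / 5) ^ 3 := by gcongr
      _ ≤ 5 := by norm_num
  have ht1 : ‖1 - t‖ ≤ 2 := by
    refine (norm_sub_le _ _).trans ?_
    rw [norm_one]; linarith
  have hN1 : N ≤ 1 := by linarith
  have hN2ρ : N ^ 2 ≤ ρ := le_trans (by nlinarith) hxρ
  have hN3 : N ^ 3 ≤ ρ * N := by
    calc N ^ 3 = N ^ 2 * N := by ring
      _ ≤ ρ * N := by gcongr
  have hRb1 : ‖R‖ ≤ 10 := by
    have : CE * ρ ≤ 1 := by nlinarith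
    nlinarith
  have hf : ∀ p q r u v w : ℂ, ‖p + q + r + u + v + w‖ ≤ ‖p‖ + ‖q‖ + ‖r‖ + ‖u‖ + ‖v‖ + ‖w‖ := by
    intro p q r u v w
    exact norm_add_le_of_le (norm_add_le_of_le (norm_add_le_of_le (norm_add_le_of_le
      (norm_add_le _ _) le_rfl) le_rfl) le_rfl) le_rfl
  refine (hf _ _ _ _ _ _).trans ?_
  have c1 : ‖- (a / 2) * (1 / s ^ 3)‖ ≤ 1 * (ρ * N) := by
    rw [norm_mul, norm_neg, norm_div]
    have : ‖a‖ / ‖(2 : ℂ)‖ ≤ 1 := by norm_num; linarith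
    exact mul_le_mul this ((hs2 3).trans hN3) (norm_nonneg _) (by norm_num)
  have c2 : ‖4 * a ^ 2 * (1 / s ^ 2) * t‖ ≤ 120 * (ρ * N) := by
    rw [norm_mul, norm_mul, norm_mul, norm_pow]
    calc ‖(4 : ℂ)‖ * ‖a‖ ^ 2 * ‖1 / s ^ 2‖ * ‖t‖ ≤ 4 * 3 * N ^ 2 * (10 * x) := by
          gcongr
          · norm_num
          · exact hs2 2
      _ = 120 * (N * x * N) := by ring
      _ ≤ 120 * (ρ * N) := by
        gcongr
        nlinarith
  have c3 : ‖4 * a ^ 3 * (1 / s ^ 3) * (1 - t)‖ ≤ 40 * (ρ * N) := by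
    rw [norm_mul, norm_mul, norm_mul, norm_pow]
    calc ‖(4 : ℂ)‖ * ‖a‖ ^ 3 * ‖1 / s ^ 3‖ * ‖1 - t‖ ≤ 4 * 5 * (ρ * N) * 2 := by
          gcongr
          · norm_num
          · exact (hs2 3).trans hN3
      _ = _ := by ring
  have c4 : ‖η * (1 + 2 * a * (1 / s ^ 1) * (1 - t))‖ ≤ 80 * (ρ * N) := by
    rw [norm_mul]
    have : ‖1 + 2 * a * (1 / s ^ 1) * (1 - t)‖ ≤ 8 := by
      refine (norm_add_le _ _).trans ?_
      rw [norm_one, norm_mul, norm_mul, norm_mul]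
      have : ‖(2 : ℂ)‖ * ‖a‖ * ‖1 / s ^ 1‖ * ‖1 - t‖ ≤ 2 * (8 / 5) * 1 * 2 := by
        gcongr
        · norm_num
        · refine (hs2 1).trans ?_; simpa using hN1
      linarith
    calc ‖η‖ * _ ≤ (10 * (ρ * N)) * 8 := by
          gcongr
          exact he.trans (by linarith)
      _ = _ := by ring
  have c5 : ‖e * (2 * a * (1 / s ^ 1)) * R‖ ≤ (8 * CE + 1000) * (ρ * N) := by
    rw [norm_mul, norm_mul, norm_mul, norm_mul]
    calc ‖e‖ * (‖(2 : ℂ)‖ * ‖a‖ * ‖1 / s ^ 1‖) * ‖R‖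
        ≤ 1 * (2 * (8 / 5) * N) * ((2 * CE + 288) * ρ) := by
          gcongr
          · norm_num
          · simpa using hs2 1
      _ = (32 / 5 * CE + 4608 / 5) * (ρ * N) := by ring
      _ ≤ _ := by gcongr <;> norm_num
  have c6 : ‖e * G * (1 - t + R)‖ ≤ 26 * CE * (ρ * N) * 3 + 26 * CE * (ρ * N) * ((2 * CE + 288) * ρ) := by
    rw [norm_mul, norm_mul]
    have h1 : ‖1 - t + R‖ ≤ 3 + (2 * CE + 288) * ρ := norm_add_le_of_le (ht1.trans (by norm_num)) hRb
    calc ‖e‖ * ‖G‖ * ‖1 - t + R‖ ≤ 1 * (26 * CE * (ρ * N)) * (3 + (2 * CE + 288) * ρ) := by gcongr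
      _ = _ := by ring
  have hρx : (2 * CE + 288) * ρ ≤ 5 := by
    have : CE * ρ ≤ CE * x := by gcongr
    nlinarith
  have hρN : 0 < ρ * N := by positivity
  have c7 : 26 * CE * (ρ * N) * ((2 * CE + 288) * ρ) ≤ 26 * CE * (ρ * N) * 5 := by gcongr
  have c8 : 0 ≤ CE * (ρ * N) := by positivity
  linarith
end ParabolicImplosion

/-! ### The gate coordinates and the geometry of the phases. -/

namespace ParabolicImplosion
open Complex

/-- The constant `iπ/2`. -/
noncomputable def halfPiI : ℂ := ((Real.pi / 2 : ℝ) : ℂ) * I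

/-- The scale `√(n² + k)`. -/
noncomputable def scale (n k : ℕ) : ℝ := Real.sqrt ((n : ℝ) ^ 2 + k)

/-- The scaled variable at time `k`. -/
noncomputable def scaled (n k : ℕ) (z : ℂ) : ℂ := scale n k * z + 1 / (4 * scale n k)

/-- The rotation accumulated by the model up to time `k`. -/
noncomputable def phase (n k : ℕ) : ℂ := exp (4 * halfPiI * ((scale n k - n : ℝ) : ℂ))

/-- The phase-corrected Cayley coordinate, centred and rescaled. -/
noncomputable def phaseCoord (n k : ℕ) (z : ℂ) : ℂ :=
  n * ((1 - 2 * halfPiI / (scaled n k z + halfPiI)) / phase n k - 1)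

/-- The model orbit, `-(π / (2 n + 1)) cot (π k / (2 n + 1))`. -/
noncomputable def modelOrbit (n k : ℕ) : ℂ :=
  (2 * halfPiI / (1 - exp (4 * halfPiI * ((k / (2 * n + 1) : ℝ) : ℂ))) - halfPiI) *
    (2 / (2 * n + 1))

theorem norm_halfPiI : ‖halfPiI‖ = Real.pi / 2 := by
  simp [halfPiI, abs_of_pos Real.pi_pos]

theorem halfPiI_ne_zero : halfPiI ≠ 0 := by
  rw [← norm_pos_iff, norm_halfPiI]; exact Real.pi_div_two_pos

theorem halfPiI_sq : halfPiI ^ 2 = -((Real.pi : ℂ) ^ 2 / 4) := by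
  rw [halfPiI, mul_pow, I_sq]; push_cast; ring

theorem exp_four_halfPiI (x : ℝ) : exp (4 * halfPiI * (x : ℂ)) = exp (I * ((2 * Real.pi * x : ℝ) : ℂ)) := by
  congr 1; rw [halfPiI]; push_cast; ring

theorem norm_exp_four_halfPiI (x : ℝ) : ‖exp (4 * halfPiI * (x : ℂ))‖ = 1 := by
  rw [exp_four_halfPiI, mul_comm, norm_exp_ofReal_mul_I]

/-- The chord is `2 sin(πx)`, and Jordan's inequality, reflected for `x ≥ 1/2`, bounds the sine
below by twice the distance of `x` to `{0, 1}`. -/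
theorem norm_one_sub_exp_lower {x d : ℝ} (h0 : 0 ≤ d) (h1 : d ≤ x) (h2 : d ≤ 1 - x) :
    4 * d ≤ ‖1 - exp (4 * halfPiI * (x : ℂ))‖ := by
  rw [exp_four_halfPiI, norm_sub_rev, norm_exp_I_mul_ofReal_sub_one]
  have hs : 2 * d ≤ Real.sin (2 * Real.pi * x / 2) := by
    have e : 2 * Real.pi * x / 2 = Real.pi * x := by ring
    rw [e]
    have hp := Real.pi_pos
    rcases le_total x (1 / 2) with hx | hx
    · have := Real.mul_le_sin (x := Real.pi * x) (by nlinarith) (by nlinarith)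
      have e2 : 2 / Real.pi * (Real.pi * x) = 2 * x := by field_simp
      linarith
    · have := Real.mul_le_sin (x := Real.pi * (1 - x)) (by nlinarith) (by nlinarith)
      have e2 : 2 / Real.pi * (Real.pi * (1 - x)) = 2 * (1 - x) := by field_simp
      have e3 : Real.sin (Real.pi * (1 - x)) = Real.sin (Real.pi * x) := by
        rw [← Real.sin_pi_sub]; congr 1; ring
      linarith
  rw [Real.norm_of_nonneg (by linarith)]
  linarith

theorem norm_exp_sub_exp_le (x y : ℝ) :
    ‖exp (4 * halfPiI * (x : ℂ)) - exp (4 * halfPiI * (y : ℂ))‖ ≤ 2 * Real.pi * |x - y| := by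
  have : exp (4 * halfPiI * (x : ℂ)) - exp (4 * halfPiI * (y : ℂ)) =
      exp (4 * halfPiI * (y : ℂ)) * (exp (I * ((2 * Real.pi * (x - y) : ℝ) : ℂ)) - 1) := by
    rw [← exp_four_halfPiI, mul_sub, ← exp_add, mul_one]
    congr 2; push_cast; ring
  rw [this, norm_mul, norm_exp_four_halfPiI, one_mul]
  refine (Real.norm_exp_I_mul_ofReal_sub_one_le).trans ?_
  rw [Real.norm_eq_abs, abs_mul, abs_of_pos (by positivity)]

theorem norm_one_sub_exp_upper (x : ℝ) :
    ‖1 - exp (4 * halfPiI * (x : ℂ))‖ ≤ 2 * Real.pi * min |x| |1 - x| := by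
  have h0 := norm_exp_sub_exp_le 0 x
  have h1 := norm_exp_sub_exp_le 1 x
  have e0 : exp (4 * halfPiI * ((0 : ℝ) : ℂ)) = 1 := by simp
  have e1 : exp (4 * halfPiI * ((1 : ℝ) : ℂ)) = 1 := by
    rw [← exp_two_pi_mul_I]; congr 1; rw [halfPiI]; push_cast; ring
  rw [e0] at h0; rw [e1] at h1
  rw [zero_sub, abs_neg] at h0
  rcases min_choice |x| |1 - x| with h | h <;> rw [h] <;> assumption

theorem scale_sq (n k : ℕ) : scale n k ^ 2 = (n : ℝ) ^ 2 + k := Real.sq_sqrt (by positivity)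

theorem le_scale (n k : ℕ) : (n : ℝ) ≤ scale n k := Real.le_sqrt_of_sq_le (by simp)

theorem scale_le {n k : ℕ} (h : k ≤ 2 * n + 1) : scale n k ≤ n + 1 := by
  refine Real.sqrt_le_iff.2 ⟨by positivity, ?_⟩
  have : (k : ℝ) ≤ 2 * n + 1 := by exact_mod_cast h
  nlinarith

theorem scale_sub (n k : ℕ) (hn : 1 ≤ n) : scale n k - n = k / (scale n k + n) := by
  have h1 := scale_sq n k
  have h2 := le_scale n k
  have h3 : (1 : ℝ) ≤ n := by exact_mod_cast hn
  rw [eq_div_iff (by linarith)]; nlinarith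

theorem succ_sub_scale (n k : ℕ) :
    n + 1 - scale n k = (2 * n + 1 - k) / (n + 1 + scale n k) := by
  have h1 := scale_sq n k
  have h2 := le_scale n k
  have h3 : (0 : ℝ) ≤ n := by positivity
  rw [eq_div_iff (by linarith)]; nlinarith

/-- Distance of the phases from `1` and from each other. -/
theorem phase_bounds {n k : ℕ} (hn : 1 ≤ n) {j : ℝ} (hj : 0 ≤ j) (hk : k ≤ 2 * n + 1)
    (hjm : j = min (k : ℝ) (2 * n + 1 - k)) :
    j / n ≤ ‖1 - phase n k‖ ∧ ‖1 - phase n k‖ ≤ Real.pi * j / n ∧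
    j / n ≤ ‖1 - exp (4 * halfPiI * ((k / (2 * n + 1) : ℝ) : ℂ))‖ ∧
    4 * j / (2 * n + 1) ≤ ‖1 - exp (4 * halfPiI * ((k / (2 * n + 1) : ℝ) : ℂ))‖ ∧
    ‖phase n k - exp (4 * halfPiI * ((k / (2 * n + 1) : ℝ) : ℂ))‖ ≤ 2 * j / n ^ 2 := by
  have hn' : (1 : ℝ) ≤ n := by exact_mod_cast hn
  have hk' : (k : ℝ) ≤ 2 * n + 1 := by exact_mod_cast hk
  have hk0 : (0 : ℝ) ≤ k := by positivity
  have hs1 := le_scale n k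
  have hs2 := scale_le hk
  have hs0 : 0 < scale n k := by linarith
  have e1 := scale_sub n k hn
  have e2 := succ_sub_scale n k
  have hjk : j ≤ k := hjm ▸ min_le_left _ _
  have hjl : j ≤ 2 * n + 1 - k := hjm ▸ min_le_right _ _
  have l4 : 4 * j / (2 * n + 1) ≤ ‖1 - exp (4 * halfPiI * ((k / (2 * n + 1) : ℝ) : ℂ))‖ := by
    have := norm_one_sub_exp_lower (x := k / (2 * n + 1)) (d := j / (2 * n + 1)) (by positivity)
      (by gcongr) (by
        rw [div_le_iff₀ (by positivity), sub_mul, div_mul_cancel₀ _ (by positivity)]; linarith)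
    calc _ = 4 * (j / (2 * n + 1)) := by ring
      _ ≤ _ := this
  refine ⟨?_, ?_, ?_, l4, ?_⟩
  · have := norm_one_sub_exp_lower (x := scale n k - n) (d := j / (2 * n + 2)) (by positivity)
      (by rw [e1]; exact div_le_div₀ hk0 hjk (by positivity) (by linarith)) (by
        have : 1 - (scale n k - n) = (2 * n + 1 - k) / (n + 1 + scale n k) := by rw [← e2]; ring
        rw [this]
        exact div_le_div₀ (by linarith) hjl (by positivity) (by linarith))
    refine le_trans ?_ this
    rw [div_le_iff₀ (by positivity), mul_assoc, div_mul_eq_mul_div, ← mul_div_assoc,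
      le_div_iff₀ (by positivity)]
    nlinarith
  · refine (norm_one_sub_exp_upper _).trans ?_
    have h1 : |scale n k - n| ≤ k / (2 * n) := by
      rw [abs_of_nonneg (by linarith), e1]; gcongr; linarith
    have h2 : |1 - (scale n k - n)| ≤ (2 * n + 1 - k) / (2 * n) := by
      have : 1 - (scale n k - n) = (2 * n + 1 - k) / (n + 1 + scale n k) := by rw [← e2]; ring
      have h0 : 0 ≤ 2 * (n : ℝ) + 1 - k := by linarith
      rw [this, abs_of_nonneg (div_nonneg h0 (by positivity))]; gcongr; linarith
    have h3 : min |scale n k - n| |1 - (scale n k - n)| ≤ j / (2 * n) := by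
      rw [hjm]
      rcases min_choice (k : ℝ) (2 * n + 1 - k) with h | h <;> rw [h]
      · exact (min_le_left _ _).trans h1
      · exact (min_le_right _ _).trans h2
    calc _ ≤ 2 * Real.pi * (j / (2 * n)) := by gcongr
      _ = _ := by field_simp
  · refine le_trans ?_ l4
    rw [div_le_div_iff₀ (by positivity) (by positivity)]
    nlinarith
  · refine (norm_exp_sub_exp_le _ _).trans ?_
    -- The exact phase `√(n² + k) - n` and its linear interpolation agree at `k = 0` and `k = 2n +
    -- 1`; both factors `k` and `2n + 1 - k` are therefore visible in the difference.
    have hd : scale n k - n - k / (2 * n + 1) =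
        k * (2 * n + 1 - k) / ((scale n k + n) * (2 * n + 1) * (n + 1 + scale n k)) := by
      have : scale n k - n - k / (2 * n + 1) = k * (n + 1 - scale n k) / ((scale n k + n) * (2 * n + 1)) := by
        rw [e1]; field_simp; ring
      rw [this, e2]; field_simp
    have hkl : k * (2 * n + 1 - k) ≤ j * (2 * (n : ℝ) + 1) := by
      rw [hjm]
      rcases min_choice (k : ℝ) (2 * n + 1 - k) with h | h <;> rw [h] <;> nlinarith
    have h0 : 0 ≤ 2 * (n : ℝ) + 1 - k := by linarith
    have hd0 : 0 ≤ k * (2 * (n : ℝ) + 1 - k) / ((scale n k + n) * (2 * n + 1) * (n + 1 + scale n k)) :=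
      div_nonneg (mul_nonneg hk0 h0) (by positivity)
    rw [hd, abs_of_nonneg hd0]
    have : k * (2 * n + 1 - k) / ((scale n k + n) * (2 * n + 1) * (n + 1 + scale n k)) ≤
        j * (2 * n + 1) / ((n + n) * (2 * n + 1) * (n + n)) := by
      refine div_le_div₀ (by positivity) hkl (by positivity) ?_
      exact mul_le_mul (by gcongr) (by linarith) (by positivity) (by positivity)
    have h3 : j * (2 * n + 1) / ((n + n) * (2 * n + 1) * (n + n)) = j / (4 * (n : ℝ) ^ 2) := by
      field_simp; ring
    rw [h3] at this
    calc _ ≤ 2 * Real.pi * (j / (4 * n ^ 2)) := by gcongr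
      _ = Real.pi / 2 * (j / n ^ 2) := by ring
      _ ≤ 2 * (j / n ^ 2) := by gcongr; linarith [Real.pi_lt_four]
      _ = _ := by ring
end ParabolicImplosion

/-! ### A priori bounds inside the gate and comparison with the cotangent orbit. -/

namespace ParabolicImplosion
open Complex

theorem phase_ne_zero (n k : ℕ) : phase n k ≠ 0 := exp_ne_zero _

theorem norm_phase (n k : ℕ) : ‖phase n k‖ = 1 := norm_exp_four_halfPiI _

theorem one_sub_eq_phaseCoord {n k : ℕ} (hn : 1 ≤ n) (z : ℂ) :
    1 - 2 * halfPiI / (scaled n k z + halfPiI) = (1 + phaseCoord n k z / n) * phase n k := by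
  have hn0 : (n : ℂ) ≠ 0 := by exact_mod_cast (by omega : n ≠ 0)
  have := phase_ne_zero n k
  rw [phaseCoord, mul_div_cancel_left₀ _ hn0, add_sub_cancel, div_mul_cancel₀ _ this]

/-- A priori bounds in terms of the phase-corrected coordinate. -/
theorem coord_bounds {n k : ℕ} {z : ℂ} {j C : ℝ} (hn : 1 ≤ n) (hk : k ≤ 2 * n + 1)
    (hjm : j = min (k : ℝ) (2 * n + 1 - k)) (hj1 : 1 ≤ j) (hCj : 4 * C ^ 2 ≤ j)
    (hg : ‖phaseCoord n k z‖ ≤ C * Real.sqrt j) :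
    j ≤ n ∧ C * Real.sqrt j ≤ j / 2 ∧
    j / (2 * n) ≤ ‖2 * halfPiI / (scaled n k z + halfPiI)‖ ∧
    ‖2 * halfPiI / (scaled n k z + halfPiI)‖ ≤ 4 * j / n ∧
    ‖2 * halfPiI / (scaled n k z + halfPiI) -
      (1 - exp (4 * halfPiI * ((k / (2 * n + 1) : ℝ) : ℂ)))‖ ≤ C * Real.sqrt j / n + 2 * j / n ^ 2 ∧
    1 / 2 ≤ ‖1 - 2 * halfPiI / (scaled n k z + halfPiI)‖ ∧
    ‖1 - 2 * halfPiI / (scaled n k z + halfPiI)‖ ≤ 3 / 2 ∧ ‖z‖ ≤ 9 / j ∧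
    ‖1 + phaseCoord n k z / n‖ ≤ 3 / 2 := by
  have hn' : (1 : ℝ) ≤ n := by exact_mod_cast hn
  have hn0 : (n : ℂ) ≠ 0 := by exact_mod_cast (by omega : n ≠ 0)
  have hj0 : 0 < j := by linarith
  have hjn : j ≤ n := by
    have hN : k ≤ n ∨ n + 1 ≤ k := by omega
    rcases hN with h | h
    · have : (k : ℝ) ≤ n := by exact_mod_cast h
      rw [hjm]; exact (min_le_left _ _).trans this
    · have : (n : ℝ) + 1 ≤ k := by exact_mod_cast h
      rw [hjm]; exact (min_le_right _ _).trans (by linarith)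
  have hsq : Real.sqrt j * Real.sqrt j = j := Real.mul_self_sqrt hj0.le
  -- This is where `4C² ≤ j` enters: a coordinate of size `C√j` displaces the Cayley variable by at
  -- most `j/(2n)`, half the lower bound `j/n` for the distance of the phase to `1`. So `y` stays
  -- under control.
  have h2C : 2 * C ≤ Real.sqrt j := Real.le_sqrt_of_sq_le (by nlinarith)
  have hCs : C * Real.sqrt j ≤ j / 2 := by nlinarith [Real.sqrt_nonneg j]
  obtain ⟨p1, p2, p3, p4, p5⟩ := phase_bounds hn hj0.le hk hjm
  set D := 2 * halfPiI / (scaled n k z + halfPiI) with hD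
  set g := phaseCoord n k z with hgd
  have hDe : 1 - D = (1 + g / n) * phase n k := one_sub_eq_phaseCoord hn z
  have hgn : ‖g / n‖ ≤ C * Real.sqrt j / n := by
    rw [norm_div, Complex.norm_natCast]; gcongr
  have hgn2 : ‖g / n‖ ≤ j / (2 * n) := by
    refine hgn.trans ?_
    rw [div_le_div_iff₀ (by linarith) (by linarith)]; nlinarith
  have hgn3 : ‖g / n‖ ≤ 1 / 2 := by
    refine hgn2.trans ?_
    rw [div_le_div_iff₀ (by linarith) (by linarith)]; nlinarith
  have hDg : D - (1 - phase n k) = - (g / n * phase n k) := by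
    have : D = 1 - (1 + g / n) * phase n k := by rw [← hDe]; ring
    rw [this]; ring
  have hDn : ‖D - (1 - phase n k)‖ = ‖g / n‖ := by
    rw [hDg, norm_neg, norm_mul, norm_phase, mul_one]
  have hDl : j / (2 * n) ≤ ‖D‖ := by
    have h1 := norm_sub_le D (D - (1 - phase n k))
    rw [sub_sub_cancel, hDn] at h1
    have h2 : j / n = 2 * (j / (2 * n)) := by field_simp
    linarith
  have hDu : ‖D‖ ≤ 4 * j / n := by
    have h1 := norm_add_le (D - (1 - phase n k)) (1 - phase n k)
    rw [sub_add_cancel, hDn] at h1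
    have h2 : Real.pi * j / n ≤ 3.15 * j / n := by gcongr; exact Real.pi_lt_d2.le
    have h3 : j / (2 * n) = 0.5 * (j / n) := by field_simp; norm_num
    have h4 : 3.15 * j / n = 3.15 * (j / n) := by ring
    have h5 : 4 * j / n = 4 * (j / n) := by ring
    have h6 : 0 < j / n := by positivity
    linarith
  have h1gu : ‖1 + g / n‖ ≤ 3 / 2 := by
    refine (norm_add_le _ _).trans ?_
    rw [norm_one]; linarith
  have h1gl : 1 / 2 ≤ ‖1 + g / n‖ := by
    have := norm_sub_le (1 + g / n) (g / n)
    rw [add_sub_cancel_right, norm_one] at this; linarith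
  have hωn : ‖1 - D‖ = ‖1 + g / n‖ := by rw [hDe, norm_mul, norm_phase, mul_one]
  refine ⟨hjn, hCs, hDl, hDu, ?_, by rw [hωn]; exact h1gl, by rw [hωn]; exact h1gu, ?_, h1gu⟩
  · have : D - (1 - exp (4 * halfPiI * ((k / (2 * n + 1) : ℝ) : ℂ))) =
        (D - (1 - phase n k)) -
          (phase n k - exp (4 * halfPiI * ((k / (2 * n + 1) : ℝ) : ℂ))) := by ring
    rw [this]
    refine norm_sub_le_of_le ?_ p5
    rw [hDn]; exact hgn
  · have hs1 := le_scale n k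
    have hs0 : 0 < scale n k := by linarith
    have hsC : (scale n k : ℂ) ≠ 0 := by exact_mod_cast hs0.ne'
    have hD0 : D ≠ 0 := by
      intro h0; rw [h0, norm_zero] at hDl
      have : 0 < j / (2 * n) := by positivity
      linarith
    have hy : scaled n k z = 2 * halfPiI / D - halfPiI := by
      rw [hD]
      have := halfPiI_ne_zero
      field_simp; ring
    have hz : z = (2 * halfPiI / D - halfPiI - 1 / (4 * scale n k)) / scale n k := by
      rw [← hy, scaled]; field_simp; ring
    have hpi := Real.pi_lt_d2
    have b1 : ‖2 * halfPiI / D‖ ≤ 6.3 * (n / j) := by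
      rw [norm_div, norm_mul, norm_halfPiI]
      calc ‖(2 : ℂ)‖ * (Real.pi / 2) / ‖D‖ ≤ 2 * (3.15 / 2) / (j / (2 * n)) := by
            gcongr; norm_num
        _ = _ := by field_simp; norm_num
    have b2 : ‖halfPiI‖ ≤ 1.6 * (n / j) := by
      rw [norm_halfPiI]
      have : 1 ≤ n / j := by rw [le_div_iff₀ hj0]; linarith
      nlinarith
    have b3 : ‖(1 : ℂ) / (4 * scale n k)‖ ≤ 0.25 * (n / j) := by
      rw [norm_div, norm_mul, Complex.norm_real, Real.norm_of_nonneg hs0.le]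
      have h1 : 1 ≤ n / j := by rw [le_div_iff₀ hj0]; linarith
      have h2 : ‖(1 : ℂ)‖ / (‖(4 : ℂ)‖ * scale n k) ≤ 1 / (4 * 1) := by
        gcongr
        · norm_num
        · norm_num
        · linarith
      norm_num at h2 ⊢
      linarith
    rw [hz, norm_div, Complex.norm_real, Real.norm_of_nonneg hs0.le]
    calc _ ≤ (6.3 * (n / j) + 1.6 * (n / j) + 0.25 * (n / j)) / n := by
          gcongr
          exact norm_sub_le_of_le (norm_sub_le_of_le b1 b2) b3
      _ = 8.15 / j := by field_simp; norm_num
      _ ≤ 9 / j := by gcongr; norm_num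

/-- Closeness of an orbit point to the model orbit. -/
theorem model_close {n k : ℕ} {z : ℂ} {j C : ℝ} (hn : 1 ≤ n) (hk : k ≤ 2 * n + 1)
    (hjm : j = min (k : ℝ) (2 * n + 1 - k)) (hj1 : 1 ≤ j) (hC : 0 ≤ C) (hCj : 4 * C ^ 2 ≤ j)
    (hg : ‖phaseCoord n k z‖ ≤ C * Real.sqrt j) :
    ‖z - modelOrbit n k‖ ≤ (10 * C + 30) / (j * Real.sqrt j) := by
  obtain ⟨hjn, hCs, hDl, hDu, hDD, -, -, -, -⟩ := coord_bounds hn hk hjm hj1 hCj hg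
  have hn' : (1 : ℝ) ≤ n := by exact_mod_cast hn
  have hj0 : 0 < j := by linarith
  have hsj : 1 ≤ Real.sqrt j := Real.one_le_sqrt.2 hj1
  have hsj0 : 0 < Real.sqrt j := by linarith
  have hsq : Real.sqrt j * Real.sqrt j = j := Real.mul_self_sqrt hj0.le
  have hsjj : Real.sqrt j ≤ j := by nlinarith
  obtain ⟨p1, p2, p3, p4, p5⟩ := phase_bounds hn hj0.le hk hjm
  have hs1 := le_scale n k
  have hs2 := scale_le hk
  have hs0 : 0 < scale n k := by linarith
  have hsC : (scale n k : ℂ) ≠ 0 := by exact_mod_cast hs0.ne'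
  set D := 2 * halfPiI / (scaled n k z + halfPiI) with hD
  set D' := 1 - exp (4 * halfPiI * ((k / (2 * n + 1) : ℝ) : ℂ)) with hD'
  have hD0 : D ≠ 0 := by
    intro h0; rw [h0, norm_zero] at hDl
    have : 0 < j / (2 * n) := by positivity
    linarith
  have hD'0 : D' ≠ 0 := by
    intro h0; rw [h0, norm_zero] at p3
    have : 0 < j / n := by positivity
    linarith
  have hy : scaled n k z = 2 * halfPiI / D - halfPiI := by
    rw [hD]
    have := halfPiI_ne_zero
    field_simp; ring
  have hz : z = (2 * halfPiI / D - halfPiI - 1 / (4 * scale n k)) / scale n k := by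
    rw [← hy, scaled]; field_simp; ring
  have hL : (2 * (n : ℂ) + 1) ≠ 0 := by exact_mod_cast (by omega : 2 * n + 1 ≠ 0)
  -- Three sources of error are separated: `D` against its model `D'`, the scale `s` against `n +
  -- 1/2`, and the shift in the definition of `scaled`.
  have hid : z - modelOrbit n k =
      2 * halfPiI * (D' - D) / (D * D') / scale n k
      + (2 * halfPiI / D' - halfPiI) * ((1 / scale n k - 2 / (2 * n + 1) : ℝ) : ℂ)
      - 1 / (4 * scale n k ^ 2) := by
    rw [hz, modelOrbit, ← hD']
    push_cast
    field_simp
    ring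
  have hpi := Real.pi_lt_d2
  have hnj : 1 / n ≤ 1 / (j : ℝ) := by gcongr
  have b1 : ‖2 * halfPiI * (D' - D) / (D * D') / scale n k‖ ≤ (7 * C + 14) / (j * Real.sqrt j) := by
    rw [norm_div, norm_div, norm_mul, norm_mul, norm_mul, norm_halfPiI, Complex.norm_real,
      Real.norm_of_nonneg hs0.le, norm_sub_rev]
    calc ‖(2 : ℂ)‖ * (Real.pi / 2) * ‖D - D'‖ / (‖D‖ * ‖D'‖) / scale n k
        ≤ 2 * (3.15 / 2) * (C * Real.sqrt j / n + 2 * j / n ^ 2) / (j / (2 * n) * (j / n)) / n := by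
          gcongr; norm_num
      _ = 6.3 * C * Real.sqrt j / j ^ 2 + 12.6 / (n * j) := by field_simp; ring
      _ ≤ 7 * C / (j * Real.sqrt j) + 14 / (j * Real.sqrt j) := by
          refine add_le_add ?_ ?_
          · rw [div_le_div_iff₀ (by positivity) (by positivity)]
            have : 6.3 * C * Real.sqrt j * (j * Real.sqrt j) = 6.3 * C * j ^ 2 := by
              calc _ = 6.3 * C * j * (Real.sqrt j * Real.sqrt j) := by ring
                _ = _ := by rw [hsq]; ring
            rw [this]; gcongr; norm_num
          · have h0 : j * Real.sqrt j ≤ n * j := by nlinarith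
            refine div_le_div₀ (by norm_num) (by norm_num) (by positivity) h0
      _ = _ := by ring
  have b2 : ‖(2 * halfPiI / D' - halfPiI) * ((1 / scale n k - 2 / (2 * n + 1) : ℝ) : ℂ)‖ ≤
      3 / (j * Real.sqrt j) := by
    rw [norm_mul, Complex.norm_real]
    have h1 : ‖2 * halfPiI / D' - halfPiI‖ ≤ 5 * (n / j) := by
      refine (norm_sub_le _ _).trans ?_
      rw [norm_div, norm_mul, norm_halfPiI]
      have h1 : ‖(2 : ℂ)‖ * (Real.pi / 2) / ‖D'‖ ≤ 2 * (3.15 / 2) / (j / n) := by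
        gcongr
        simp
      have h2 : 2 * (3.15 / 2) / (j / n) = 3.15 * (n / j) := by field_simp
      have h3 : 1 ≤ n / j := by rw [le_div_iff₀ hj0]; linarith
      linarith
    have h2 : ‖1 / scale n k - 2 / (2 * n + 1)‖ ≤ 1 / (2 * (n : ℝ) ^ 2) := by
      have : 1 / scale n k - 2 / (2 * n + 1) = (2 * n + 1 - 2 * scale n k) / (scale n k * (2 * n + 1)) := by
        field_simp
      rw [this, norm_div, Real.norm_of_nonneg (by positivity : 0 ≤ scale n k * (2 * n + 1))]
      refine div_le_div₀ (by norm_num) ?_ (by positivity) (by nlinarith)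
      rw [Real.norm_eq_abs, abs_le]; constructor <;> linarith
    calc _ ≤ 5 * (n / j) * (1 / (2 * (n : ℝ) ^ 2)) := by gcongr
      _ = 2.5 / (n * j) := by field_simp; norm_num
      _ ≤ 3 / (j * Real.sqrt j) := by
        have h0 : j * Real.sqrt j ≤ n * j := by nlinarith
        refine div_le_div₀ (by norm_num) (by norm_num) (by positivity) h0
  have b3 : ‖(1 : ℂ) / (4 * scale n k ^ 2)‖ ≤ 1 / (j * Real.sqrt j) := by
    rw [norm_div, norm_mul, norm_pow, Complex.norm_real, Real.norm_of_nonneg hs0.le]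
    have h0 : j * Real.sqrt j ≤ 4 * scale n k ^ 2 := by nlinarith
    rw [norm_one, Complex.norm_ofNat]
    exact one_div_le_one_div_of_le (by positivity) h0
  rw [hid]
  refine (norm_sub_le_of_le (norm_add_le_of_le b1 b2) b3).trans ?_
  rw [← add_div, ← add_div]
  exact div_le_div_of_nonneg_right (by linarith) (by positivity)
end ParabolicImplosion

/-! ### One step of the phase-corrected coordinate. -/

namespace ParabolicImplosion
open Complex

theorem exp_quadratic_bound {w : ℂ} (hw : ‖w‖ ≤ 1) :
    ‖exp w - (1 + w + w ^ 2 / 2)‖ ≤ ‖w‖ ^ 3 / 4 := by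
  have := Complex.exp_bound hw (n := 3) (by norm_num)
  simp only [Finset.sum_range_succ, Finset.sum_range_zero] at this
  norm_num [Nat.factorial] at this
  have h3 : (0 : ℝ) ≤ ‖w‖ ^ 3 := by positivity
  linarith

/-- Second-order expansion of the rotation over one step. -/
theorem rotation_bound {n k : ℕ} (hn : 100 ≤ n) :
    ‖exp (-(4 * halfPiI * ((scale n (k + 1) - scale n k : ℝ) : ℂ))) -
      (1 - 2 * halfPiI / scale n k + 2 * halfPiI ^ 2 / (scale n k : ℂ) ^ 2)‖ ≤ 10 * (1 / (n : ℝ)) ^ 3 := by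
  have hn' : (100 : ℝ) ≤ n := by exact_mod_cast hn
  set s := scale n k with hs
  set s' := scale n (k + 1) with hs'
  have hs1 : (n : ℝ) ≤ s := le_scale n k
  have hs1' : (n : ℝ) ≤ s' := le_scale n (k + 1)
  have hs0 : 0 < s := by linarith
  have hss : s' ^ 2 = s ^ 2 + 1 := by rw [hs, hs', scale_sq, scale_sq]; push_cast; ring
  have hlt : s < s' := by nlinarith
  set h : ℝ := s' - s with hh
  have hpos : 0 < h := by simp [hh, hlt]
  have hprod : h * (s' + s) = 1 := by rw [hh]; nlinarith
  have hle : h ≤ 1 / (2 * s) := by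
    rw [le_div_iff₀ (by positivity)]; nlinarith
  have hdiff : 1 / (2 * s) - h = h ^ 2 / (2 * s) := by
    field_simp; nlinarith
  have hsq : h ^ 2 ≤ 1 / (4 * s ^ 2) := by
    calc h ^ 2 ≤ (1 / (2 * s)) ^ 2 := by gcongr
      _ = _ := by field_simp; norm_num
  have hdiff2 : 1 / (2 * s) - h ≤ 1 / (8 * s ^ 3) := by
    rw [hdiff]
    calc h ^ 2 / (2 * s) ≤ 1 / (4 * s ^ 2) / (2 * s) := by gcongr
      _ = _ := by field_simp; norm_num
  have hpi := Real.pi_lt_d2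
  have hpi0 := Real.pi_pos
  have hsC : (s : ℂ) ≠ 0 := by exact_mod_cast hs0.ne'
  set w : ℂ := -(4 * halfPiI * (h : ℂ)) with hw
  have hwn : ‖w‖ = 2 * Real.pi * h := by
    rw [hw, norm_neg, norm_mul, norm_mul, norm_halfPiI, Complex.norm_real,
      Real.norm_of_nonneg hpos.le, Complex.norm_ofNat]; ring
  have hwn2 : ‖w‖ ≤ 3.15 / s := by
    rw [hwn]
    calc 2 * Real.pi * h ≤ 2 * 3.15 * (1 / (2 * s)) := by gcongr
      _ = _ := by field_simp
  have hw1 : ‖w‖ ≤ 1 := by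
    refine hwn2.trans ?_
    rw [div_le_one hs0]; linarith
  set w0 : ℂ := -(2 * halfPiI / s) with hw0
  have hww : w - w0 = 4 * halfPiI * ((1 / (2 * s) - h : ℝ) : ℂ) := by
    rw [hw, hw0]; push_cast; field_simp; ring
  have hwwn : ‖w - w0‖ ≤ 0.8 / s ^ 3 := by
    rw [hww, norm_mul, norm_mul, norm_halfPiI, Complex.norm_real, Complex.norm_ofNat,
      Real.norm_of_nonneg (by rw [hdiff]; positivity)]
    calc 4 * (Real.pi / 2) * (1 / (2 * s) - h) ≤ 4 * (3.15 / 2) * (1 / (8 * s ^ 3)) := by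
          gcongr
      _ = 0.7875 / s ^ 3 := by field_simp; norm_num
      _ ≤ _ := by gcongr; norm_num
  have hw0n : ‖w0‖ ≤ 3.15 / s := by
    rw [hw0, norm_neg, norm_div, norm_mul, norm_halfPiI, Complex.norm_real, Complex.norm_ofNat,
      Real.norm_of_nonneg hs0.le]
    gcongr; linarith
  have hw01 : ‖w0‖ ≤ 1 := by
    refine hw0n.trans ?_
    rw [div_le_one hs0]; linarith
  have hid : exp w - (1 - 2 * halfPiI / s + 2 * halfPiI ^ 2 / (s : ℂ) ^ 2) =
      (exp w - (1 + w + w ^ 2 / 2)) + (w - w0) * (1 + (w + w0) / 2) := by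
    rw [hw0]; field_simp; ring
  rw [hid]
  have hb1 := exp_quadratic_bound hw1
  have hb2 : ‖1 + (w + w0) / 2‖ ≤ 2 := by
    refine (norm_add_le _ _).trans ?_
    rw [norm_one, norm_div, Complex.norm_ofNat]
    have := norm_add_le w w0
    linarith
  calc _ ≤ ‖w‖ ^ 3 / 4 + 0.8 / s ^ 3 * 2 := by
        refine norm_add_le_of_le hb1 ?_
        rw [norm_mul]; gcongr
    _ ≤ (3.15 / s) ^ 3 / 4 + 0.8 / s ^ 3 * 2 := by gcongr
    _ = ((3.15) ^ 3 / 4 + 1.6) * (1 / s) ^ 3 := by field_simp; norm_num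
    _ ≤ 10 * (1 / s) ^ 3 := by gcongr; norm_num
    _ ≤ _ := by gcongr

/-- All errors of `scaled_step_bound` are compared with `n/(j³√j)`, given `|z| ≤ 9/j`. The quartic
term dominates the constant: `2·9⁴ = 13122`, and `81 + 4` more come from the last two terms. -/
theorem scaled_error_le {n j s Z ε B : ℝ} (hj1 : 1 ≤ j) (hjn : j ≤ n) (hB : 0 ≤ B)
    (hn1 : 1 ≤ n) (hs1 : n ≤ s) (hs2n : s ≤ 2 * n) (hZ0 : 0 ≤ Z) (hz : Z ≤ 9 / j)
    (hε0 : 0 ≤ ε) (he : ε ≤ B / (n ^ 3 * Real.sqrt n)) :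
    s * Z ^ 4 + 2 * s * ε + Z ^ 2 / s + 4 / s ^ 3 ≤
      (13300 + 4 * B) * (1 / (j * Real.sqrt j) * (1 / j) ^ 2 / (1 / n)) := by
  have hsj : 1 ≤ Real.sqrt j := Real.one_le_sqrt.2 hj1
  have hj0 : 0 < j := by linarith
  have hsq : Real.sqrt j * Real.sqrt j = j := Real.mul_self_sqrt hj0.le
  have hsjj : Real.sqrt j ≤ j := by nlinarith
  have hn0 : 0 < n := by linarith
  have hs0 : 0 < s := by linarith
  set W := 1 / (j * Real.sqrt j) * (1 / j) ^ 2 / (1 / n) with hW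
  have hq : W = n / (j ^ 3 * Real.sqrt j) := by
    rw [hW]; field_simp
  have t1 : s * Z ^ 4 ≤ 13122 * W := by
    calc s * Z ^ 4 ≤ (2 * n) * (9 / j) ^ 4 := by gcongr
      _ = 13122 * (n / j ^ 4) := by field_simp; norm_num
      _ ≤ _ := by
        rw [hq]; gcongr
        calc j ^ 3 * Real.sqrt j ≤ j ^ 3 * j := by gcongr
          _ = j ^ 4 := by ring
  have t2 : 2 * s * ε ≤ 4 * B * W := by
    calc 2 * s * ε ≤ 2 * (2 * n) * (B / (n ^ 3 * Real.sqrt n)) := by gcongr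
      _ = 4 * B * (n / (n ^ 3 * Real.sqrt n)) := by ring
      _ ≤ _ := by rw [hq]; gcongr
  have hn2 : 1 ≤ n ^ 2 := by nlinarith
  have t3 : Z ^ 2 / s ≤ 81 * W := by
    calc Z ^ 2 / s ≤ (9 / j) ^ 2 / n := by gcongr
      _ = 81 * (1 / (j ^ 2 * n)) := by field_simp; norm_num
      _ ≤ _ := by
        rw [hq]
        gcongr ?_ * ?_
        rw [div_le_div_iff₀ (by positivity) (by positivity), one_mul]
        calc j ^ 3 * Real.sqrt j ≤ j ^ 3 * j := by gcongr
          _ = j ^ 2 * (j * j) := by ring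
          _ ≤ j ^ 2 * (n * n) := by gcongr
          _ = _ := by ring
  have t4 : 4 / s ^ 3 ≤ 4 * W := by
    calc 4 / s ^ 3 ≤ 4 / n ^ 3 := by gcongr
      _ = 4 * (1 / n ^ 3) := by ring
      _ ≤ _ := by
        rw [hq]
        gcongr ?_ * ?_
        rw [div_le_div_iff₀ (by positivity) (by positivity), one_mul]
        calc j ^ 3 * Real.sqrt j ≤ j ^ 3 * j := by gcongr
          _ ≤ n ^ 3 * n := by gcongr
          _ = _ := by ring
  have hp : 0 ≤ W := by positivity
  linarith

/-- The multiplicative increment of `1 + g/n` becomes an additive one for `g`: replacing `n(1 +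
g/n)` by `s` costs `O(√j)` against `z/s`, and replacing `z` by the model `zt` costs `O(1/(j√j))`.
The result is summable over the gate. -/
theorem phase_difference_bound {n : ℕ} {s j B C : ℝ} {g g' Q z zt : ℂ} (hj1 : 1 ≤ j) (hjn : j ≤ n)
    (hn1 : (1 : ℝ) ≤ n) (hC : 1 ≤ C) (hs1 : n ≤ s) (hs2 : s ≤ n + 1)
    (hz : ‖z‖ ≤ 9 / j) (hmc : ‖z - zt‖ ≤ (10 * C + 30) / (j * Real.sqrt j))
    (hg : ‖g‖ ≤ C * Real.sqrt j) (hg2 : ‖1 + g / n‖ ≤ 3 / 2)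
    (hQ : ‖Q‖ ≤ (220 * (13300 + 4 * B) + 2000) * (1 / (j * Real.sqrt j) * (1 / (n : ℝ))))
    (hgg : 1 + g' / n = (1 + g / n) * (1 + Q - 2 * halfPiI / s * z)) :
    ‖g' - g + 2 * halfPiI * zt‖ ≤
      (330 * (13300 + 4 * B) + 70 * C + 4000) / (j * Real.sqrt j) := by
  have hj0 : 0 < j := by linarith
  have hn0 : (0 : ℝ) < n := by linarith
  have hs0 : 0 < s := by linarith
  have hnC : (n : ℂ) ≠ 0 := by exact_mod_cast hn0.ne'
  have hsC : (s : ℂ) ≠ 0 := by exact_mod_cast hs0.ne'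
  have hsj : 1 ≤ Real.sqrt j := Real.one_le_sqrt.2 hj1
  have hsj0 : 0 < Real.sqrt j := by linarith
  have hsq : Real.sqrt j * Real.sqrt j = j := Real.mul_self_sqrt hj0.le
  have hpi := Real.pi_lt_d2
  have hpi0 := Real.pi_pos
  have hfin : g' - g + 2 * halfPiI * zt =
      n * (1 + g / n) * Q - 2 * halfPiI * ((n * (1 + g / n) - s) / s) * z
        - 2 * halfPiI * (z - zt) := by
    have e1 : g' = n * ((1 + g / n) * (1 + Q - 2 * halfPiI / s * z)) - n := by
      rw [← hgg]; field_simp; ring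
    rw [e1]; field_simp; ring
  rw [hfin]
  set ρ := 1 / (j * Real.sqrt j) with hρ
  have hρ0 : 0 < ρ := by positivity
  have hng : ‖(n : ℂ) * (1 + g / n)‖ ≤ 3 / 2 * n := by
    rw [norm_mul, Complex.norm_natCast]; nlinarith
  have c1 : ‖n * (1 + g / n) * Q‖ ≤ (330 * (13300 + 4 * B) + 3000) * ρ := by
    rw [norm_mul]
    calc _ ≤ 3 / 2 * n * ((220 * (13300 + 4 * B) + 2000) * (ρ * (1 / (n : ℝ)))) := by gcongr
      _ = _ := by field_simp; ring
  have hnj : Real.sqrt j / (n * j) ≤ ρ := by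
    rw [hρ, div_le_div_iff₀ (by positivity) (by positivity)]
    calc Real.sqrt j * (j * Real.sqrt j) = j * (Real.sqrt j * Real.sqrt j) := by ring
      _ ≤ _ := by rw [hsq]; nlinarith
  have c2 : ‖2 * halfPiI * ((n * (1 + g / n) - s) / s) * z‖ ≤ (30 * C + 30) * ρ := by
    have e1 : n * (1 + g / n) - s = g + ((n - s : ℝ) : ℂ) := by push_cast; field_simp; ring
    have e2 : ‖n * (1 + g / n) - s‖ ≤ (C + 1) * Real.sqrt j := by
      rw [e1]
      have h1 : ‖((n - s : ℝ) : ℂ)‖ ≤ 1 := by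
        rw [Complex.norm_real, Real.norm_eq_abs, abs_le]; constructor <;> linarith
      refine (norm_add_le_of_le hg h1).trans ?_
      linarith
    rw [norm_mul, norm_mul, norm_mul, norm_div, norm_halfPiI, Complex.norm_ofNat,
      Complex.norm_real, Real.norm_of_nonneg hs0.le]
    calc 2 * (Real.pi / 2) * (‖n * (1 + g / n) - s‖ / s) * ‖z‖
        ≤ 2 * (3.15 / 2) * ((C + 1) * Real.sqrt j / n) * (9 / j) := by gcongr
      _ = 28.35 * (C + 1) * (Real.sqrt j / (n * j)) := by field_simp; norm_num
      _ ≤ 28.35 * (C + 1) * ρ := by gcongr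
      _ ≤ _ := by gcongr ?_ * ρ; linarith
  have c3 : ‖2 * halfPiI * (z - zt)‖ ≤ (40 * C + 120) * ρ := by
    rw [norm_mul, norm_mul, norm_halfPiI, Complex.norm_ofNat]
    calc 2 * (Real.pi / 2) * ‖z - zt‖
        ≤ 2 * (4 / 2) * ((10 * C + 30) / (j * Real.sqrt j)) := by
          gcongr; linarith
      _ = _ := by rw [hρ]; ring
  refine (norm_sub_le_of_le (norm_sub_le_of_le c1 c2) c3).trans ?_
  have : (330 * (13300 + 4 * B) + 70 * C + 4000) / (j * Real.sqrt j) =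
    (330 * (13300 + 4 * B) + 70 * C + 4000) * ρ := by rw [hρ]; ring
  rw [this, ← add_mul, ← add_mul]
  gcongr ?_ * ρ
  linarith

set_option maxHeartbeats 4000000 in
/-- One step of the perturbed map in the phase-corrected coordinate. -/
theorem phaseCoord_step {n k : ℕ} {b z e : ℂ} {j B C : ℝ} (hb : ‖b‖ ≤ 1)
    (hk : k ≤ 2 * n + 1) (hjm : j = min (k : ℝ) (2 * n + 1 - k))
    (hB : 0 ≤ B) (hC : 1 ≤ C) (hCj : 4 * C ^ 2 ≤ j) (hBj : 13300 + 4 * B ≤ j)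
    (hg : ‖phaseCoord n k z‖ ≤ C * Real.sqrt j) (hA : scaled n k z + halfPiI ≠ 0)
    (he : ‖e‖ ≤ B / (n ^ 3 * Real.sqrt n)) :
    scaled n (k + 1) (z + z ^ 2 + b * z ^ 4 + (Real.pi : ℂ) ^ 2 / 4 / (n ^ 2 + k) + e) + halfPiI ≠ 0 ∧
    ‖phaseCoord n (k + 1) (z + z ^ 2 + b * z ^ 4 + (Real.pi : ℂ) ^ 2 / 4 / (n ^ 2 + k) + e)
      - phaseCoord n k z + 2 * halfPiI * modelOrbit n k‖ ≤
      (330 * (13300 + 4 * B) + 70 * C + 4000) / (j * Real.sqrt j) := by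
  have hj1 : 1 ≤ j := by linarith
  have hj0 : 0 < j := by linarith
  have hk0 : 0 ≤ 2 * (n : ℝ) + 1 - k := by
    have : (k : ℝ) ≤ 2 * n + 1 := by exact_mod_cast hk
    linarith
  have hn : 1 ≤ n := by
    by_contra h
    have h0 : n = 0 := by omega
    have hjl : j ≤ 2 * n + 1 - k := hjm ▸ min_le_right _ _
    have hjk : j ≤ k := hjm ▸ min_le_left _ _
    rw [h0] at hjl
    norm_num at hjl
    linarith
  obtain ⟨hjn, hCs, hDl, hDu, hDD, hω1, hω2, hz, hg2⟩ := coord_bounds hn hk hjm hj1 hCj hg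
  have hmc := model_close hn hk hjm hj1 (by linarith) hCj hg
  have hn' : (13300 : ℝ) ≤ n := by linarith
  have hn100 : 100 ≤ n := by
    have : (100 : ℝ) ≤ n := by linarith
    exact_mod_cast this
  have hn0 : (0 : ℝ) < n := by linarith
  have hnC : (n : ℂ) ≠ 0 := by exact_mod_cast hn0.ne'
  set s := scale n k with hs
  set s' := scale n (k + 1) with hs'
  have hs1 : (n : ℝ) ≤ s := le_scale n k
  have hs2 : s ≤ n + 1 := scale_le hk
  have hs1' : (n : ℝ) ≤ s' := le_scale n (k + 1)
  have hs0 : 0 < s := by linarith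
  have hsC : (s : ℂ) ≠ 0 := by exact_mod_cast hs0.ne'
  have hss : s' ^ 2 = s ^ 2 + 1 := by rw [hs, hs', scale_sq, scale_sq]; push_cast; ring
  have hsc : (n : ℂ) ^ 2 + k = (s : ℂ) ^ 2 := by
    have := scale_sq n k
    rw [← hs] at this
    exact_mod_cast this.symm
  rw [hsc]
  set y := scaled n k z with hy
  set z' := z + z ^ 2 + b * z ^ 4 + (Real.pi : ℂ) ^ 2 / 4 / (s : ℂ) ^ 2 + e with hz'
  set y' := scaled n (k + 1) z' with hy'
  have hz1 : ‖z‖ ≤ 1 := hz.trans (by rw [div_le_one hj0]; linarith)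
  have hEb := scaled_step_bound (by linarith : 1 ≤ s) (by linarith : 0 < s') hss (e := e) hb hz1
    (hy : y = s * z + 1 / (4 * s)) (hy' : y' = s' * z' + 1 / (4 * s'))
  set E := y' - y - (y ^ 2 + (Real.pi : ℂ) ^ 2 / 4) / s with hE
  have hsj : 1 ≤ Real.sqrt j := Real.one_le_sqrt.2 hj1
  have hsj0 : 0 < Real.sqrt j := by linarith
  have hsq : Real.sqrt j * Real.sqrt j = j := Real.mul_self_sqrt hj0.le
  have hsjj : Real.sqrt j ≤ j := by nlinarith
  set x := 1 / j with hx
  set N := 1 / (n : ℝ) with hN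
  set ρ := 1 / (j * Real.sqrt j) with hρ
  have hx0 : 0 < x := by positivity
  have hN0 : 0 < N := by positivity
  have hNx : N ≤ x := by rw [hN, hx]; gcongr
  have hxρ : x ^ 2 ≤ ρ := by
    rw [hx, hρ, one_div_pow]
    exact one_div_le_one_div_of_le (by positivity) (by nlinarith)
  have hρx : ρ ≤ x := by
    rw [hx, hρ]
    exact one_div_le_one_div_of_le (by positivity) (by nlinarith)
  have hρ0 : 0 < ρ := by positivity
  have hEb2 : ‖E‖ ≤ (13300 + 4 * B) * (ρ * x ^ 2 / N) :=
    hEb.trans (scaled_error_le hj1 hjn hB (by linarith) hs1 (by linarith) (norm_nonneg z) hz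
      (norm_nonneg e) he)
  have hy'E : y' = y + (y ^ 2 - halfPiI ^ 2) / s + E := by
    rw [hE, halfPiI_sq]; ring
  have hpi := Real.pi_lt_d2
  have hpi0 := Real.pi_pos
  set A := y + halfPiI with hAd
  set D := 2 * halfPiI / A with hD
  have hD0 : D ≠ 0 := div_ne_zero (mul_ne_zero two_ne_zero halfPiI_ne_zero) hA
  have hpi' : 0 < ‖halfPiI‖ := by rw [norm_halfPiI]; positivity
  have hAi : ‖A⁻¹‖ ≤ 2 * N / x := by
    have : A⁻¹ = D / (2 * halfPiI) := by
      rw [hD]; have := halfPiI_ne_zero; field_simp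
    rw [this, norm_div, norm_mul, norm_halfPiI, Complex.norm_ofNat]
    calc ‖D‖ / (2 * (Real.pi / 2)) ≤ (4 * j / n) / (2 * (3 / 2)) := by
          gcongr; exact Real.pi_gt_three.le
      _ ≤ 2 * j / n := by
        have : 0 < j / n := by positivity
        have e1 : (4 * j / n) / (2 * (3 / 2)) = 4 / 3 * (j / n) := by ring
        have e2 : 2 * j / n = 2 * (j / n) := by ring
        rw [e1, e2]; linarith
      _ = _ := by rw [hN, hx]; field_simp
  set t := (y - halfPiI) / s with ht
  have htz : t = z + 1 / (4 * (s : ℂ) ^ 2) - halfPiI / s := by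
    rw [ht, hy, scaled, ← hs]; field_simp
  have htb : ‖t‖ ≤ 10 * x := by
    have e1 : y - halfPiI = 2 * halfPiI * (1 - D) / D := by
      rw [hD, hAd]; have := halfPiI_ne_zero
      rw [hAd] at hA
      field_simp; ring
    rw [ht, e1, norm_div, norm_div, norm_mul, norm_mul, norm_halfPiI, Complex.norm_ofNat,
      Complex.norm_real, Real.norm_of_nonneg hs0.le]
    calc 2 * (Real.pi / 2) * ‖1 - D‖ / ‖D‖ / s ≤ 2 * (3.15 / 2) * (3 / 2) / (j / (2 * n)) / n := by
          gcongr
      _ = 9.45 * (1 / j) := by field_simp; norm_num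
      _ ≤ _ := by rw [hx]; gcongr; norm_num
  have hrot := rotation_bound (k := k) hn100
  rw [← hs, ← hs'] at hrot
  set ex := exp (-(4 * halfPiI * ((s' - s : ℝ) : ℂ))) with hex
  have hexn : ‖ex‖ = 1 := by
    have : ex = exp (4 * halfPiI * ((s - s' : ℝ) : ℂ)) := by rw [hex]; congr 1; push_cast; ring
    rw [this, norm_exp_four_halfPiI]
  obtain ⟨hne, hQ⟩ := phase_step_bound (a := halfPiI) (s := s) (z := z) (t := t) (e := ex)
    (ω := 1 - D) (E := E) (A := A) (x := x) (N := N) (ρ := ρ) (CE := 13300 + 4 * B)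
    (by rw [norm_halfPiI]; linarith) hsC
    (by rw [norm_inv, Complex.norm_real, Real.norm_of_nonneg hs0.le, hN, one_div]
        exact inv_anti₀ hn0 hs1) hN0 hNx
    (by rw [hx]; exact one_div_le_one_div_of_le (by norm_num) (by linarith)) hxρ hρx
    (by linarith) (by rw [hx, mul_one_div, div_le_one hj0]; exact hBj) hEb2 hA hAi htb htz hω1
    hexn.le hrot rfl rfl
  obtain ⟨hA', hω'⟩ := cayley_step hsC hA hy'E hne
  rw [← hAd, ← ht, ← hD] at hω'
  have hA'0 : y' + halfPiI ≠ 0 := by rw [hA']; exact mul_ne_zero hA hne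
  refine ⟨hA'0, ?_⟩
  have hω0 : 1 - D ≠ 0 := by
    intro h0; rw [h0, norm_zero] at hω1; linarith
  set Q := ex * (1 + (2 * halfPiI / s + 2 * halfPiI * E / (A ^ 2 * (1 - D))) / (1 + (t + E / A))) - 1
    + 2 * halfPiI / s * z with hQd
  set g := phaseCoord n k z with hgd
  set g' := phaseCoord n (k + 1) z' with hgd'
  have hv : 1 - D = (1 + g / n) * phase n k := one_sub_eq_phaseCoord hn z
  have hv' : 1 - 2 * halfPiI / (y' + halfPiI) = (1 + g' / n) * phase n (k + 1) :=
    one_sub_eq_phaseCoord hn z'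
  -- `ex` is the inverse rotation over one step; it turns the Cayley ratio into the ratio of the
  -- factors `1 + g/n`.
  have hph : phase n k = ex * phase n (k + 1) := by
    rw [phase, phase, hex, ← exp_add]; congr 1; push_cast; ring
  have hph0 := phase_ne_zero n (k + 1)
  have hrat : 1 - 2 * halfPiI / (y' + halfPiI) = (1 - D) *
      (1 + (2 * halfPiI / s + 2 * halfPiI * E / (A ^ 2 * (1 - D))) / (1 + (t + E / A))) := by
    rw [hω']
    generalize 1 + (t + E / A) = q at hne
    generalize 1 - D = ω at hω0
    field_simp
  have hgg : 1 + g' / n = (1 + g / n) * (1 + Q - 2 * halfPiI / s * z) := by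
    have e1 : (1 + g' / n) * phase n (k + 1) = (1 + g / n) * (ex * phase n (k + 1)) *
      (1 + (2 * halfPiI / s + 2 * halfPiI * E / (A ^ 2 * (1 - D))) / (1 + (t + E / A))) := by
      rw [← hv', hrat, hv, hph]
    have e2 : 1 + Q - 2 * halfPiI / s * z = ex *
      (1 + (2 * halfPiI / s + 2 * halfPiI * E / (A ^ 2 * (1 - D))) / (1 + (t + E / A))) := by
      rw [hQd]; ring
    rw [e2]
    apply mul_right_cancel₀ hph0
    rw [e1]; ring
  exact phase_difference_bound hj1 hjn (by linarith) hC hs1 hs2 hz hmc hg hg2 hQ hgg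
end ParabolicImplosion

/-! ### Summation of the increments through the gate. -/

namespace ParabolicImplosion
open Complex Finset

/-- Telescoping of `4/√k`. -/
theorem sum_inv_mul_sqrt_le {m k : ℕ} (hm : 1 ≤ m) (hk : m ≤ k) :
    ∑ i ∈ Ico m k, 1 / ((i : ℝ) * Real.sqrt i) ≤ 4 / Real.sqrt m - 4 / Real.sqrt k := by
  induction k, hk using Nat.le_induction with
  | base => simp
  | succ k hk ih =>
    rw [sum_Ico_succ_top hk]
    have hk1 : (1 : ℝ) ≤ k := by exact_mod_cast hm.trans hk
    have hstep : 1 / ((k : ℝ) * Real.sqrt k) ≤ 4 / Real.sqrt k - 4 / Real.sqrt (k + 1 : ℕ) := by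
      push_cast
      set p := Real.sqrt k with hp
      set q := Real.sqrt ((k : ℝ) + 1) with hq
      have hp2 : p * p = k := Real.mul_self_sqrt (by linarith)
      have hq2 : q * q = k + 1 := Real.mul_self_sqrt (by linarith)
      have hp0 : 1 ≤ p := Real.one_le_sqrt.2 hk1
      have hq0 : 0 < q := Real.sqrt_pos.2 (by linarith)
      have hpq : p ≤ q := Real.sqrt_le_sqrt (by linarith)
      have hq3 : q ≤ 3 / 2 * p := by nlinarith
      rw [← hp2, div_sub_div _ _ (by positivity) (by positivity),
        div_le_div_iff₀ (by positivity) (by positivity)]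
      have h1 : (q - p) * (q + p) = 1 := by nlinarith
      have h2 : q * (q + p) ≤ 4 * p ^ 2 := by nlinarith
      have h3 : 0 < q + p := by linarith
      have h4 : q ≤ 4 * p ^ 2 * (q - p) := by
        have h5 : q * ((q - p) * (q + p)) ≤ 4 * p ^ 2 * (q - p) := by
          have : 0 ≤ q - p := by linarith
          calc q * ((q - p) * (q + p)) = (q * (q + p)) * (q - p) := by ring
            _ ≤ _ := by gcongr
        rwa [h1, mul_one] at h5
      calc 1 * (p * q) = p * q := by ring
        _ ≤ p * (4 * p ^ 2 * (q - p)) := by gcongr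
        _ = _ := by ring
    linarith

theorem sum_inv_le_sqrt {m k : ℕ} (hm : 1 ≤ m) :
    ∑ i ∈ Ico m (k + 1), 1 / (i : ℝ) ≤ 2 * Real.sqrt k := by
  induction k with
  | zero => rw [Ico_eq_empty (by omega)]; simp
  | succ k ih =>
    rcases Nat.lt_or_ge (k + 1) m with h | h
    · rw [Ico_eq_empty (by omega)]; simp
    rw [sum_Ico_succ_top (by omega)]
    have hstep : 1 / ((k + 1 : ℕ) : ℝ) ≤ 2 * Real.sqrt (k + 1 : ℕ) - 2 * Real.sqrt k := by
      push_cast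
      set p := Real.sqrt k with hp
      set q := Real.sqrt ((k : ℝ) + 1) with hq
      have hp2 : p * p = k := Real.mul_self_sqrt (by positivity)
      have hq2 : q * q = k + 1 := Real.mul_self_sqrt (by positivity)
      have hp0 : 0 ≤ p := Real.sqrt_nonneg _
      have hq0 : 1 ≤ q := Real.one_le_sqrt.2 (by linarith [(Nat.cast_nonneg k : (0:ℝ) ≤ k)])
      have hpq : p ≤ q := Real.sqrt_le_sqrt (by linarith)
      rw [← hq2, div_le_iff₀ (by positivity)]
      have h1 : (q - p) * (q + p) = 1 := by nlinarith
      have h0 : 0 ≤ q - p := by linarith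
      have h2 : (q - p) * (q + p) ≤ (q - p) * (2 * (q * q)) := by
        gcongr; nlinarith
      linarith
    linarith

/-- This is `cot(π - θ) = -cot θ`; it is the reason why the main increments leave no net effect. -/
theorem modelOrbit_reflect {n k : ℕ} (hk1 : 1 ≤ k) (hk : k ≤ 2 * n) :
    modelOrbit n (2 * n + 1 - k) = - modelOrbit n k := by
  have hL : ((2 * n + 1 : ℝ)) ≠ 0 := by positivity
  set x : ℝ := k / (2 * n + 1) with hx
  have e1 : (((2 * n + 1 - k : ℕ) / (2 * n + 1) : ℝ)) = 1 - x := by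
    rw [Nat.cast_sub (by omega), hx]; push_cast; field_simp
  have e2 : exp (4 * halfPiI * ((1 - x : ℝ) : ℂ)) = (exp (4 * halfPiI * (x : ℂ)))⁻¹ := by
    rw [← exp_neg]
    have : 4 * halfPiI * ((1 - x : ℝ) : ℂ) = -(4 * halfPiI * (x : ℂ)) + 2 * Real.pi * I := by
      rw [halfPiI]; push_cast; ring
    rw [this, exp_add, exp_two_pi_mul_I, mul_one]
  have hq1 : 1 - exp (4 * halfPiI * (x : ℂ)) ≠ 0 := by
    have h1 : (1 : ℝ) ≤ k := by exact_mod_cast hk1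
    have h2 : (k : ℝ) ≤ 2 * n := by exact_mod_cast hk
    have := norm_one_sub_exp_lower (x := x) (d := 1 / (2 * n + 1)) (by positivity)
      (by rw [hx]; gcongr) (by
        rw [div_le_iff₀ (by positivity), sub_mul, hx, div_mul_cancel₀ _ hL]; linarith)
    intro h0; rw [h0, norm_zero] at this
    have h3 : (0 : ℝ) < 4 * (1 / (2 * n + 1)) := by positivity
    linarith
  rw [modelOrbit, modelOrbit, e1, e2, ← neg_mul]
  congr 1
  have hq0 := exp_ne_zero (4 * halfPiI * (x : ℂ))
  set q := exp (4 * halfPiI * (x : ℂ))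
  have hq2 : 1 - q⁻¹ ≠ 0 := by
    intro h0; apply hq1
    have : q⁻¹ = 1 := by linear_combination -h0
    rw [inv_eq_one.1 this]; ring
  have hq3 : q - 1 ≠ 0 := fun h => hq1 (by linear_combination -h)
  have : 1 - q⁻¹ = (q - 1) / q := by field_simp
  rw [this]
  have : (1 - q) = - (q - 1) := by ring
  rw [this]
  field_simp
  ring

theorem norm_modelOrbit_le {n k : ℕ} {j : ℝ} (hn : 1 ≤ n) (hk : k ≤ 2 * n + 1) (hj : 0 < j)
    (hjm : j = min (k : ℝ) (2 * n + 1 - k)) : ‖modelOrbit n k‖ ≤ 2 / j := by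
  obtain ⟨-, -, -, p4, -⟩ := phase_bounds hn hj.le hk hjm
  have hqn := norm_exp_four_halfPiI (k / (2 * n + 1) : ℝ)
  rw [modelOrbit]
  set q := exp (4 * halfPiI * ((k / (2 * n + 1) : ℝ) : ℂ)) with hq
  have hn' : (1 : ℝ) ≤ n := by exact_mod_cast hn
  have hpos : 0 < 4 * j / (2 * n + 1) := by positivity
  have hq1 : 1 - q ≠ 0 := by
    intro h0; rw [h0, norm_zero] at p4; linarith
  have e1 : 2 * halfPiI / (1 - q) - halfPiI = halfPiI * (1 + q) / (1 - q) := by field_simp; ring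
  have hL : ‖(2 : ℂ) / (2 * n + 1)‖ = 2 / (2 * n + 1) := by
    have : (2 : ℂ) / (2 * n + 1) = ((2 / (2 * n + 1) : ℝ) : ℂ) := by push_cast; ring
    rw [this, Complex.norm_real, Real.norm_of_nonneg (by positivity)]
  have h2 : ‖1 + q‖ ≤ 2 := by
    refine (norm_add_le _ _).trans ?_
    rw [norm_one, hqn]; norm_num
  rw [e1, norm_mul, norm_div, norm_mul, norm_halfPiI, hL]
  calc Real.pi / 2 * ‖1 + q‖ / ‖1 - q‖ * (2 / (2 * n + 1))
      ≤ 4 / 2 * 2 / (4 * j / (2 * n + 1)) * (2 / (2 * n + 1)) := by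
        gcongr; exact Real.pi_lt_four.le
    _ = 2 / j := by field_simp

theorem sum_modelOrbit_symm {n p : ℕ} (hp : 1 ≤ p) (hpn : p ≤ 2 * n + 1) :
    ∑ i ∈ Ico p (2 * n + 1 + 1 - p), modelOrbit n i = 0 := by
  have h := sum_Ico_reflect (fun i => modelOrbit n i) p (m := 2 * n + 1 + 1 - p) (n := 2 * n + 1)
    (by omega)
  have e : 2 * n + 1 + 1 - (2 * n + 1 + 1 - p) = p := by omega
  rw [e] at h
  have h2 : ∑ i ∈ Ico p (2 * n + 1 + 1 - p), modelOrbit n (2 * n + 1 - i) =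
      ∑ i ∈ Ico p (2 * n + 1 + 1 - p), - modelOrbit n i := by
    refine sum_congr rfl fun i hi => ?_
    rw [mem_Ico] at hi
    exact modelOrbit_reflect (by omega) (by omega)
  rw [h2, sum_neg_distrib] at h
  exact self_eq_neg.1 h.symm

/-- Beyond the midpoint the symmetric central block cancels, which leaves a sum over indices below
`2n + 2 - k`. The harmonic sum is bounded crudely by a square root, which is the growth that the
bootstrap in `phaseCoord_transit` tolerates. -/
theorem norm_sum_modelOrbit_le {n m k : ℕ} (hm : 1 ≤ m) (hmk : m ≤ k) (hk : k + m ≤ 2 * n + 1) :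
    ‖∑ i ∈ Ico m k, modelOrbit n i‖ ≤ 4 * Real.sqrt (min (k : ℝ) (2 * n + 1 - k)) := by
  have hn : 1 ≤ n := by omega
  have key : ∀ l : ℕ, l ≤ n → ‖∑ i ∈ Ico m (l + 1), modelOrbit n i‖ ≤ 4 * Real.sqrt l := by
    intro l hl
    refine (norm_sum_le _ _).trans ?_
    have : ∀ i ∈ Ico m (l + 1), ‖modelOrbit n i‖ ≤ 2 * (1 / (i : ℝ)) := by
      intro i hi
      rw [mem_Ico] at hi
      have h0 : (0 : ℝ) < i := by exact_mod_cast (by omega : 0 < i)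
      have h1 : (i : ℝ) ≤ n := by exact_mod_cast (by omega : i ≤ n)
      have := norm_modelOrbit_le (n := n) (k := i) (j := i) hn (by omega) h0
        (by rw [min_eq_left]; linarith)
      rw [mul_one_div]; exact this
    refine (sum_le_sum this).trans ?_
    rw [← mul_sum]
    have := sum_inv_le_sqrt (m := m) (k := l) hm
    linarith
  rcases Nat.lt_or_ge n k with h | h
  · have hsplit : ∑ i ∈ Ico m k, modelOrbit n i =
        ∑ i ∈ Ico m (2 * n + 1 - k + 1), modelOrbit n i := by
      rw [← sum_Ico_consecutive _ (by omega : m ≤ 2 * n + 1 - k + 1) (by omega : 2 * n + 1 - k + 1 ≤ k)]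
      have := sum_modelOrbit_symm (n := n) (p := 2 * n + 1 - k + 1) (by omega) (by omega)
      have e : 2 * n + 1 + 1 - (2 * n + 1 - k + 1) = k := by omega
      rw [e] at this
      rw [this, add_zero]
    rw [hsplit]
    refine (key _ (by omega)).trans ?_
    rw [Nat.cast_sub (by omega), min_eq_right]
    · push_cast; rfl
    · have : (n : ℝ) + 1 ≤ k := by exact_mod_cast h
      linarith
  · obtain ⟨l, rfl⟩ : ∃ l, k = l + 1 := ⟨k - 1, by omega⟩
    refine (key l (by omega)).trans ?_
    have : ((l + 1 : ℕ) : ℝ) ≤ n := by exact_mod_cast h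
    push_cast at this ⊢
    gcongr
    rw [le_min_iff]; constructor <;> linarith

theorem sum_inv_min_le {n m k : ℕ} (hm : 1 ≤ m) (hmk : m ≤ k) (hk : k + m ≤ 2 * n + 1) :
    ∑ i ∈ Ico m k, 1 / (min (i : ℝ) (2 * n + 1 - i) * Real.sqrt (min (i : ℝ) (2 * n + 1 - i))) ≤
      8 / Real.sqrt m := by
  have h1 : ∀ i ∈ Ico m k, 1 / (min (i : ℝ) (2 * n + 1 - i) *
      Real.sqrt (min (i : ℝ) (2 * n + 1 - i))) ≤ 1 / ((i : ℝ) * Real.sqrt i) +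
      (fun i : ℕ => 1 / ((i : ℝ) * Real.sqrt i)) (2 * n + 1 - i) := by
    intro i hi
    rw [mem_Ico] at hi
    simp only
    rw [Nat.cast_sub (by omega)]
    push_cast
    have h2 : (i : ℝ) ≤ 2 * n + 1 := by exact_mod_cast (by omega : i ≤ 2 * n + 1)
    have h3 : 0 ≤ 2 * (n : ℝ) + 1 - i := by linarith
    rcases min_choice (i : ℝ) (2 * n + 1 - i) with h | h <;> rw [h]
    · have : 0 ≤ 1 / ((2 * (n : ℝ) + 1 - i) * Real.sqrt (2 * n + 1 - i)) := by positivity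
      linarith
    · have : 0 ≤ 1 / ((i : ℝ) * Real.sqrt i) := by positivity
      linarith
  refine (sum_le_sum h1).trans ?_
  rw [sum_add_distrib, sum_Ico_reflect (fun i : ℕ => 1 / ((i : ℝ) * Real.sqrt i)) m
    (by omega : k ≤ 2 * n + 1 + 1)]
  have a1 := sum_inv_mul_sqrt_le hm hmk
  have a2 := sum_inv_mul_sqrt_le (m := 2 * n + 1 + 1 - k) (k := 2 * n + 1 + 1 - m) (by omega) (by omega)
  have a3 : 4 / Real.sqrt ((2 * n + 1 + 1 - k : ℕ)) ≤ 4 / Real.sqrt m := by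
    have : (m : ℝ) ≤ ((2 * n + 1 + 1 - k : ℕ) : ℝ) := by exact_mod_cast (by omega)
    have h0 : (0 : ℝ) < m := by exact_mod_cast hm
    gcongr
  have a4 : 0 ≤ 4 / Real.sqrt k := by positivity
  have a5 : 0 ≤ 4 / Real.sqrt ((2 * n + 1 + 1 - m : ℕ)) := by positivity
  have a6 : 8 / Real.sqrt m = 4 / Real.sqrt m + 4 / Real.sqrt m := by ring
  rw [a6]
  exact add_le_add (by linarith) (by linarith)

/-- The phase-corrected coordinate is almost invariant through the gate. -/
theorem phaseCoord_transit {n m : ℕ} {b : ℂ} {z e : ℕ → ℂ} {B G K : ℝ} (hb : ‖b‖ ≤ 1)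
    (hB : 0 ≤ B) (hG : 0 ≤ G) (hK : K = 330 * (13300 + 4 * B) + 70 * (G + 14) + 4000)
    (hm1 : 4 * (G + 14) ^ 2 ≤ m) (hm2 : 8 * K ≤ m) (hmn : m ≤ n)
    (hz : ∀ k, m ≤ k → k + m < 2 * n + 1 → z (k + 1) =
      z k + z k ^ 2 + b * z k ^ 4 + (Real.pi : ℂ) ^ 2 / 4 / (n ^ 2 + k) + e k)
    (he : ∀ k, m ≤ k → k + m < 2 * n + 1 → ‖e k‖ ≤ B / (n ^ 3 * Real.sqrt n))
    (hg : ‖phaseCoord n m (z m)‖ ≤ G * Real.sqrt m) (hA : scaled n m (z m) + halfPiI ≠ 0) :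
    scaled n (2 * n + 1 - m) (z (2 * n + 1 - m)) + halfPiI ≠ 0 ∧
    ‖phaseCoord n (2 * n + 1 - m) (z (2 * n + 1 - m)) - phaseCoord n m (z m)‖ ≤
      (8 * K + 8) / Real.sqrt m := by
  have hm0 : (1 : ℝ) ≤ m := by nlinarith
  have hmN : 1 ≤ m := by exact_mod_cast hm0
  have hsm : 1 ≤ Real.sqrt m := Real.one_le_sqrt.2 hm0
  have hsm0 : 0 < Real.sqrt m := by linarith
  have hsmm : Real.sqrt m * Real.sqrt m = m := Real.mul_self_sqrt (by linarith)
  have hK0 : 0 < K := by rw [hK]; positivity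
  have hπ : ‖2 * halfPiI‖ ≤ 3.15 := by
    rw [norm_mul, norm_halfPiI, Complex.norm_ofNat]; linarith [Real.pi_lt_d2]
  -- A bootstrap: the accumulated bound yields the size condition needed for the next step. The
  -- constant `14` covers `1` from the errors, as `8K ≤ m`, and `3.15·4 = 12.6` from the partial
  -- sums of the model.
  have main : ∀ k, m ≤ k → k + m ≤ 2 * n + 1 → scaled n k (z k) + halfPiI ≠ 0 ∧
      ‖phaseCoord n k (z k) - phaseCoord n m (z m) +
        2 * halfPiI * ∑ i ∈ Ico m k, modelOrbit n i‖ ≤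
      K * ∑ i ∈ Ico m k, 1 / (min (i : ℝ) (2 * n + 1 - i) *
        Real.sqrt (min (i : ℝ) (2 * n + 1 - i))) := by
    intro k hk
    induction k, hk using Nat.le_induction with
    | base => intro _; exact ⟨hA, by simp⟩
    | succ k hk ih =>
      intro hk2
      obtain ⟨ih1, ih2⟩ := ih (by omega)
      set j := min (k : ℝ) (2 * n + 1 - k) with hj
      have hmj : (m : ℝ) ≤ j := by
        rw [hj, le_min_iff]
        have h1 : (m : ℝ) ≤ k := by exact_mod_cast hk
        have h2 : (k : ℝ) + m ≤ 2 * n + 1 := by exact_mod_cast (by omega : k + m ≤ 2 * n + 1)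
        exact ⟨h1, by linarith⟩
      have hsmj : Real.sqrt m ≤ Real.sqrt j := Real.sqrt_le_sqrt hmj
      have hs1 := sum_inv_min_le hmN hk (by omega : k + m ≤ 2 * n + 1)
      have hs2 := norm_sum_modelOrbit_le hmN hk (by omega : k + m ≤ 2 * n + 1)
      rw [← hj] at hs2
      have hgk : ‖phaseCoord n k (z k)‖ ≤ (G + 14) * Real.sqrt j := by
        set S := ∑ i ∈ Ico m k, modelOrbit n i
        have e1 : phaseCoord n k (z k) = (phaseCoord n k (z k) - phaseCoord n m (z m) +
          2 * halfPiI * S) + phaseCoord n m (z m) - 2 * halfPiI * S := by ring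
        have b1 : K * ∑ i ∈ Ico m k, 1 / (min (i : ℝ) (2 * n + 1 - i) *
            Real.sqrt (min (i : ℝ) (2 * n + 1 - i))) ≤ Real.sqrt m := by
          calc _ ≤ K * (8 / Real.sqrt m) := by gcongr
            _ = (8 * K) / Real.sqrt m := by ring
            _ ≤ Real.sqrt m := by rw [div_le_iff₀ hsm0, hsmm]; exact hm2
        have b2 : ‖2 * halfPiI * S‖ ≤ 3.15 * (4 * Real.sqrt j) := by
          rw [norm_mul]; gcongr
        rw [e1]
        refine (norm_sub_le_of_le (norm_add_le_of_le (ih2.trans b1) hg) b2).trans ?_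
        nlinarith
      obtain ⟨s1, s2⟩ := phaseCoord_step (e := e k) hb (by omega : k ≤ 2 * n + 1) hj hB
        (by linarith : 1 ≤ G + 14) (hm1.trans hmj) (by linarith) hgk ih1 (he k hk (by omega))
      rw [← hz k hk (by omega)] at s1 s2
      refine ⟨s1, ?_⟩
      rw [sum_Ico_succ_top hk, sum_Ico_succ_top hk, mul_add, mul_add]
      have e2 : phaseCoord n (k + 1) (z (k + 1)) - phaseCoord n m (z m) +
          (2 * halfPiI * ∑ i ∈ Ico m k, modelOrbit n i + 2 * halfPiI * modelOrbit n k) =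
          (phaseCoord n k (z k) - phaseCoord n m (z m) +
            2 * halfPiI * ∑ i ∈ Ico m k, modelOrbit n i) +
          (phaseCoord n (k + 1) (z (k + 1)) - phaseCoord n k (z k) +
            2 * halfPiI * modelOrbit n k) := by ring
      rw [e2]
      refine norm_add_le_of_le ih2 (s2.trans_eq ?_)
      rw [hK, ← hj]; ring
  obtain ⟨r1, r2⟩ := main (2 * n + 1 - m) (by omega) (by omega)
  refine ⟨r1, ?_⟩
  have hs1 := sum_inv_min_le hmN (by omega : m ≤ 2 * n + 1 - m) (by omega : (2 * n + 1 - m) + m ≤ 2 * n + 1)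
  -- The range omits the last index `2n + 1 - m` of the symmetric block, so the sum is the single
  -- term `modelOrbit n m`.
  have hlast : ‖∑ i ∈ Ico m (2 * n + 1 - m), modelOrbit n i‖ ≤ 2 / m := by
    have h1 := sum_modelOrbit_symm (n := n) (p := m) hmN (by omega)
    have e : 2 * n + 1 + 1 - m = (2 * n + 1 - m) + 1 := by omega
    rw [e, sum_Ico_succ_top (by omega), modelOrbit_reflect hmN (by omega)] at h1
    have h2 : ∑ i ∈ Ico m (2 * n + 1 - m), modelOrbit n i = modelOrbit n m := by
      linear_combination h1
    rw [h2]
    have h3 : (m : ℝ) ≤ n := by exact_mod_cast hmn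
    exact norm_modelOrbit_le (by omega) (by omega) (by linarith) (by rw [min_eq_left]; linarith)
  set S := ∑ i ∈ Ico m (2 * n + 1 - m), modelOrbit n i
  have e1 : phaseCoord n (2 * n + 1 - m) (z (2 * n + 1 - m)) - phaseCoord n m (z m) =
    (phaseCoord n (2 * n + 1 - m) (z (2 * n + 1 - m)) - phaseCoord n m (z m) + 2 * halfPiI * S)
      - 2 * halfPiI * S := by ring
  rw [e1]
  have b2 : ‖2 * halfPiI * S‖ ≤ 8 / Real.sqrt m := by
    rw [norm_mul]
    calc ‖2 * halfPiI‖ * ‖S‖ ≤ 4 * (2 / m) := by gcongr; linarith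
      _ = 8 / m := by ring
      _ ≤ 8 / Real.sqrt m := by
        gcongr
        nlinarith
  refine (norm_sub_le_of_le r2 b2).trans ?_
  calc _ ≤ K * (8 / Real.sqrt m) + 8 / Real.sqrt m := by gcongr
    _ = _ := by ring
end ParabolicImplosion

/-! ### Entrance and exit of the gate, and the transit law. -/

namespace ParabolicImplosion
open Complex

theorem exp_linear_bounds {x : ℂ} (hx : ‖x‖ ≤ 1) :
    ‖exp x - 1 - x‖ ≤ ‖x‖ ^ 2 ∧ ‖exp x - 1‖ ≤ 2 * ‖x‖ :=
  ⟨Complex.norm_exp_sub_one_sub_id_le hx, Complex.norm_exp_sub_one_le hx⟩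

theorem norm_shift_le {s : ℝ} (hs : 1 ≤ s) : ‖halfPiI + 1 / (4 * s)‖ ≤ 2 := by
  refine (norm_add_le _ _).trans ?_
  rw [norm_halfPiI, norm_div, norm_mul, Complex.norm_real, norm_one, Complex.norm_ofNat,
    Real.norm_of_nonneg (by linarith)]
  have : 1 / (4 * s) ≤ 1 / (4 * 1) := by gcongr
  linarith [Real.pi_lt_d2]

/-- The phase-corrected coordinate at the entrance of the gate. -/
theorem phaseCoord_entrance {n m : ℕ} {z : ℂ} {M : ℝ} (hm : 1 ≤ m) (hmM : (m : ℝ) ≤ M)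
    (hz : z ≠ 0) (hzM : ‖1 / z‖ ≤ M) (hn : 4 * M ≤ n) :
    scaled n m z + halfPiI ≠ 0 ∧
    ‖phaseCoord n m z - 2 * halfPiI * (-1 / z - m)‖ ≤ 60 * M ^ 2 / n := by
  have hm1 : (1 : ℝ) ≤ m := by exact_mod_cast hm
  have hM1 : 1 ≤ M := hm1.trans hmM
  have hn1 : (1 : ℝ) ≤ n := by linarith
  have hnN : 1 ≤ n := by exact_mod_cast hn1
  have hn0 : (0 : ℝ) < n := by linarith
  have hmn : m ≤ 2 * n + 1 := by
    have : (m : ℝ) ≤ n := by linarith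
    have : m ≤ n := by exact_mod_cast this
    omega
  set s := scale n m with hs
  have hs1 : (n : ℝ) ≤ s := le_scale n m
  have hs2 : s ≤ n + 1 := scale_le hmn
  have hs0 : 0 < s := by linarith
  have hsn : s - n = m / (s + n) := scale_sub n m hnN
  have hsC : (s : ℂ) ≠ 0 := by exact_mod_cast hs0.ne'
  have hnC : (n : ℂ) ≠ 0 := by exact_mod_cast hn0.ne'
  set ζ := 1 / z with hζ
  have hζ0 : ζ ≠ 0 := one_div_ne_zero hz
  have hzζ : z = 1 / ζ := by rw [hζ, one_div_one_div]
  set c := halfPiI + 1 / (4 * s) with hc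
  have hcn : ‖c‖ ≤ 2 := norm_shift_le (by linarith)
  have hcζ : ‖c * ζ‖ ≤ 2 * M := by rw [norm_mul]; gcongr
  have hden : n / 2 ≤ ‖s + c * ζ‖ := by
    have := norm_sub_le (s + c * ζ) (c * ζ)
    rw [add_sub_cancel_right, Complex.norm_real, Real.norm_of_nonneg hs0.le] at this
    linarith
  have hden0 : s + c * ζ ≠ 0 := by
    intro h; rw [h, norm_zero] at hden; linarith
  have hy : scaled n m z + halfPiI = (s + c * ζ) / ζ := by
    rw [scaled, ← hs, hzζ, hc]; field_simp; ring
  refine ⟨by rw [hy]; exact div_ne_zero hden0 hζ0, ?_⟩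
  have hpi := Real.pi_lt_d2
  have hpi0 := Real.pi_pos
  have h2a : ‖2 * halfPiI‖ ≤ 3.15 := by
    rw [norm_mul, norm_halfPiI, Complex.norm_ofNat]; linarith
  set D := 2 * halfPiI / (scaled n m z + halfPiI) with hD
  have hDe : D = 2 * halfPiI * ζ / (s + c * ζ) := by rw [hD, hy]; field_simp
  set x : ℂ := 4 * halfPiI * ((s - n : ℝ) : ℂ) with hx
  have hxn : ‖x‖ ≤ 3.15 * m / n := by
    rw [hx, norm_mul, norm_mul, norm_halfPiI, Complex.norm_ofNat, Complex.norm_real,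
      Real.norm_of_nonneg (by linarith), hsn]
    calc 4 * (Real.pi / 2) * (m / (s + n)) ≤ 4 * (3.15 / 2) * (m / (n + n)) := by gcongr
      _ = _ := by field_simp; norm_num
  have hx1 : ‖x‖ ≤ 1 := by
    refine hxn.trans ?_
    rw [div_le_one hn0]; linarith
  obtain ⟨ex1, ex2⟩ := exp_linear_bounds (x := -x) (by rwa [norm_neg])
  rw [norm_neg] at ex1 ex2
  set p := exp (-x) with hp
  have hpn : ‖p‖ = 1 := by
    have : -x = 4 * halfPiI * ((n - s : ℝ) : ℂ) := by rw [hx]; push_cast; ring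
    rw [hp, this, norm_exp_four_halfPiI]
  have hgeq : phaseCoord n m z = n * ((1 - D) * p - 1) := by
    rw [phaseCoord, ← hD, phase, ← hs, div_eq_mul_inv, ← exp_neg]
  -- To first order `p = 1 - x`, `n x ≈ 2am` and `n D ≈ 2aζ`, so `n((1 - D)p - 1) ≈ -2aζ - 2am`.
  have hsplit : phaseCoord n m z - 2 * halfPiI * (-1 / z - m) =
      n * (p - 1 - -x) - (n * x - 2 * halfPiI * m)
        - ((n * D - 2 * halfPiI * ζ) * p + 2 * halfPiI * ζ * (p - 1)) := by
    rw [hgeq]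
    have : -1 / z = -ζ := by rw [hζ]; ring
    rw [this]; ring
  rw [hsplit]
  have b1 : ‖n * (p - 1 - -x)‖ ≤ 10 * M ^ 2 / n := by
    rw [norm_mul, Complex.norm_natCast]
    calc n * ‖p - 1 - -x‖ ≤ n * (3.15 * m / n) ^ 2 := by
          gcongr
          exact ex1.trans (by gcongr)
      _ = 9.9225 * (m : ℝ) ^ 2 / n := by field_simp; norm_num
      _ ≤ _ := by gcongr; norm_num
  have b2 : ‖n * x - 2 * halfPiI * m‖ ≤ 2 * M ^ 2 / n := by
    have : n * x - 2 * halfPiI * m = 2 * halfPiI * ((m * (n - s) / (s + n) : ℝ) : ℂ) := by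
      rw [hx, hsn]; push_cast
      have h0 : (s : ℂ) + n ≠ 0 := by exact_mod_cast (by linarith : s + (n : ℝ) ≠ 0)
      field_simp; ring
    have h1 : ‖(m : ℝ) * (n - s)‖ ≤ M * 1 := by
      rw [norm_mul, Real.norm_of_nonneg (by positivity : (0 : ℝ) ≤ m)]
      have h1 : ‖(n : ℝ) - s‖ ≤ 1 := by rw [Real.norm_eq_abs, abs_le]; constructor <;> linarith
      gcongr
    rw [this, norm_mul, Complex.norm_real, norm_div,
      Real.norm_of_nonneg (by linarith : 0 ≤ s + (n : ℝ))]
    calc ‖2 * halfPiI‖ * (‖(m : ℝ) * (n - s)‖ / (s + n)) ≤ 4 * (M * 1 / (n + n)) := by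
          gcongr; linarith
      _ = 2 * M / n := by field_simp; norm_num
      _ ≤ _ := by gcongr; nlinarith
  have b3 : ‖(n * D - 2 * halfPiI * ζ) * p‖ ≤ 20 * M ^ 2 / n := by
    rw [norm_mul, hpn, mul_one]
    have : n * D - 2 * halfPiI * ζ =
        2 * halfPiI * ζ * (((n - s : ℝ) : ℂ) - c * ζ) / (s + c * ζ) := by
      have hq : ((n - s : ℝ) : ℂ) - c * ζ = n - (s + c * ζ) := by push_cast; ring
      rw [hDe, hq]
      generalize (s : ℂ) + c * ζ = q at hden0 ⊢
      field_simp
    rw [this, norm_div, norm_mul, norm_mul]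
    have h1 : ‖((n - s : ℝ) : ℂ) - c * ζ‖ ≤ 3 * M := by
      have h1 : ‖((n - s : ℝ) : ℂ)‖ ≤ 1 := by
        rw [Complex.norm_real, Real.norm_eq_abs, abs_le]; constructor <;> linarith
      exact (norm_sub_le_of_le h1 hcζ).trans (by linarith)
    calc _ ≤ 3.15 * M * (3 * M) / (n / 2) := by gcongr
      _ = 18.9 * M ^ 2 / n := by field_simp; norm_num
      _ ≤ _ := by gcongr; norm_num
  have b4 : ‖2 * halfPiI * ζ * (p - 1)‖ ≤ 20 * M ^ 2 / n := by
    rw [norm_mul, norm_mul]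
    calc _ ≤ 3.15 * M * (2 * (3.15 * M / n)) := by
          gcongr
          exact ex2.trans (by gcongr; exact hxn.trans (by gcongr))
      _ = 19.845 * M ^ 2 / n := by field_simp; norm_num
      _ ≤ _ := by gcongr; norm_num
  refine (norm_sub_le_of_le (norm_sub_le_of_le b1 b2) (norm_add_le_of_le b3 b4)).trans ?_
  rw [← add_div, ← add_div, ← add_div]
  gcongr
  nlinarith

set_option maxHeartbeats 1000000 in
/-- The phase-corrected coordinate at the exit of the gate. -/
theorem phaseCoord_exit {n m : ℕ} {z : ℂ} {R : ℝ} (hm : 1 ≤ m) (hmR : (m : ℝ) ≤ R)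
    (hn : 30 * R ≤ n) (hA : scaled n (2 * n + 1 - m) z + halfPiI ≠ 0)
    (hg : ‖phaseCoord n (2 * n + 1 - m) z‖ ≤ R) :
    z ≠ 0 ∧
    ‖1 / z - (m - phaseCoord n (2 * n + 1 - m) z / (2 * halfPiI))‖ ≤ 30 * R ^ 2 / n := by
  have hm1 : (1 : ℝ) ≤ m := by exact_mod_cast hm
  have hR1 : 1 ≤ R := hm1.trans hmR
  have hn1 : (1 : ℝ) ≤ n := by linarith
  have hnN : 1 ≤ n := by exact_mod_cast hn1
  have hn0 : (0 : ℝ) < n := by linarith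
  have hmn : m ≤ n := by
    have : (m : ℝ) ≤ n := by linarith
    exact_mod_cast this
  set k := 2 * n + 1 - m with hk
  set s := scale n k with hs
  have hs1 : (n : ℝ) ≤ s := le_scale n k
  have hs2 : s ≤ n + 1 := scale_le (by omega)
  have hs0 : 0 < s := by linarith
  have hkm : 2 * (n : ℝ) + 1 - k = m := by
    rw [hk, Nat.cast_sub (by omega)]; push_cast; ring
  have hsn : n + 1 - s = m / (n + 1 + s) := by
    have := succ_sub_scale n k
    rwa [hkm] at this
  have hsC : (s : ℂ) ≠ 0 := by exact_mod_cast hs0.ne'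
  have hnC : (n : ℂ) ≠ 0 := by exact_mod_cast hn0.ne'
  have ha0 := halfPiI_ne_zero
  set c := halfPiI + 1 / (4 * s) with hc
  have hcn : ‖c‖ ≤ 2 := norm_shift_le (by linarith)
  have hpi := Real.pi_lt_d2
  have hpi3 := Real.pi_gt_three
  have h2an : ‖2 * halfPiI‖ = Real.pi := by
    rw [norm_mul, norm_halfPiI, Complex.norm_ofNat]; ring
  set g := phaseCoord n k z with hgd
  set D := 2 * halfPiI / (scaled n k z + halfPiI) with hD
  have hD0 : D ≠ 0 := div_ne_zero (mul_ne_zero two_ne_zero ha0) hA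
  set x : ℂ := 4 * halfPiI * ((s - n - 1 : ℝ) : ℂ) with hx
  -- Since `4a = 2πi`, a full turn can be dropped; near the exit the scale is close to `n + 1`, and
  -- the remaining exponent is small.
  have hph : phase n k = exp x := by
    have : 4 * halfPiI * ((scale n k - n : ℝ) : ℂ) = x + 2 * Real.pi * I := by
      rw [hx, ← hs, halfPiI]; push_cast; ring
    rw [phase, this, exp_add, exp_two_pi_mul_I, mul_one]
  have hxn : ‖x‖ ≤ 3.15 * R / n := by
    rw [hx, norm_mul, norm_mul, norm_halfPiI, Complex.norm_ofNat, Complex.norm_real,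
      Real.norm_of_nonpos (by linarith)]
    have : -(s - n - 1) = m / (n + 1 + s) := by rw [← hsn]; ring
    rw [this]
    calc 4 * (Real.pi / 2) * (m / (n + 1 + s)) ≤ 4 * (3.15 / 2) * (R / (n + n)) := by
          gcongr; linarith
      _ = _ := by field_simp; norm_num
  have hx1 : ‖x‖ ≤ 1 := by
    refine hxn.trans ?_
    rw [div_le_one hn0]; linarith
  obtain ⟨ex1, ex2⟩ := exp_linear_bounds hx1
  have hDe : 1 - D = (1 + g / n) * exp x := by
    rw [← hph]; exact one_sub_eq_phaseCoord hnN z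
  set p := exp x with hp
  set h := 2 * halfPiI * m - g with hh
  have hnD : n * D - h = - (n * (p - 1 - x)) - (n * x + 2 * halfPiI * m) - g * (p - 1) := by
    have : D = 1 - (1 + g / n) * p := by rw [← hDe]; ring
    rw [this, hh]; field_simp; ring
  have b1 : ‖- (n * (p - 1 - x))‖ ≤ 10 * R ^ 2 / n := by
    rw [norm_neg, norm_mul, Complex.norm_natCast]
    calc n * ‖p - 1 - x‖ ≤ n * (3.15 * R / n) ^ 2 := by
          gcongr
          exact ex1.trans (by gcongr)
      _ = 9.9225 * R ^ 2 / n := by field_simp; norm_num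
      _ ≤ _ := by gcongr; norm_num
  have b2 : ‖n * x + 2 * halfPiI * m‖ ≤ 4 * R ^ 2 / n := by
    have : n * x + 2 * halfPiI * m = 2 * halfPiI * ((m * (1 + s - n) / (n + 1 + s) : ℝ) : ℂ) := by
      have e1 : x = -(4 * halfPiI * ((m / (n + 1 + s) : ℝ) : ℂ)) := by
        rw [hx, ← hsn]; push_cast; ring
      rw [e1]; push_cast
      have h0 : (n : ℂ) + 1 + s ≠ 0 := by
        exact_mod_cast (by linarith : (n : ℝ) + 1 + s ≠ 0)
      field_simp; ring
    have h0 : 0 ≤ 1 + s - n := by linarith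
    have h1 : m * (1 + s - n) / (n + 1 + s) ≤ R * 2 / (n + n) :=
      div_le_div₀ (by positivity) (mul_le_mul hmR (by linarith) h0 (by linarith)) (by positivity)
        (by linarith)
    rw [this, norm_mul, h2an, Complex.norm_real,
      Real.norm_of_nonneg (div_nonneg (by positivity) (by positivity))]
    calc Real.pi * (m * (1 + s - n) / (n + 1 + s)) ≤ 4 * (R * 2 / (n + n)) := by
          gcongr; linarith
      _ = 4 * R / n := by field_simp; norm_num
      _ ≤ _ := by gcongr; nlinarith
  have b3 : ‖g * (p - 1)‖ ≤ 7 * R ^ 2 / n := by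
    rw [norm_mul]
    calc _ ≤ R * (2 * (3.15 * R / n)) := by
          gcongr
          exact ex2.trans (by gcongr)
      _ = 6.3 * R ^ 2 / n := by field_simp; norm_num
      _ ≤ _ := by gcongr; norm_num
  have hnDh : ‖n * D - h‖ ≤ 21 * R ^ 2 / n := by
    rw [hnD]
    refine (norm_sub_le_of_le (norm_sub_le_of_le b1 b2) b3).trans ?_
    rw [← add_div, ← add_div]
    gcongr
    nlinarith
  have hhn : ‖h‖ ≤ 5 * R := by
    refine (norm_sub_le _ _).trans ?_
    rw [norm_mul, h2an, Complex.norm_natCast]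
    nlinarith
  have h21 : 21 * R ^ 2 / n ≤ R := by
    rw [div_le_iff₀ hn0]; nlinarith
  have hDn : ‖D‖ ≤ 6 * R / n := by
    have h1 := norm_add_le (n * D - h) h
    rw [sub_add_cancel, norm_mul, Complex.norm_natCast] at h1
    rw [le_div_iff₀ hn0]; linarith
  have hD4 : ‖D‖ ≤ 1 / 4 := by
    refine hDn.trans ?_
    rw [div_le_iff₀ hn0]; linarith
  have hcD : ‖c * D‖ ≤ 1 / 2 := by
    rw [norm_mul]
    calc ‖c‖ * ‖D‖ ≤ 2 * (1 / 4) := by gcongr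
      _ = _ := by norm_num
  have hden : 2 ≤ ‖2 * halfPiI - c * D‖ := by
    have := norm_sub_norm_le (2 * halfPiI) (c * D)
    rw [h2an] at this; linarith
  have hden0 : 2 * halfPiI - c * D ≠ 0 := by
    intro h0; rw [h0, norm_zero] at hden; linarith
  have hz : z = (2 * halfPiI - c * D) / (s * D) := by
    have h1 : scaled n k z + halfPiI = 2 * halfPiI / D := by
      rw [hD]; field_simp
    have h2 : (s : ℂ) * z + c = 2 * halfPiI / D := by
      rw [← h1, scaled, hc, ← hs]; ring
    have h3 : (s : ℂ) * z = 2 * halfPiI / D - c := by linear_combination h2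
    rw [eq_div_iff (mul_ne_zero hsC hD0)]
    calc z * (s * D) = (s * z) * D := by ring
      _ = _ := by rw [h3]; field_simp
  refine ⟨by rw [hz]; exact div_ne_zero hden0 (mul_ne_zero hsC hD0), ?_⟩
  have hid : 1 / z - (m - g / (2 * halfPiI)) =
      D * (2 * halfPiI * ((s - n : ℝ) : ℂ) + n * (c * D)) / (2 * halfPiI * (2 * halfPiI - c * D))
        + (n * D - h) / (2 * halfPiI) := by
    rw [hz, hh]
    generalize c * D = q at hden0
    push_cast
    field_simp
    ring
  rw [hid]
  have c1 : ‖D * (2 * halfPiI * ((s - n : ℝ) : ℂ) + n * (c * D)) /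
      (2 * halfPiI * (2 * halfPiI - c * D))‖ ≤ 16 * R ^ 2 / n := by
    have h1 : ‖2 * halfPiI * ((s - n : ℝ) : ℂ) + n * (c * D)‖ ≤ 16 * R := by
      refine (norm_add_le _ _).trans ?_
      rw [norm_mul, h2an, Complex.norm_real, Real.norm_of_nonneg (by linarith), norm_mul,
        Complex.norm_natCast, norm_mul]
      have h2 : (n : ℝ) * (‖c‖ * ‖D‖) ≤ n * (2 * (6 * R / n)) := by gcongr
      have h3 : (n : ℝ) * (2 * (6 * R / n)) = 12 * R := by field_simp; norm_num
      have h4 : Real.pi * (s - n) ≤ 4 * 1 :=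
        mul_le_mul (by linarith) (by linarith) (by linarith) (by norm_num)
      linarith
    rw [norm_div, norm_mul, norm_mul, h2an]
    calc _ ≤ 6 * R / n * (16 * R) / (3 * 2) := by gcongr
      _ = _ := by field_simp; norm_num
  have c2 : ‖(n * D - h) / (2 * halfPiI)‖ ≤ 7 * R ^ 2 / n := by
    rw [norm_div, h2an]
    calc _ ≤ 21 * R ^ 2 / n / 3 := by gcongr
      _ = _ := by ring
  refine (norm_add_le_of_le c1 c2).trans ?_
  rw [← add_div]
  gcongr
  nlinarith

/-- Passage through the gate: `-1 / z` is carried to `1 / z` with the expected transit time. -/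
theorem gate_transit {B C : ℝ} (hB : 0 ≤ B) (hC : 0 ≤ C) :
    ∃ K : ℝ, 0 < K ∧ ∃ m₀ : ℕ, 1 ≤ m₀ ∧ ∀ m : ℕ, m₀ ≤ m → ∃ n₀ : ℕ, ∀ n : ℕ, n₀ ≤ n → m ≤ n ∧
      ∀ (b : ℂ) (z e : ℕ → ℂ), ‖b‖ ≤ 1 →
      (∀ k, m ≤ k → k + m < 2 * n + 1 → z (k + 1) =
        z k + z k ^ 2 + b * z k ^ 4 + (Real.pi : ℂ) ^ 2 / 4 / (n ^ 2 + k) + e k) →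
      (∀ k, m ≤ k → k + m < 2 * n + 1 → ‖e k‖ ≤ B / (n ^ 3 * Real.sqrt n)) →
      z m ≠ 0 → ‖-1 / z m - m‖ ≤ C * Real.sqrt m →
      z (2 * n + 1 - m) ≠ 0 ∧ ‖1 / z (2 * n + 1 - m) + -1 / z m - 2 * m‖ ≤ K / Real.sqrt m := by
  set G := 4 * C + 1 with hG
  set K₁ := 330 * (13300 + 4 * B) + 70 * (G + 14) + 4000 with hK₁
  have hK₁0 : 0 < K₁ := by positivity
  -- These are exactly the two size conditions of `phaseCoord_transit`, with `1` added to make `m`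
  -- positive.
  obtain ⟨m₀, hm₀⟩ := exists_nat_ge (4 * (G + 14) ^ 2 + 8 * K₁ + 1)
  refine ⟨8 * K₁ + 8 + 2, by positivity, m₀, ?_, ?_⟩
  · have : (1 : ℝ) ≤ m₀ := by
      have : 0 ≤ 4 * (G + 14) ^ 2 := by positivity
      linarith
    exact_mod_cast this
  intro m hm
  have hmR : (m₀ : ℝ) ≤ m := by exact_mod_cast hm
  have hGp : 0 ≤ 4 * (G + 14) ^ 2 := by positivity
  have hm1 : (1 : ℝ) ≤ m := by linarith
  have hmN : 1 ≤ m := by exact_mod_cast hm1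
  have hsm : 1 ≤ Real.sqrt m := Real.one_le_sqrt.2 hm1
  have hsm0 : 0 < Real.sqrt m := by linarith
  have hsmm : Real.sqrt m * Real.sqrt m = m := Real.mul_self_sqrt (by linarith)
  have hsmle : Real.sqrt m ≤ m := by nlinarith
  set M := (1 + C) * m with hM
  have hM0 : (m : ℝ) ≤ M := by rw [hM]; nlinarith
  set R := (G + 8 * K₁ + 8 + 1) * m with hR
  have hR0 : (m : ℝ) ≤ R := by
    rw [hR]
    have : 1 ≤ G + 8 * K₁ + 8 + 1 := by rw [hG]; linarith
    nlinarith
  -- With `m` fixed, the entrance and exit errors `60M²/n` and `30R²/n` drop below `1/√m` for large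
  -- `n`. This keeps the final constant independent of `m`.
  obtain ⟨n₀, hn₀⟩ := exists_nat_ge (60 * M ^ 2 * Real.sqrt m + 30 * R ^ 2 * Real.sqrt m + 4 * M + 30 * R + m)
  refine ⟨n₀, fun n hn => ?_⟩
  have hnR : (n₀ : ℝ) ≤ n := by exact_mod_cast hn
  have p1 : 0 ≤ 60 * M ^ 2 * Real.sqrt m := by positivity
  have p2 : 0 ≤ 30 * R ^ 2 * Real.sqrt m := by positivity
  have hmn : m ≤ n := by
    have : (m : ℝ) ≤ n := by linarith
    exact_mod_cast this
  have hn0 : (0 : ℝ) < n := by linarith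
  refine ⟨hmn, ?_⟩
  intro b z e hb hz he hzm hzC
  have hpi := Real.pi_lt_d2
  have hpi3 := Real.pi_gt_three
  have h2an : ‖2 * halfPiI‖ = Real.pi := by
    rw [norm_mul, norm_halfPiI, Complex.norm_ofNat]; ring
  have ha0 := halfPiI_ne_zero
  have hzM : ‖1 / z m‖ ≤ M := by
    have e1 : 1 / z m = -((-1 / z m - m) + m) := by ring
    rw [e1, norm_neg]
    refine (norm_add_le_of_le hzC (Complex.norm_natCast m).le).trans ?_
    rw [hM]; nlinarith
  obtain ⟨s1, s2⟩ := phaseCoord_entrance hmN hM0 hzm hzM (by linarith : 4 * M ≤ n)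
  have s3 : 60 * M ^ 2 / n ≤ 1 / Real.sqrt m := by
    rw [div_le_div_iff₀ hn0 hsm0]; linarith
  have s4 : (1 : ℝ) / Real.sqrt m ≤ 1 := by rw [div_le_one hsm0]; exact hsm
  have hgm : ‖phaseCoord n m (z m)‖ ≤ G * Real.sqrt m := by
    have e1 : phaseCoord n m (z m) = (phaseCoord n m (z m) - 2 * halfPiI * (-1 / z m - m)) +
      2 * halfPiI * (-1 / z m - m) := by ring
    rw [e1]
    have : ‖2 * halfPiI * (-1 / z m - m)‖ ≤ 4 * (C * Real.sqrt m) := by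
      rw [norm_mul, h2an]; gcongr; linarith
    refine (norm_add_le_of_le s2 this).trans ?_
    rw [hG]; linarith
  obtain ⟨t1, t2⟩ := phaseCoord_transit hb hB (by positivity : 0 ≤ G) hK₁ (by linarith) (by linarith)
    hmn hz he hgm s1
  have hge : ‖phaseCoord n (2 * n + 1 - m) (z (2 * n + 1 - m))‖ ≤ R := by
    have h1 := norm_add_le_of_le t2 hgm
    rw [sub_add_cancel] at h1
    refine h1.trans ?_
    have : (8 * K₁ + 8) / Real.sqrt m ≤ 8 * K₁ + 8 := div_le_self (by positivity) hsm
    rw [hR]; nlinarith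
  obtain ⟨u1, u2⟩ := phaseCoord_exit hmN hR0 (by linarith : 30 * R ≤ n) t1 hge
  refine ⟨u1, ?_⟩
  have u3 : 30 * R ^ 2 / n ≤ 1 / Real.sqrt m := by
    rw [div_le_div_iff₀ hn0 hsm0]; linarith
  set ge := phaseCoord n (2 * n + 1 - m) (z (2 * n + 1 - m))
  set gm := phaseCoord n m (z m)
  have hid : 1 / z (2 * n + 1 - m) + -1 / z m - 2 * m =
      (1 / z (2 * n + 1 - m) - (m - ge / (2 * halfPiI)))
      - ((ge - gm) / (2 * halfPiI))
      - ((gm - 2 * halfPiI * (-1 / z m - m)) / (2 * halfPiI)) := by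
    field_simp; ring
  rw [hid]
  have v1 : ‖(ge - gm) / (2 * halfPiI)‖ ≤ (8 * K₁ + 8) / Real.sqrt m := by
    rw [norm_div, h2an]
    exact (div_le_self (norm_nonneg _) (by linarith)).trans t2
  have v2 : ‖(gm - 2 * halfPiI * (-1 / z m - m)) / (2 * halfPiI)‖ ≤ 1 / Real.sqrt m := by
    rw [norm_div, h2an]
    exact (div_le_self (norm_nonneg _) (by linarith)).trans (s2.trans s3)
  refine (norm_sub_le_of_le (norm_sub_le_of_le (u2.trans u3) v1) v2).trans (le_of_eq ?_)
  ring
end ParabolicImplosion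

/-! ### Critical returns and uniform control of `f` outside the gate. -/

namespace ParabolicImplosion
open Complex Filter Topology

/-- The quartic map `z + z² + b z⁴`. -/
noncomputable def quartic (b z : ℂ) : ℂ := z + z ^ 2 + b * z ^ 4

/-- A real quartic `z + z² + b z⁴` whose critical point `c` lies on the repelling side, together with
the orbit `x` of `f (f c)` on the attracting side and a backward orbit `u` of `c`, whose
asymptotic phases match. -/
structure CriticalReturn (b c C : ℝ) (x u : ℕ → ℝ) : Prop where
  abs_b : |b| ≤ 1
  crit : 1 + 2 * c + 4 * b * c ^ 3 = 0
  x_zero : quartic b (quartic b c) = x 0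
  x_neg : ∀ m, x m < 0
  x_succ : ∀ m, x (m + 1) = x m + x m ^ 2 + b * x m ^ 4
  u_zero : u 0 = c
  u_pos : ∀ j, 0 < u j
  u_succ : ∀ j, u (j + 1) + u (j + 1) ^ 2 + b * u (j + 1) ^ 4 = u j
  C_nonneg : 0 ≤ C
  x_asymp : ∀ m : ℕ, |-1 / x m - m| ≤ C * Real.sqrt (m + 1)
  u_asymp : ∀ j : ℕ, |1 / u j - j| ≤ C * Real.sqrt (j + 1)
  matching : Tendsto (fun m : ℕ => -1 / x (m + 2) + 1 / u m - 2 * (m + 2)) atTop (𝓝 0)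

/-- In the coordinate `ζ = 1/z` the map is `ζ ↦ ζ - 1 + 1/ζ + O(1/ζ²)`, whose derivative is `1 +
O(z²)`. Along orbits with `|z|` of order `1/i` the Lipschitz factors have a convergent product. -/
theorem quartic_recip_step {b z z' : ℂ} {M : ℝ} (hb : ‖b‖ ≤ 1) (hz0 : z ≠ 0) (hz0' : z' ≠ 0)
    (hz : ‖z‖ ≤ M) (hz' : ‖z'‖ ≤ M) (hM : M ≤ 1 / 4) :
    quartic b z ≠ 0 ∧
    ‖1 / quartic b z - 1 / quartic b z'‖ ≤ (1 + 6 * M ^ 2) * ‖1 / z - 1 / z'‖ := by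
  have hM0 : 0 ≤ M := (norm_nonneg z).trans hz
  have hql : ∀ w : ℂ, ‖w‖ ≤ M → 0.73 ≤ ‖1 + w + b * w ^ 3‖ := by
    intro w hw
    have h1 : ‖w + b * w ^ 3‖ ≤ 0.27 := by
      refine (norm_add_le _ _).trans ?_
      rw [norm_mul, norm_pow]
      have : ‖b‖ * ‖w‖ ^ 3 ≤ 1 * (1 / 4) ^ 3 := by
        gcongr; exact hw.trans hM
      norm_num at this ⊢
      linarith
    have h2 := norm_sub_le (1 + w + b * w ^ 3) (w + b * w ^ 3)
    have h3 : 1 + w + b * w ^ 3 - (w + b * w ^ 3) = 1 := by ring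
    rw [h3, norm_one] at h2
    norm_num at h1 ⊢
    linarith
  set q := 1 + z + b * z ^ 3 with hq
  set q' := 1 + z' + b * z' ^ 3 with hq'
  have hqn := hql z hz
  have hqn' := hql z' hz'
  have hq0 : q ≠ 0 := by intro h; rw [← hq, h] at hqn; norm_num at hqn
  have hq0' : q' ≠ 0 := by intro h; rw [← hq', h] at hqn'; norm_num at hqn'
  have e1 : quartic b z = z * q := by rw [quartic, hq]; ring
  have e2 : quartic b z' = z' * q' := by rw [quartic, hq']; ring
  refine ⟨by rw [e1]; exact mul_ne_zero hz0 hq0, ?_⟩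
  have hid : 1 / quartic b z - 1 / quartic b z' = (1 / z - 1 / z') *
      (1 + (b * (z ^ 3 + z ^ 2 * z' + z * z' ^ 2 + z' ^ 3) - z * z' - b * z ^ 3 * (1 + z')
        - b * z' ^ 3 * (1 + z) - b ^ 2 * z ^ 3 * z' ^ 3) / (q * q')) := by
    have e3 : 1 + (b * (z ^ 3 + z ^ 2 * z' + z * z' ^ 2 + z' ^ 3) - z * z' - b * z ^ 3 * (1 + z')
        - b * z' ^ 3 * (1 + z) - b ^ 2 * z ^ 3 * z' ^ 3) / (q * q') =
        (1 + z + z' + b * (z ^ 3 + z ^ 2 * z' + z * z' ^ 2 + z' ^ 3)) / (q * q') := by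
      rw [eq_div_iff (mul_ne_zero hq0 hq0'), add_mul, div_mul_cancel₀ _ (mul_ne_zero hq0 hq0'),
        hq, hq']
      ring
    rw [e3, e1, e2, div_sub_div _ _ (mul_ne_zero hz0 hq0) (mul_ne_zero hz0' hq0'),
      div_sub_div _ _ hz0 hz0', div_mul_div_comm,
      div_eq_div_iff (mul_ne_zero (mul_ne_zero hz0 hq0) (mul_ne_zero hz0' hq0'))
        (mul_ne_zero (mul_ne_zero hz0 hz0') (mul_ne_zero hq0 hq0')), hq, hq']
    ring
  rw [hid, norm_mul, mul_comm]
  gcongr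
  refine (norm_add_le _ _).trans ?_
  rw [norm_one]
  gcongr
  rw [norm_div, norm_mul, div_le_iff₀ (by
    have : 0 < ‖q‖ := norm_pos_iff.2 hq0
    have : 0 < ‖q'‖ := norm_pos_iff.2 hq0'
    positivity)]
  have hden : 0.53 ≤ ‖q‖ * ‖q'‖ := by
    calc (0.53 : ℝ) ≤ 0.73 * 0.73 := by norm_num
      _ ≤ _ := by gcongr
  have hnum : ‖b * (z ^ 3 + z ^ 2 * z' + z * z' ^ 2 + z' ^ 3) - z * z' - b * z ^ 3 * (1 + z')
        - b * z' ^ 3 * (1 + z) - b ^ 2 * z ^ 3 * z' ^ 3‖ ≤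
      1 * (M ^ 3 + M ^ 2 * M + M * M ^ 2 + M ^ 3) + M * M + 1 * M ^ 3 * (1 + M) +
        1 * M ^ 3 * (1 + M) + 1 ^ 2 * M ^ 3 * M ^ 3 := by
    refine norm_sub_le_of_le (norm_sub_le_of_le (norm_sub_le_of_le (norm_sub_le_of_le ?_ ?_) ?_) ?_) ?_
    · rw [norm_mul]
      gcongr
      refine norm_add_le_of_le (norm_add_le_of_le (norm_add_le_of_le ?_ ?_) ?_) ?_
      · rw [norm_pow]; gcongr
      · rw [norm_mul, norm_pow]; gcongr
      · rw [norm_mul, norm_pow]; gcongr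
      · rw [norm_pow]; gcongr
    · rw [norm_mul]; gcongr
    · rw [norm_mul, norm_mul, norm_pow]
      gcongr
      exact norm_add_le_of_le norm_one.le hz'
    · rw [norm_mul, norm_mul, norm_pow]
      gcongr
      exact norm_add_le_of_le norm_one.le hz
    · rw [norm_mul, norm_mul, norm_pow, norm_pow, norm_pow]; gcongr
  refine hnum.trans ?_
  have h4 : M ^ 3 ≤ M ^ 2 * (1 / 4) := by nlinarith [sq_nonneg M]
  have h5 : M ^ 3 * M ≤ M ^ 2 * (1 / 16) := by nlinarith [sq_nonneg M]
  have h6 : M ^ 3 * M ^ 3 ≤ M ^ 2 * (1 / 16) := by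
    calc M ^ 3 * M ^ 3 = M ^ 2 * M ^ 4 := by ring
      _ ≤ M ^ 2 * (1 / 4) ^ 4 := by gcongr
      _ ≤ _ := by gcongr; norm_num
  have h7 : 6 * M ^ 2 * 0.53 ≤ 6 * M ^ 2 * (‖q‖ * ‖q'‖) := by gcongr
  have h8 : 0 ≤ M ^ 2 := sq_nonneg M
  norm_num at h7
  linarith

/-- One step near the parabolic point, with the explicit distortion used in both directions. -/
theorem quartic_recip_step_exp {b z x : ℂ} {i : ℕ} (hb : ‖b‖ ≤ 1) (hi : 16 ≤ i) (hz : z ≠ 0)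
    (hx : (i : ℝ) / 2 ≤ ‖1 / x‖) (hd : ‖1 / z - 1 / x‖ ≤ 1) :
    quartic b z ≠ 0 ∧ ‖1 / quartic b z - 1 / quartic b x‖ ≤
      Real.exp (200 * (1 / i - 1 / (i + 1))) * ‖1 / z - 1 / x‖ := by
  have hiR : (16 : ℝ) ≤ i := by exact_mod_cast hi
  have hx0 : x ≠ 0 := by
    rintro rfl; simp at hx; linarith
  have hxn : ‖x‖ ≤ 4 / i := by
    rw [norm_div, norm_one] at hx
    have h0 : 0 < ‖x‖ := norm_pos_iff.2 hx0
    rw [le_div_iff₀ h0] at hx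
    rw [le_div_iff₀ (by linarith)]
    linarith
  have hzn : ‖z‖ ≤ 4 / i := by
    have h1 : (i : ℝ) / 4 ≤ ‖1 / z‖ := by
      have := norm_sub_norm_le (1 / x) (1 / z)
      rw [norm_sub_rev] at this
      linarith
    rw [norm_div, norm_one] at h1
    have h0 : 0 < ‖z‖ := norm_pos_iff.2 hz
    rw [le_div_iff₀ h0] at h1
    rw [le_div_iff₀ (by linarith)]
    linarith
  obtain ⟨h1, h2⟩ := quartic_recip_step hb hz hx0 hzn hxn
    (by rw [div_le_div_iff₀ (by linarith) (by norm_num)]; linarith)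
  refine ⟨h1, h2.trans ?_⟩
  gcongr
  refine le_trans ?_ (Real.add_one_le_exp _)
  -- The distortion `96/i²` is written as a telescoping difference, so products of such factors
  -- never exceed `exp 200`.
  have : 6 * (4 / (i : ℝ)) ^ 2 ≤ 200 * (1 / i - 1 / (i + 1)) := by
    have e : 1 / (i : ℝ) - 1 / (i + 1) = 1 / (i * (i + 1)) := by
      have : (i : ℝ) ≠ 0 := by positivity
      field_simp; ring
    have e2 : 6 * (4 / (i : ℝ)) ^ 2 = 96 / (i * i) := by field_simp; norm_num
    rw [e, e2, mul_one_div, div_le_div_iff₀ (by positivity) (by positivity)]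
    nlinarith
  linarith

theorem eventually_asymp_lower {C : ℝ} {v : ℕ → ℝ} (h : ∀ m : ℕ, |v m - m| ≤ C * Real.sqrt (m + 1)) :
    ∀ᶠ m : ℕ in atTop, (m : ℝ) / 2 ≤ v m := by
  obtain ⟨N, hN⟩ := exists_nat_ge (8 * C ^ 2 + 1)
  filter_upwards [eventually_ge_atTop N] with m hm
  have hmR : 8 * C ^ 2 + 1 ≤ m := hN.trans (by exact_mod_cast hm)
  have h1 := abs_le.1 (h m)
  have h2 : C * Real.sqrt (m + 1) ≤ m / 2 := by
    have h3 : Real.sqrt (m + 1) ^ 2 = m + 1 := Real.sq_sqrt (by positivity)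
    refine abs_le_of_sq_le_sq' ?_ (by positivity) |>.2
    rw [mul_pow, h3]
    nlinarith
  linarith [h1.1]

variable {b c C : ℝ} {x u : ℕ → ℝ}

namespace CriticalReturn

theorem norm_b (D : CriticalReturn b c C x u) : ‖(b : ℂ)‖ ≤ 1 := by
  rw [Complex.norm_real]; exact D.abs_b

theorem iterate_x (D : CriticalReturn b c C x u) (m : ℕ) : (quartic b)^[m] (x 0) = x m := by
  induction m with
  | zero => rfl
  | succ m ih =>
    rw [Function.iterate_succ_apply', ih, D.x_succ, quartic]; push_cast; ring

theorem quartic_u (D : CriticalReturn b c C x u) (j : ℕ) : quartic b (u (j + 1)) = u j := by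
  rw [← D.u_succ j, quartic]; push_cast; ring

theorem quartic_x (D : CriticalReturn b c C x u) (j : ℕ) : quartic b (x j) = x (j + 1) := by
  rw [D.x_succ, quartic]; push_cast; ring

theorem iterate_u (D : CriticalReturn b c C x u) (m : ℕ) : (quartic b)^[m] (u m) = c := by
  induction m with
  | zero => rw [← D.u_zero]; rfl
  | succ m ih => rw [Function.iterate_succ_apply, D.quartic_u, ih]

theorem differentiable_quartic (b : ℂ) : Differentiable ℂ (quartic b) := by
  unfold quartic; fun_prop

theorem differentiable_iterate (b : ℂ) (m : ℕ) : Differentiable ℂ ((quartic b)^[m]) :=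
  (differentiable_quartic b).iterate m

theorem eventually_lower (D : CriticalReturn b c C x u) :
    ∀ᶠ m : ℕ in atTop, (m : ℝ) / 2 ≤ ‖(1 : ℂ) / x m‖ ∧ (m : ℝ) / 2 ≤ ‖(1 : ℂ) / u m‖ := by
  filter_upwards [eventually_asymp_lower D.x_asymp, eventually_asymp_lower D.u_asymp] with m h1 h2
  constructor
  · rw [norm_div, norm_one, Complex.norm_real, Real.norm_of_nonpos (D.x_neg m).le]
    refine h1.trans (le_of_eq ?_)
    rw [div_neg, neg_div]
  · rw [norm_div, norm_one, Complex.norm_real, Real.norm_of_nonneg (D.u_pos m).le]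
    exact h2

/-- Entrance: in the coordinate `1 / z` iteration is uniformly Lipschitz at `x 0`. -/
theorem entrance_lipschitz (D : CriticalReturn b c C x u) :
    ∃ K > 0, ∃ ρ > 0, ∃ m₁ : ℕ, ∀ z : ℂ, ‖z - x 0‖ ≤ ρ → ∀ m, m₁ ≤ m →
      (quartic b)^[m] z ≠ 0 ∧ ‖1 / (quartic b)^[m] z - 1 / x m‖ ≤ K * ‖z - x 0‖ := by
  obtain ⟨m₁, hm₁⟩ := eventually_atTop.1 (D.eventually_lower.and (eventually_ge_atTop 16))
  have hne : (quartic b)^[m₁] (x 0) ≠ 0 := by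
    rw [D.iterate_x]; exact_mod_cast (D.x_neg m₁).ne
  have hcont := (differentiable_iterate b m₁).continuous.continuousAt (x := (x 0 : ℂ))
  have hdiff : DifferentiableAt ℂ (fun z => 1 / (quartic b)^[m₁] z) (x 0) :=
    (differentiableAt_const _).div (differentiable_iterate b m₁ _) hne
  obtain ⟨K₀, hK₀, hO⟩ := hdiff.isBigO_sub.exists_pos
  have hev := hO.bound.and (hcont.eventually_ne hne)
  obtain ⟨ρ₀, hρ₀, hball⟩ := Metric.eventually_nhds_iff.1 hev
  set E := Real.exp 200 with hE
  have hE0 : 0 < E := Real.exp_pos _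
  refine ⟨K₀ * E, by positivity, min (ρ₀ / 2) (1 / (K₀ * E)), by positivity, m₁, ?_⟩
  intro z hz
  obtain ⟨h1, h2⟩ := hball (y := z) (by
    rw [dist_eq_norm]; exact (hz.trans (min_le_left _ _)).trans_lt (by linarith))
  rw [D.iterate_x] at h1
  have hdE : K₀ * ‖z - x 0‖ * E ≤ 1 := by
    have := hz.trans (min_le_right _ _)
    rw [le_div_iff₀ (by positivity)] at this
    linarith
  have main : ∀ m, m₁ ≤ m → (quartic b)^[m] z ≠ 0 ∧ ‖1 / (quartic b)^[m] z - 1 / x m‖ ≤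
      K₀ * ‖z - x 0‖ * Real.exp (200 * (1 / m₁ - 1 / m)) := by
    intro m hm
    induction m, hm using Nat.le_induction with
    | base => refine ⟨h2, ?_⟩; simpa using h1
    | succ m hm ih =>
      obtain ⟨⟨l1, -⟩, l2⟩ := hm₁ m hm
      have hm16 : (16 : ℝ) ≤ m := by exact_mod_cast l2
      have hle : K₀ * ‖z - x 0‖ * Real.exp (200 * (1 / m₁ - 1 / m)) ≤ 1 := by
        refine le_trans ?_ hdE
        gcongr
        rw [hE]
        gcongr
        have h16 : (1 : ℝ) ≤ m₁ := by exact_mod_cast (by have := (hm₁ m₁ le_rfl).2; omega)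
        have : (1 : ℝ) / m₁ ≤ 1 := by rw [div_le_one (by linarith)]; exact h16
        have : (0 : ℝ) ≤ 1 / m := by positivity
        linarith
      obtain ⟨s1, s2⟩ := quartic_recip_step_exp D.norm_b l2 ih.1 l1 (ih.2.trans hle)
      rw [Function.iterate_succ_apply']
      refine ⟨s1, ?_⟩
      rw [← D.quartic_x]
      refine s2.trans ?_
      calc _ ≤ Real.exp (200 * (1 / m - 1 / (m + 1))) *
            (K₀ * ‖z - x 0‖ * Real.exp (200 * (1 / m₁ - 1 / m))) := by gcongr; exact ih.2
        _ = K₀ * ‖z - x 0‖ * (Real.exp (200 * (1 / m - 1 / (m + 1))) *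
            Real.exp (200 * (1 / m₁ - 1 / m))) := by ring
        _ = _ := by rw [← Real.exp_add]; congr 2; push_cast; ring
  intro m hm
  refine ⟨(main m hm).1, (main m hm).2.trans ?_⟩
  have h16 : (1 : ℝ) ≤ m₁ := by exact_mod_cast (by have := (hm₁ m₁ le_rfl).2; omega)
  have hexp : Real.exp (200 * (1 / m₁ - 1 / m)) ≤ E := by
    rw [hE]
    gcongr
    have h3 : (1 : ℝ) / m₁ ≤ 1 := by rw [div_le_one (by linarith)]; exact h16
    have h4 : (0 : ℝ) ≤ 1 / m := by positivity
    linarith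
  calc _ ≤ K₀ * ‖z - x 0‖ * E := by gcongr
    _ = _ := by ring

/-- Exit: the iterates leading from near `u J` to the critical point are uniformly Lipschitz in
the coordinate `1 / z`. -/
theorem exit_lipschitz (D : CriticalReturn b c C x u) :
    ∃ K > 0, ∃ η > 0, ∃ j₁ : ℕ, ∀ J, j₁ ≤ J → ∀ z : ℂ, z ≠ 0 → ‖1 / z - 1 / u J‖ ≤ η →
      ‖(quartic b)^[J] z - c‖ ≤ K * ‖1 / z - 1 / u J‖ := by
  obtain ⟨j₁, hj₁⟩ := eventually_atTop.1 (D.eventually_lower.and (eventually_ge_atTop 16))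
  have hu0 : (1 : ℂ) / u j₁ ≠ 0 := one_div_ne_zero (by exact_mod_cast (D.u_pos j₁).ne')
  have hdiff : DifferentiableAt ℂ (fun w : ℂ => (quartic b)^[j₁] (1 / w)) (1 / u j₁) := by
    refine DifferentiableAt.comp _ (differentiable_iterate b j₁ _) ?_
    exact (differentiableAt_const _).div differentiableAt_id hu0
  obtain ⟨K₀, hK₀, hO⟩ := hdiff.isBigO_sub.exists_pos
  obtain ⟨η₀, hη₀, hball⟩ := Metric.eventually_nhds_iff.1 hO.bound
  set E := Real.exp 200 with hE
  have hE0 : 0 < E := Real.exp_pos _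
  set η := min (η₀ / 2) 1 with hη
  have hη0 : 0 < η := by positivity
  have hj16 : (16 : ℝ) ≤ j₁ := by exact_mod_cast (hj₁ j₁ le_rfl).2
  -- The admissible radius decreases with `J` at the same telescoping rate as the distortion; one
  -- step from level `J + 1` therefore lands in the admissible disc of level `J`.
  have main : ∀ J, j₁ ≤ J → ∀ z : ℂ, z ≠ 0 →
      ‖1 / z - 1 / u J‖ ≤ η * Real.exp (200 * (1 / J - 1 / j₁)) →
      ‖(quartic b)^[J] z - c‖ ≤ K₀ * Real.exp (200 * (1 / j₁ - 1 / J)) * ‖1 / z - 1 / u J‖ := by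
    intro J hJ
    induction J, hJ using Nat.le_induction with
    | base =>
      intro z hz hd
      rw [sub_self, mul_zero, Real.exp_zero, mul_one] at hd ⊢
      have := hball (y := 1 / z) (by
        rw [dist_eq_norm]
        exact (hd.trans (min_le_left _ _)).trans_lt (by linarith))
      rw [one_div_one_div, one_div_one_div, D.iterate_u] at this
      exact this
    | succ J hJ ih =>
      intro z hz hd
      obtain ⟨⟨-, l1⟩, l2⟩ := hj₁ (J + 1) (by omega)
      have hJ16 : (16 : ℝ) ≤ J := hj16.trans (by exact_mod_cast hJ)
      have hJpos : (0 : ℝ) < J := by linarith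
      have hle : η * Real.exp (200 * (1 / ((J + 1 : ℕ) : ℝ) - 1 / j₁)) ≤ 1 := by
        have h1 : Real.exp (200 * (1 / ((J + 1 : ℕ) : ℝ) - 1 / j₁)) ≤ 1 := by
          rw [Real.exp_le_one_iff]
          have : 1 / ((J + 1 : ℕ) : ℝ) ≤ 1 / j₁ := by
            gcongr; omega
          linarith
        have h2 : η ≤ 1 := min_le_right _ _
        exact mul_le_one₀ h2 (Real.exp_pos _).le h1
      obtain ⟨s1, s2⟩ := quartic_recip_step_exp D.norm_b l2 hz l1 (hd.trans hle)
      rw [D.quartic_u] at s2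
      have hmono : Real.exp (200 * (1 / ((J + 1 : ℕ) : ℝ) - 1 / (((J + 1 : ℕ) : ℝ) + 1))) ≤
          Real.exp (200 * (1 / J - 1 / ((J + 1 : ℕ) : ℝ))) := by
        refine Real.exp_le_exp.2 (mul_le_mul_of_nonneg_left ?_ (by norm_num))
        have e1 : 1 / ((J + 1 : ℕ) : ℝ) - 1 / (((J + 1 : ℕ) : ℝ) + 1) = 1 / ((J + 1) * (J + 2)) := by
          push_cast; field_simp; ring
        have e2 : 1 / (J : ℝ) - 1 / ((J + 1 : ℕ) : ℝ) = 1 / (J * (J + 1)) := by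
          push_cast; field_simp; ring
        rw [e1, e2]
        exact one_div_le_one_div_of_le (by positivity) (by nlinarith)
      have s3 : ‖1 / quartic b z - 1 / u J‖ ≤
          Real.exp (200 * (1 / J - 1 / ((J + 1 : ℕ) : ℝ))) * ‖1 / z - 1 / u (J + 1)‖ :=
        s2.trans (by gcongr)
      have s4 : ‖1 / quartic b z - 1 / u J‖ ≤ η * Real.exp (200 * (1 / J - 1 / j₁)) := by
        refine s3.trans ?_
        calc _ ≤ Real.exp (200 * (1 / J - 1 / ((J + 1 : ℕ) : ℝ))) *
              (η * Real.exp (200 * (1 / ((J + 1 : ℕ) : ℝ) - 1 / j₁))) := by gcongr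
          _ = η * (Real.exp (200 * (1 / J - 1 / ((J + 1 : ℕ) : ℝ))) *
              Real.exp (200 * (1 / ((J + 1 : ℕ) : ℝ) - 1 / j₁))) := by ring
          _ = _ := by rw [← Real.exp_add]; congr 2; ring
      rw [Function.iterate_succ_apply]
      refine (ih _ s1 s4).trans ?_
      calc _ ≤ K₀ * Real.exp (200 * (1 / j₁ - 1 / J)) *
            (Real.exp (200 * (1 / J - 1 / ((J + 1 : ℕ) : ℝ))) * ‖1 / z - 1 / u (J + 1)‖) := by gcongr
        _ = K₀ * (Real.exp (200 * (1 / j₁ - 1 / J)) *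
            Real.exp (200 * (1 / J - 1 / ((J + 1 : ℕ) : ℝ)))) * ‖1 / z - 1 / u (J + 1)‖ := by ring
        _ = _ := by rw [← Real.exp_add]; congr 3; ring
  refine ⟨K₀ * E, by positivity, η * Real.exp (-200), by positivity, j₁, ?_⟩
  intro J hJ z hz hd
  have hJ16 : (16 : ℝ) ≤ J := hj16.trans (by exact_mod_cast hJ)
  have h3 : (1 : ℝ) / j₁ ≤ 1 := by rw [div_le_one (by linarith)]; linarith
  have h4 : (0 : ℝ) ≤ 1 / J := by positivity
  refine (main J hJ z hz (hd.trans ?_)).trans ?_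
  · gcongr; linarith
  · gcongr
    rw [hE]
    gcongr; linarith

end CriticalReturn
end ParabolicImplosion

/-! ### The return map over one block and its contraction. -/

namespace ParabolicImplosion
open Complex Filter Topology

/-- Uniform continuity over finitely many steps. It covers the two ends of a block, whose length is
fixed while the perturbation is `O(1/n)`. -/
theorem pseudo_orbit_shadow (b : ℂ) (M : ℕ) (R : ℝ) : ∀ ε > 0, ∃ δ > 0, ∀ ζ : ℕ → ℂ, ‖ζ 0‖ ≤ R →
    (∀ k < M, ‖ζ (k + 1) - quartic b (ζ k)‖ ≤ δ) → ‖ζ M - (quartic b)^[M] (ζ 0)‖ ≤ ε := by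
  induction M with
  | zero => intro ε hε; exact ⟨1, one_pos, fun ζ _ _ => by simpa using hε.le⟩
  | succ M ih =>
    intro ε hε
    have hK : IsCompact ((quartic b)^[M] '' Metric.closedBall 0 R) :=
      (isCompact_closedBall _ _).image (CriticalReturn.differentiable_iterate b M).continuous
    have hu := hK.uniformContinuousAt_of_continuousAt (quartic b)
      (fun a _ => (CriticalReturn.differentiable_quartic b).continuous.continuousAt)
      (Metric.dist_mem_uniformity (half_pos hε))
    obtain ⟨δ₁, hδ₁, hδ⟩ := Metric.mem_uniformity_dist.1 hu
    obtain ⟨δ₂, hδ₂, h2⟩ := ih (δ₁ / 2) (half_pos hδ₁)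
    refine ⟨min δ₂ (ε / 2), by positivity, fun ζ h0 hζ => ?_⟩
    have h3 := h2 ζ h0 (fun k hk => (hζ k (by omega)).trans (min_le_left _ _))
    have h4 := hδ (a := (quartic b)^[M] (ζ 0)) (b := ζ M) (by
      rw [dist_eq_norm, norm_sub_rev]; linarith)
      ⟨ζ 0, by simpa using h0, rfl⟩
    rw [Function.iterate_succ_apply']
    have h5 : dist (quartic b ((quartic b)^[M] (ζ 0))) (quartic b (ζ M)) < ε / 2 := h4
    have h6 := (hζ M (by omega)).trans (min_le_right _ _)
    rw [dist_eq_norm, norm_sub_rev] at h5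
    have := norm_add_le_of_le h6 h5.le
    rw [sub_add_sub_cancel] at this
    linarith

/-- The nonautonomous recursion satisfied by the first coordinate of an orbit of the skew product. -/
def GateOrbit (b : ℂ) (B : ℝ) (n : ℕ) (z e : ℕ → ℂ) : Prop :=
  ∀ k, k < 2 * n + 1 → z (k + 1) =
    z k + z k ^ 2 + b * z k ^ 4 + (Real.pi : ℂ) ^ 2 / 4 / (n ^ 2 + k) + e k ∧
    ‖e k‖ ≤ B / (n ^ 3 * Real.sqrt n)

theorem GateOrbit.step_close {b : ℂ} {B : ℝ} {n : ℕ} {z e : ℕ → ℂ} (hB : 0 ≤ B) (hn : 1 ≤ n)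
    (h : GateOrbit b B n z e) (k : ℕ) (hk : k < 2 * n + 1) :
    ‖z (k + 1) - quartic b (z k)‖ ≤ (3 + B) / n := by
  obtain ⟨h1, h2⟩ := h k hk
  have hn' : (1 : ℝ) ≤ n := by exact_mod_cast hn
  have e1 : z (k + 1) - quartic b (z k) = (Real.pi : ℂ) ^ 2 / 4 / (n ^ 2 + k) + e k := by
    rw [h1, quartic]; ring
  rw [e1, add_div]
  refine norm_add_le_of_le ?_ (h2.trans ?_)
  · have : (Real.pi : ℂ) ^ 2 / 4 / (n ^ 2 + k) = ((Real.pi ^ 2 / 4 / ((n : ℝ) ^ 2 + k) : ℝ) : ℂ) := by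
      push_cast; ring
    rw [this, Complex.norm_real, Real.norm_of_nonneg (by positivity)]
    have h3 : Real.pi ^ 2 / 4 ≤ 3 := by nlinarith [Real.pi_lt_d2, Real.pi_pos]
    have h4 : (n : ℝ) ≤ n ^ 2 + k := by
      have : (0 : ℝ) ≤ k := by positivity
      nlinarith
    gcongr
  · have h5 : 1 ≤ Real.sqrt n := Real.one_le_sqrt.2 hn'
    have h6 : (n : ℝ) ≤ n ^ 3 * Real.sqrt n := by
      have : (n : ℝ) ≤ n ^ 3 := by nlinarith [sq_nonneg ((n : ℝ) - 1), mul_self_nonneg (n : ℝ)]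
      nlinarith
    gcongr

variable {b c C : ℝ} {x u : ℕ → ℝ}

namespace CriticalReturn

set_option maxHeartbeats 1000000 in
/-- After `2 n - 1` steps the orbit of a point near `x 0` is near the critical point. -/
theorem gate_to_critical (D : CriticalReturn b c C x u) {B : ℝ} (hB : 0 ≤ B) :
    ∃ K > 0, ∃ ρ > 0, ∀ ε > 0, ∃ n₀ : ℕ, ∀ n, n₀ ≤ n → ∀ z e : ℕ → ℂ, GateOrbit b B n z e →
      ‖z 0 - x 0‖ ≤ ρ → ‖z (2 * n - 1) - c‖ ≤ K * ‖z 0 - x 0‖ + ε := by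
  obtain ⟨K₁, hK₁, ρ₁, hρ₁, m₁, hin⟩ := D.entrance_lipschitz
  obtain ⟨K₂, hK₂, η', hη', j₁, hout⟩ := D.exit_lipschitz
  have hC := D.C_nonneg
  obtain ⟨Kt, hKt, mt, hmt1, hgate⟩ := gate_transit (B := B) (C := 2 * C + 2) hB (by linarith)
  obtain ⟨j₂, hj₂⟩ := eventually_atTop.1 D.eventually_lower
  set η := min η' 1 with hη
  have hη0 : 0 < η := by positivity
  have hη1 : η ≤ 1 := min_le_right _ _
  refine ⟨K₂ * K₁, by positivity, min ρ₁ (η / (4 * K₁)), by positivity, fun ε hε => ?_⟩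
  set ε₁ := min (ε / (8 * K₂)) (η / 8) with hε₁
  have hε₁0 : 0 < ε₁ := by positivity
  have hε₁η : ε₁ ≤ η / 8 := min_le_right _ _
  have hε₁1 : ε₁ ≤ 1 / 8 := by linarith
  have hKε : K₂ * (3 * ε₁) ≤ ε / 2 := by
    have : ε₁ ≤ ε / (8 * K₂) := min_le_left _ _
    rw [le_div_iff₀ (by positivity)] at this
    linarith
  -- choice of `m`
  have hS := (Metric.tendsto_atTop.1 D.matching) ε₁ hε₁0
  obtain ⟨m₂, hm₂⟩ := hS
  obtain ⟨m₃, hm₃⟩ := exists_nat_ge ((Kt / ε₁) ^ 2 + 1)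
  set m := m₁ + j₁ + mt + j₂ + m₂ + m₃ + 6 with hm
  -- Matching pairs `x m` with `u (m - 2)`: the gate is left at time `2n + 1 - m`, and `m - 2`
  -- further steps reach the critical point at time `2n - 1`.
  have hSm := hm₂ (m - 2) (by omega)
  have hm2 : m - 2 + 2 = m := by omega
  rw [hm2, Real.dist_eq, sub_zero] at hSm
  have hcast : ((m - 2 : ℕ) : ℝ) = (m : ℝ) - 2 := by rw [Nat.cast_sub (by omega)]; norm_num
  rw [hcast] at hSm
  have hmR : (m₃ : ℝ) ≤ m := by exact_mod_cast (by omega : m₃ ≤ m)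
  have hm6 : (6 : ℝ) ≤ m := by exact_mod_cast (by omega : 6 ≤ m)
  have hsm : 1 ≤ Real.sqrt m := Real.one_le_sqrt.2 (by linarith)
  have hKtm : Kt / Real.sqrt m ≤ ε₁ := by
    rw [div_le_iff₀ (by linarith)]
    have h1 : Kt / ε₁ ≤ Real.sqrt m := Real.le_sqrt_of_sq_le (by linarith)
    rw [div_le_iff₀ hε₁0] at h1
    linarith
  obtain ⟨n₁, hn₁⟩ := hgate m (by omega)
  have hxm : (x m : ℂ) ≠ 0 := by exact_mod_cast (D.x_neg m).ne
  set W := ‖(1 : ℂ) / x m‖ + 1 with hW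
  have hW0 : 0 < W := by positivity
  set ε₂ := min (1 / (2 * W)) (ε₁ / (2 * W ^ 2)) with hε₂
  have hε₂0 : 0 < ε₂ := by positivity
  obtain ⟨δ₁, hδ₁, hsh₁⟩ := pseudo_orbit_shadow b m (‖(x 0 : ℂ)‖ + ρ₁) ε₂ hε₂0
  obtain ⟨δ₂, hδ₂, hsh₂⟩ := pseudo_orbit_shadow b (m - 2) 1 (ε / 2) (half_pos hε)
  obtain ⟨n₂, hn₂⟩ := exists_nat_ge ((3 + B) / min δ₁ δ₂ + 1)
  refine ⟨max n₁ n₂, fun n hn z e hz hz0 => ?_⟩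
  obtain ⟨hmn, hgt⟩ := hn₁ n (le_of_max_le_left hn)
  have hnR : (n₂ : ℝ) ≤ n := by exact_mod_cast le_of_max_le_right hn
  have hq0 : 0 ≤ (3 + B) / min δ₁ δ₂ := by positivity
  have hn0 : (0 : ℝ) < n := by linarith
  have hn1 : 1 ≤ n := by exact_mod_cast (by linarith : (1 : ℝ) ≤ n)
  have hδ : (3 + B) / n ≤ min δ₁ δ₂ := by
    rw [div_le_iff₀ hn0]
    have h1 : (3 + B) / min δ₁ δ₂ ≤ n := by linarith
    rw [div_le_iff₀ (by positivity)] at h1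
    linarith
  have hstep := hz.step_close hB hn1
  set d := ‖z 0 - x 0‖ with hd
  have hdρ : d ≤ ρ₁ := hz0.trans (min_le_left _ _)
  have hdη : K₁ * d ≤ η / 4 := by
    have := hz0.trans (min_le_right _ _)
    rw [le_div_iff₀ (by positivity)] at this
    linarith
  -- entrance
  obtain ⟨a1, a2⟩ := hin (z 0) hdρ m (by omega)
  have a3 := hsh₁ z (by
      have := norm_add_le_of_le hdρ (le_refl ‖(x 0 : ℂ)‖)
      rw [sub_add_cancel] at this; linarith)
    (fun k hk => (hstep k (by omega)).trans (hδ.trans (min_le_left _ _)))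
  set F := (quartic b)^[m] (z 0) with hF
  have hFW : ‖1 / F‖ ≤ W := by
    have := norm_add_le_of_le a2 (le_refl ‖(1 : ℂ) / x m‖)
    rw [sub_add_cancel] at this; linarith
  have hFl : 1 / W ≤ ‖F‖ := by
    rw [norm_div, norm_one, div_le_iff₀ (norm_pos_iff.2 a1)] at hFW
    rw [div_le_iff₀ hW0]; linarith
  have hzl : 1 / (2 * W) ≤ ‖z m‖ := by
    have h1 := norm_sub_norm_le F (z m)
    rw [norm_sub_rev] at h1
    have h2 : ‖z m - F‖ ≤ 1 / (2 * W) := a3.trans (min_le_left _ _)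
    have h3 : 1 / W = 2 * (1 / (2 * W)) := by field_simp
    linarith
  have hzm0 : z m ≠ 0 := by
    intro h; rw [h, norm_zero] at hzl
    have : 0 < 1 / (2 * W) := by positivity
    linarith
  have a4 : ‖1 / z m - 1 / F‖ ≤ ε₁ := by
    have : 1 / z m - 1 / F = (F - z m) * (1 / z m) * (1 / F) := by field_simp
    rw [this, norm_mul, norm_mul, norm_sub_rev]
    have h1 : ‖1 / z m‖ ≤ 2 * W := by
      rw [norm_div, norm_one, div_le_iff₀ (norm_pos_iff.2 hzm0)]
      rw [div_le_iff₀ (by positivity)] at hzl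
      linarith
    calc _ ≤ (ε₁ / (2 * W ^ 2)) * (2 * W) * W := by
          gcongr
          exact a3.trans (min_le_right _ _)
      _ = ε₁ := by field_simp
  have a5 : ‖1 / z m - 1 / x m‖ ≤ K₁ * d + ε₁ := by
    have := norm_add_le_of_le a4 a2
    rw [sub_add_sub_cancel] at this; linarith
  -- gate
  have hxas := D.x_asymp m
  have hsm1 : Real.sqrt (m + 1) ≤ 2 * Real.sqrt m := by
    rw [Real.sqrt_le_left (by positivity), mul_pow, Real.sq_sqrt (by positivity)]
    linarith
  have a6 : ‖-1 / z m - m‖ ≤ (2 * C + 2) * Real.sqrt m := by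
    have e1 : -1 / z m - m = -(1 / z m - 1 / x m) + ((-1 / x m - m : ℝ) : ℂ) := by push_cast; ring
    rw [e1]
    refine (norm_add_le _ _).trans ?_
    rw [norm_neg, Complex.norm_real, Real.norm_eq_abs]
    have : C * Real.sqrt (m + 1) ≤ C * (2 * Real.sqrt m) := by gcongr
    linarith
  obtain ⟨g1, g2⟩ := hgt b z e D.norm_b (fun k _ hk => (hz k (by omega)).1)
    (fun k _ hk => (hz k (by omega)).2) hzm0 a6
  set y := z (2 * n + 1 - m) with hy
  have a7 : ‖1 / y - 1 / u (m - 2)‖ ≤ K₁ * d + 3 * ε₁ := by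
    have e1 : 1 / y - 1 / u (m - 2) = (1 / y + -1 / z m - 2 * m) + (1 / z m - 1 / x m)
        - ((-1 / x m + 1 / u (m - 2) - 2 * (m - 2 + 2) : ℝ) : ℂ) := by push_cast; ring
    rw [e1]
    refine (norm_sub_le_of_le (norm_add_le_of_le (g2.trans hKtm) a5)
      (r₂ := ε₁) ?_).trans (by linarith)
    rw [Complex.norm_real, Real.norm_eq_abs]; exact hSm.le
  -- exit
  have a8 := hout (m - 2) (by omega) y g1 (a7.trans (by
    have : η ≤ η' := min_le_left _ _
    linarith))
  have hy1 : ‖y‖ ≤ 1 := by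
    have h1 := (hj₂ (m - 2) (by omega)).2
    rw [hcast] at h1
    have h2 := norm_sub_norm_le ((1 : ℂ) / u (m - 2)) (1 / y)
    rw [norm_sub_rev] at h2
    have h3 : 1 ≤ ‖1 / y‖ := by linarith
    rw [norm_div, norm_one, le_div_iff₀ (norm_pos_iff.2 g1)] at h3
    linarith
  have a9 := hsh₂ (fun k => z (2 * n + 1 - m + k)) (by simpa using hy1)
    (fun k hk => (hstep (2 * n + 1 - m + k) (by omega)).trans (hδ.trans (min_le_right _ _)))
  have e2 : 2 * n + 1 - m + (m - 2) = 2 * n - 1 := by omega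
  simp only [e2, add_zero] at a9
  have := norm_add_le_of_le a9 (a8.trans (mul_le_mul_of_nonneg_left a7 hK₂.le))
  rw [sub_add_sub_cancel] at this
  refine this.trans ?_
  rw [mul_add]
  linarith

/-- The linear term vanishes at a critical point. This quadratic gain is what beats the Lipschitz
constant of the passage, whatever its size. -/
theorem quartic_near_critical (D : CriticalReturn b c C x u) {y : ℂ} (hy : ‖y - c‖ ≤ 1) :
    ‖quartic b y - quartic b c‖ ≤ (1 + ((1 + |c|) ^ 2 + 2 * (1 + |c|) * |c| + 3 * |c| ^ 2)) * ‖y - c‖ ^ 2 := by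
  have hc := D.crit
  have hcC : 1 + 2 * (c : ℂ) + 4 * b * c ^ 3 = 0 := by exact_mod_cast hc
  have hid : quartic b y - quartic b c = (1 + b * (y ^ 2 + 2 * y * c + 3 * c ^ 2)) * (y - c) ^ 2 := by
    rw [quartic, quartic]
    linear_combination (y - c) * hcC
  have hyn : ‖y‖ ≤ 1 + |c| := by
    have := norm_add_le_of_le hy (le_refl ‖(c : ℂ)‖)
    rw [sub_add_cancel, Complex.norm_real, Real.norm_eq_abs] at this
    exact this
  have hcn : ‖(c : ℂ)‖ = |c| := by rw [Complex.norm_real, Real.norm_eq_abs]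
  rw [hid, norm_mul, norm_pow]
  gcongr
  refine norm_add_le_of_le norm_one.le ?_
  rw [norm_mul]
  have h1 : ‖y ^ 2 + 2 * y * c + 3 * (c : ℂ) ^ 2‖ ≤ (1 + |c|) ^ 2 + 2 * (1 + |c|) * |c| + 3 * |c| ^ 2 := by
    refine norm_add_le_of_le (norm_add_le_of_le ?_ ?_) ?_
    · rw [norm_pow]; gcongr
    · rw [norm_mul, norm_mul, hcn, Complex.norm_ofNat]; gcongr
    · rw [norm_mul, norm_pow, hcn, Complex.norm_ofNat]
  calc ‖(b : ℂ)‖ * _ ≤ 1 * _ := mul_le_mul D.norm_b h1 (norm_nonneg _) zero_le_one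
    _ = _ := one_mul _

theorem quartic_lipschitz {b y y' : ℂ} {R : ℝ} (hb : ‖b‖ ≤ 1) (hy : ‖y‖ ≤ R) (hy' : ‖y'‖ ≤ R) :
    ‖quartic b y - quartic b y'‖ ≤ (1 + 2 * R + 4 * R ^ 3) * ‖y - y'‖ := by
  have hR : 0 ≤ R := (norm_nonneg _).trans hy
  have hid : quartic b y - quartic b y' =
      (1 + (y + y') + b * (y ^ 3 + y ^ 2 * y' + y * y' ^ 2 + y' ^ 3)) * (y - y') := by
    rw [quartic, quartic]; ring
  rw [hid, norm_mul]
  gcongr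
  refine (norm_add_le_of_le (norm_add_le_of_le norm_one.le (norm_add_le_of_le hy hy'))
    (r₂ := 1 * (R ^ 3 + R ^ 2 * R + R * R ^ 2 + R ^ 3)) ?_).trans (le_of_eq (by ring))
  rw [norm_mul]
  gcongr
  refine norm_add_le_of_le (norm_add_le_of_le (norm_add_le_of_le ?_ ?_) ?_) ?_
  · rw [norm_pow]; gcongr
  · rw [norm_mul, norm_pow]; gcongr
  · rw [norm_mul, norm_pow]; gcongr
  · rw [norm_pow]; gcongr

set_option maxHeartbeats 1000000 in
/-- The return map over `2 n + 1` steps contracts a disk around `x 0`. -/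
theorem return_contracts (D : CriticalReturn b c C x u) {B : ℝ} (hB : 0 ≤ B) :
    ∃ r > 0, ∀ ε > 0, ∃ n₀ : ℕ, ∀ n, n₀ ≤ n → ∀ z e : ℕ → ℂ, GateOrbit b B n z e →
      ‖z 0 - x 0‖ ≤ r → ‖z (2 * n + 1) - x 0‖ ≤ ‖z 0 - x 0‖ / 2 + ε := by
  obtain ⟨K, hK, ρ, hρ, hgate⟩ := D.gate_to_critical hB
  set Q := 1 + ((1 + |c|) ^ 2 + 2 * (1 + |c|) * |c| + 3 * |c| ^ 2) with hQ
  have hQ0 : 0 < Q := by positivity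
  set R := ‖quartic b c‖ + Q + 1 with hR
  have hR0 : 0 < R := by positivity
  set Λ := 1 + 2 * R + 4 * R ^ 3 with hΛ
  have hΛ0 : 0 < Λ := by positivity
  -- The last entry makes the quadratic contribution `2ΛQK²d²` at most `d/2`; the middle one keeps
  -- the orbit within distance `1` of `c`.
  set r := min ρ (min (1 / (2 * K)) (1 / (4 * Λ * Q * K ^ 2))) with hr
  have hr0 : 0 < r := by positivity
  refine ⟨r, hr0, fun ε hε => ?_⟩
  set ε₁ := min (1 / 2) (ε / (4 * Λ * Q)) with hε₁
  have hε₁0 : 0 < ε₁ := by positivity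
  obtain ⟨n₀, hn₀⟩ := hgate ε₁ hε₁0
  set δ := min 1 (ε / (2 * (Λ + 1))) with hδd
  have hδ0 : 0 < δ := by positivity
  obtain ⟨n₁, hn₁⟩ := exists_nat_ge ((3 + B) / δ + 1)
  refine ⟨max n₀ n₁, fun n hn z e hz hz0 => ?_⟩
  have hnR : (n₁ : ℝ) ≤ n := by exact_mod_cast le_of_max_le_right hn
  have hq0 : 0 ≤ (3 + B) / δ := by positivity
  have hn0 : (0 : ℝ) < n := by linarith
  have hn1 : 1 ≤ n := by exact_mod_cast (by linarith : (1 : ℝ) ≤ n)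
  have hδ : (3 + B) / n ≤ δ := by
    rw [div_le_iff₀ hn0]
    have h1 : (3 + B) / δ ≤ n := by linarith
    rw [div_le_iff₀ (by positivity)] at h1
    linarith
  have h1 := hn₀ n (le_of_max_le_left hn) z e hz (hz0.trans (min_le_left _ _))
  have s1 := (hz.step_close hB hn1 (2 * n - 1) (by omega)).trans hδ
  have s2 := (hz.step_close hB hn1 (2 * n) (by omega)).trans hδ
  have e1 : 2 * n - 1 + 1 = 2 * n := by omega
  rw [e1] at s1
  set d := ‖z 0 - x 0‖ with hd
  have hd0 : 0 ≤ d := norm_nonneg _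
  set y := z (2 * n - 1) with hy
  have hKd : K * d ≤ 1 / 2 := by
    have := hz0.trans ((min_le_right _ _).trans (min_le_left _ _))
    rw [le_div_iff₀ (by positivity)] at this
    linarith
  have hε₁h : ε₁ ≤ 1 / 2 := min_le_left _ _
  have hyc : ‖y - c‖ ≤ 1 := by linarith
  have h2 := D.quartic_near_critical hyc
  rw [← hQ] at h2
  have h3 : ‖y - c‖ ^ 2 ≤ 2 * K ^ 2 * d ^ 2 + ε₁ := by
    calc ‖y - c‖ ^ 2 ≤ (K * d + ε₁) ^ 2 := by gcongr
      _ ≤ 2 * K ^ 2 * d ^ 2 + ε₁ := by nlinarith [sq_nonneg (K * d - ε₁)]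
  have h4 : ‖z (2 * n) - quartic b c‖ ≤ Q * ‖y - c‖ ^ 2 + δ := by
    have := norm_add_le_of_le s1 h2
    rw [sub_add_sub_cancel] at this; linarith
  have hδ1 : δ ≤ 1 := min_le_left _ _
  have h5 : ‖z (2 * n)‖ ≤ R := by
    have := norm_add_le_of_le h4 (le_refl ‖quartic b c‖)
    rw [sub_add_cancel] at this
    have h6 : ‖y - c‖ ^ 2 ≤ 1 := pow_le_one₀ (norm_nonneg _) hyc
    have : Q * ‖y - c‖ ^ 2 ≤ Q * 1 := by gcongr
    linarith
  have h6 := quartic_lipschitz D.norm_b h5 (by linarith : ‖quartic b c‖ ≤ R)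
  rw [← hΛ] at h6
  have h7 : ‖z (2 * n + 1) - x 0‖ ≤ δ + Λ * (Q * ‖y - c‖ ^ 2 + δ) := by
    have h8 := norm_add_le_of_le s2 (h6.trans (mul_le_mul_of_nonneg_left h4 hΛ0.le))
    rw [sub_add_sub_cancel, D.x_zero] at h8
    exact h8
  have h8 : d * (4 * Λ * Q * K ^ 2) ≤ 1 := by
    have := hz0.trans ((min_le_right _ _).trans (min_le_right _ _))
    rwa [le_div_iff₀ (by positivity)] at this
  have h9 : ε₁ * (4 * Λ * Q) ≤ ε := by
    have : ε₁ ≤ ε / (4 * Λ * Q) := min_le_right _ _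
    rwa [le_div_iff₀ (by positivity)] at this
  have h10 : δ * (2 * (Λ + 1)) ≤ ε := by
    have : δ ≤ ε / (2 * (Λ + 1)) := min_le_right _ _
    rwa [le_div_iff₀ (by positivity)] at this
  have h11 : Λ * (Q * ‖y - c‖ ^ 2) ≤ Λ * (Q * (2 * K ^ 2 * d ^ 2 + ε₁)) := by gcongr
  have h12 : d * (4 * Λ * Q * K ^ 2) * d ≤ 1 * d := by gcongr
  have e2 : Λ * (Q * (2 * K ^ 2 * d ^ 2 + ε₁)) =
      d * (4 * Λ * Q * K ^ 2) * d / 2 + ε₁ * (4 * Λ * Q) / 4 := by ring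
  have e3 : δ + Λ * (Q * ‖y - c‖ ^ 2 + δ) = Λ * (Q * ‖y - c‖ ^ 2) + δ * (2 * (Λ + 1)) / 2 := by
    ring
  linarith

end CriticalReturn
end ParabolicImplosion

/-! ### Asymptotics of the two real orbits and the limit of their phase mismatch. -/

namespace ParabolicImplosion
open Filter Topology

/-- A forward orbit `-t` of `z + z² - β z⁴` on the attracting side of `0` and a backward orbit `u` on
the repelling side. -/
structure OrbitPair (β : ℝ) (t u : ℕ → ℝ) : Prop where
  beta_lower : 239 / 1000 ≤ β
  beta_upper : β ≤ 8 / 27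
  t_zero_lower : 1 / 4 ≤ t 0
  t_zero_upper : t 0 ≤ 8 / 5
  t_succ : ∀ m, t (m + 1) = t m - t m ^ 2 + β * t m ^ 4
  u_zero_lower : 3 / 2 ≤ u 0
  u_zero_upper : u 0 ≤ 33 / 20
  u_pos : ∀ j, 0 < u j
  u_upper : ∀ j, u (j + 1) ≤ 4 / 3
  u_succ : ∀ j, u (j + 1) + u (j + 1) ^ 2 - β * u (j + 1) ^ 4 = u j

theorem attracting_factor {β t : ℝ} (h1 : 239 / 1000 ≤ β) (h2 : β ≤ 8 / 27) (ht : 0 < t)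
    (ht' : t ≤ 8 / 5) :
    1 / 5 ≤ 1 - t + β * t ^ 3 ∧ 1 - t + β * t ^ 3 < 1 ∧ 1 / 5 ≤ 1 - β * t ^ 2 := by
  have h3 : β * t ^ 2 ≤ 8 / 27 * (8 / 5) ^ 2 := by gcongr
  refine ⟨?_, ?_, by linarith⟩
  · have : 239 / 1000 * t ^ 3 ≤ β * t ^ 3 := by gcongr
    -- `59/50` approximates the minimiser `1/√(3·0.239)` of `1 - t + 0.239 t³`.
    nlinarith [mul_nonneg ht.le (sq_nonneg (t - 59 / 50)), sq_nonneg (t - 59 / 50)]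
  · nlinarith

theorem attracting_step {β t : ℝ} (h1 : 239 / 1000 ≤ β) (h2 : β ≤ 8 / 27) (ht : 0 < t)
    (ht' : t ≤ 8 / 5) :
    0 < t - t ^ 2 + β * t ^ 4 ∧ t - t ^ 2 + β * t ^ 4 < t ∧
    1 / 5 ≤ 1 / (t - t ^ 2 + β * t ^ 4) - 1 / t ∧
    |1 / (t - t ^ 2 + β * t ^ 4) - 1 / t - 1 - t| ≤ 10 * t ^ 2 := by
  obtain ⟨q1, q2, q3⟩ := attracting_factor h1 h2 ht ht'
  set q := 1 - t + β * t ^ 3 with hq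
  have e : t - t ^ 2 + β * t ^ 4 = t * q := by rw [hq]; ring
  have hq0 : 0 < q := by linarith
  have e2 : 1 / (t * q) - 1 / t = (1 - β * t ^ 2) / q := by
    field_simp; rw [hq]; ring
  rw [e, e2]
  refine ⟨by positivity, by nlinarith, ?_, ?_⟩
  · rw [le_div_iff₀ hq0]; linarith
  · have e3 : (1 - β * t ^ 2) / q - 1 - t = t ^ 2 * ((1 - β - β * t - β * t ^ 2) / q) := by
      field_simp; rw [hq]; ring
    rw [e3, abs_mul, abs_of_nonneg (sq_nonneg t), mul_comm]
    gcongr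
    rw [abs_div, abs_of_pos hq0, div_le_iff₀ hq0]
    have h0 : 0 ≤ β := by linarith
    have h4 : β * t ≤ 8 / 27 * (8 / 5) := by gcongr
    have h5 : β * t ^ 2 ≤ 8 / 27 * (8 / 5) ^ 2 := by gcongr
    have h6 : 0 ≤ β * t := by positivity
    have h7 : 0 ≤ β * t ^ 2 := by positivity
    rw [abs_le]
    constructor <;> linarith

theorem repelling_step {β y : ℝ} (h1 : 239 / 1000 ≤ β) (h2 : β ≤ 8 / 27) (hy : 0 < y)
    (hy' : y ≤ 4 / 3) :
    y < y + y ^ 2 - β * y ^ 4 ∧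
    1 / 5 ≤ 1 / y - 1 / (y + y ^ 2 - β * y ^ 4) ∧
    |1 / y - 1 / (y + y ^ 2 - β * y ^ 4) - 1 + y| ≤ 2 * y ^ 2 := by
  have h0 : 0 ≤ β := by linarith
  have h5 : β * y ^ 2 ≤ 8 / 27 * (4 / 3) ^ 2 := by gcongr
  have h6 : 0 ≤ β * y ^ 2 := by positivity
  set p := 1 + y - β * y ^ 3 with hp
  have hp1 : 1 < p := by
    have : p = 1 + y * (1 - β * y ^ 2) := by rw [hp]; ring
    nlinarith
  have hp2 : p ≤ 7 / 3 := by
    have : 0 ≤ β * y ^ 3 := by positivity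
    linarith
  have e : y + y ^ 2 - β * y ^ 4 = y * p := by rw [hp]; ring
  have hp0 : 0 < p := by linarith
  have e2 : 1 / y - 1 / (y * p) = (1 - β * y ^ 2) / p := by
    field_simp; rw [hp]; ring
  rw [e, e2]
  refine ⟨by nlinarith, ?_, ?_⟩
  · rw [le_div_iff₀ hp0]; linarith
  · have e3 : (1 - β * y ^ 2) / p - 1 + y = y ^ 2 * ((1 - β + β * y - β * y ^ 2) / p) := by
      field_simp; rw [hp]; ring
    rw [e3, abs_mul, abs_of_nonneg (sq_nonneg y), mul_comm]
    gcongr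
    rw [abs_div, abs_of_pos hp0, div_le_iff₀ hp0]
    have h4 : β * y ≤ 8 / 27 * (4 / 3) := by gcongr
    have h7 : 0 ≤ β * y := by positivity
    rw [abs_le]
    constructor <;> linarith

theorem linear_growth {Z : ℕ → ℝ} (h0 : 1 / 5 ≤ Z 0) (h : ∀ m, 1 / 5 ≤ Z (m + 1) - Z m) (m : ℕ) :
    ((m : ℝ) + 1) / 5 ≤ Z m := by
  induction m with
  | zero => simpa using h0
  | succ m ih => have := h m; push_cast; linarith

theorem sqrt_step (m : ℕ) : Real.sqrt (m + 1) + 1 / (4 * (m + 1)) ≤ Real.sqrt (m + 1 + 1) := by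
  have hm : (0 : ℝ) ≤ m := by positivity
  set s := Real.sqrt (m + 1) with hs
  have h1 : 1 ≤ s := Real.one_le_sqrt.2 (by linarith)
  have h2 : s ^ 2 = m + 1 := Real.sq_sqrt (by positivity)
  refine Real.le_sqrt_of_sq_le ?_
  rw [← h2]
  have e : (s + 1 / (4 * s ^ 2)) ^ 2 = s ^ 2 + (1 / s / 2 + (1 / s) ^ 4 / 16) := by
    field_simp; ring
  rw [e]
  have h3 : 1 / s ≤ 1 := by rw [div_le_one (by linarith)]; exact h1
  have h4 : (1 / s) ^ 4 ≤ 1 := pow_le_one₀ (by positivity) h3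
  linarith

/-- The errors accumulate like a logarithm; a square root majorises them and is the deviation
allowed at the entrance of the gate. -/
theorem asymp_of_step {Z : ℕ → ℝ} {D E : ℝ} (hD : 0 ≤ D) (hE : 0 ≤ E) (h0 : |Z 0| ≤ D)
    (h : ∀ m : ℕ, |Z (m + 1) - Z m - 1| ≤ E / (m + 1)) (m : ℕ) :
    |Z m - m| ≤ (D + 4 * E) * Real.sqrt (m + 1) := by
  have main : |Z m - m| ≤ D + 4 * E * Real.sqrt (m + 1) := by
    induction m with
    | zero => simp only [Nat.cast_zero, sub_zero, zero_add, Real.sqrt_one]; linarith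
    | succ m ih =>
      have h1 := h m
      have h2 := sqrt_step m
      have e : E / (m + 1) = 4 * E * (1 / (4 * (m + 1))) := by field_simp
      have h3 : 4 * E * (Real.sqrt (m + 1) + 1 / (4 * (m + 1))) ≤
          4 * E * Real.sqrt (m + 1 + 1) := by gcongr
      rw [mul_add, ← e] at h3
      have e2 : Z (m + 1) - ((m + 1 : ℕ) : ℝ) = (Z (m + 1) - Z m - 1) + (Z m - m) := by
        push_cast; ring
      rw [e2]
      refine (abs_add_le _ _).trans ?_
      push_cast
      linarith
  have h1 : 1 ≤ Real.sqrt (m + 1) := Real.one_le_sqrt.2 (by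
    have : (0 : ℝ) ≤ m := by positivity
    linarith)
  nlinarith

namespace OrbitPair

variable {β : ℝ} {t u : ℕ → ℝ}

theorem t_bounds (H : OrbitPair β t u) (m : ℕ) : 0 < t m ∧ t m ≤ 8 / 5 := by
  induction m with
  | zero => exact ⟨by linarith [H.t_zero_lower], H.t_zero_upper⟩
  | succ m ih =>
    obtain ⟨h1, h2, -⟩ := attracting_step H.beta_lower H.beta_upper ih.1 ih.2
    rw [H.t_succ]
    exact ⟨h1, h2.le.trans ih.2⟩

theorem t_step (H : OrbitPair β t u) (m : ℕ) : t (m + 1) < t m ∧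
    1 / 5 ≤ 1 / t (m + 1) - 1 / t m ∧ |1 / t (m + 1) - 1 / t m - 1 - t m| ≤ 10 * t m ^ 2 := by
  have := attracting_step H.beta_lower H.beta_upper (H.t_bounds m).1 (H.t_bounds m).2
  rw [← H.t_succ] at this
  exact this.2

theorem u_step (H : OrbitPair β t u) (j : ℕ) : u (j + 1) < u j ∧
    1 / 5 ≤ 1 / u (j + 1) - 1 / u j ∧
    |1 / u (j + 1) - 1 / u j - 1 + u (j + 1)| ≤ 2 * u (j + 1) ^ 2 := by
  have := repelling_step H.beta_lower H.beta_upper (H.u_pos (j + 1)) (H.u_upper j)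
  rw [H.u_succ] at this
  exact this

theorem t_growth (H : OrbitPair β t u) (m : ℕ) : ((m : ℝ) + 1) / 5 ≤ 1 / t m := by
  refine linear_growth (Z := fun m => 1 / t m) ?_ (fun m => (H.t_step m).2.1) m
  have := (H.t_bounds 0).1
  rw [div_le_div_iff₀ (by norm_num) this]
  linarith [H.t_zero_upper]

theorem u_growth (H : OrbitPair β t u) (j : ℕ) : ((j : ℝ) + 1) / 5 ≤ 1 / u j := by
  refine linear_growth (Z := fun m => 1 / u m) ?_ (fun m => (H.u_step m).2.1) j
  have := H.u_pos 0
  rw [div_le_div_iff₀ (by norm_num) this]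
  linarith [H.u_zero_upper]

theorem t_le (H : OrbitPair β t u) (m : ℕ) : t m ≤ 5 / (m + 1) := by
  have h := H.t_growth m
  rw [div_le_div_iff₀ (by norm_num) (H.t_bounds m).1] at h
  rw [le_div_iff₀ (by positivity)]
  linarith

theorem u_le (H : OrbitPair β t u) (j : ℕ) : u j ≤ 5 / (j + 1) := by
  have h := H.u_growth j
  rw [div_le_div_iff₀ (by norm_num) (H.u_pos j)] at h
  rw [le_div_iff₀ (by positivity)]
  linarith

theorem t_asymp (H : OrbitPair β t u) (m : ℕ) : |1 / t m - m| ≤ 344 * Real.sqrt (m + 1) := by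
  have := asymp_of_step (Z := fun m => 1 / t m) (D := 4) (E := 85) (by norm_num) (by norm_num) ?_ ?_ m
  · norm_num at this ⊢; exact this
  · have h0 := (H.t_bounds 0).1
    rw [abs_of_pos (by positivity), div_le_iff₀ h0]
    linarith [H.t_zero_lower]
  · intro m
    obtain ⟨h0, h0'⟩ := H.t_bounds m
    have h1 := H.t_le m
    have h2 := abs_le.1 (H.t_step m).2.2
    have e : (85 : ℝ) / (m + 1) = 17 * (5 / (m + 1)) := by ring
    rw [e]
    have h3 : t m ^ 2 ≤ 8 / 5 * t m := by nlinarith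
    rw [abs_le]
    constructor <;> linarith [h2.1, h2.2]

theorem u_asymp (H : OrbitPair β t u) (j : ℕ) : |1 / u j - j| ≤ 344 * Real.sqrt (j + 1) := by
  have := asymp_of_step (Z := fun m => 1 / u m) (D := 4) (E := 85) (by norm_num) (by norm_num) ?_ ?_ j
  · norm_num at this ⊢; exact this
  · have h0 := H.u_pos 0
    rw [abs_of_pos (by positivity), div_le_iff₀ h0]
    linarith [H.u_zero_lower]
  · intro m
    have h0 := H.u_pos (m + 1)
    have h0' := H.u_upper m
    have h1 := H.u_le m
    have h2 := abs_le.1 (H.u_step m).2.2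
    have h4 := (H.u_step m).1
    have e : (85 : ℝ) / (m + 1) = 17 * (5 / (m + 1)) := by ring
    rw [e]
    have h3 : u (m + 1) ^ 2 ≤ 4 / 3 * u (m + 1) := by nlinarith
    rw [abs_le]
    constructor <;> linarith [h2.1, h2.2]

theorem sqrt_bounds (j : ℕ) : 1 ≤ Real.sqrt (j + 1) ∧ Real.sqrt (j + 1 + 1) ≤ 2 * Real.sqrt (j + 1) ∧
    Real.sqrt (j + 2 + 1) ≤ 2 * Real.sqrt (j + 1) ∧ Real.sqrt (j + 1) ^ 2 = j + 1 := by
  have hj : (0 : ℝ) ≤ j := by positivity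
  have h2 : Real.sqrt (j + 1) ^ 2 = j + 1 := Real.sq_sqrt (by positivity)
  refine ⟨Real.one_le_sqrt.2 (by linarith), ?_, ?_, h2⟩ <;>
  · rw [Real.sqrt_le_left (by positivity), mul_pow, h2]; linarith

theorem phase_gap (H : OrbitPair β t u) (j : ℕ) :
    |1 / t (j + 2) - 1 / u j| ≤ 2000 * Real.sqrt (j + 1) ∧
    |1 / t (j + 2) - 1 / u (j + 1)| ≤ 2000 * Real.sqrt (j + 1) := by
  obtain ⟨s1, s2, s3, -⟩ := sqrt_bounds j
  have h1 := H.t_asymp (j + 2)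
  have h2 := H.u_asymp j
  have h3 := H.u_asymp (j + 1)
  push_cast at h1 h2 h3
  rw [abs_le] at h1 h2 h3
  constructor <;> rw [abs_le] <;> constructor <;> linarith [h1.1, h1.2, h2.1, h2.2, h3.1, h3.2]

/-- The sum of the two phases. -/
noncomputable def mismatch (t u : ℕ → ℝ) (j : ℕ) : ℝ := 1 / t (j + 2) + 1 / u j - 2 * (j + 2)

/-- Up to quadratic terms, `1/t` grows by `1 + t` and `1/u` by `1 - u`. The two harmonic corrections
nearly cancel: `t - u = -(1/t - 1/u) t u` is `O(√j / j²)`, so the increments are summable and no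
logarithm survives. -/
theorem mismatch_step (H : OrbitPair β t u) (j : ℕ) :
    |mismatch t u (j + 1) - mismatch t u j| ≤ 60000 / ((j + 1) * Real.sqrt (j + 1)) := by
  obtain ⟨s1, -, -, s4⟩ := sqrt_bounds j
  set s := Real.sqrt (j + 1) with hs
  have hs0 : 0 < s := by linarith
  have ht := (H.t_step (j + 2)).2.2
  have hu := (H.u_step j).2.2
  have ht0 := (H.t_bounds (j + 2)).1
  have hu0 := H.u_pos (j + 1)
  have gap := (H.phase_gap j).2
  have ht1 : t (j + 2) ≤ 5 / s ^ 2 := by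
    refine (H.t_le (j + 2)).trans ?_
    rw [s4]; push_cast; gcongr; linarith
  have hu1 : u (j + 1) ≤ 5 / s ^ 2 := by
    refine (H.u_le (j + 1)).trans ?_
    rw [s4]; push_cast; gcongr; linarith
  have e : mismatch t u (j + 1) - mismatch t u j =
      (1 / t (j + 2 + 1) - 1 / t (j + 2) - 1 - t (j + 2)) +
      (1 / u (j + 1) - 1 / u j - 1 + u (j + 1)) + (t (j + 2) - u (j + 1)) := by
    have e1 : j + 1 + 2 = j + 2 + 1 := by omega
    unfold mismatch
    rw [e1]; push_cast; ring
  have e2 : t (j + 2) - u (j + 1) =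
      -((1 / t (j + 2) - 1 / u (j + 1)) * (t (j + 2) * u (j + 1))) := by
    field_simp; ring
  have h3 : |t (j + 2) - u (j + 1)| ≤ 50000 / s ^ 3 := by
    rw [e2, abs_neg, abs_mul, abs_of_pos (by positivity : 0 < t (j + 2) * u (j + 1))]
    calc _ ≤ (2000 * s) * ((5 / s ^ 2) * (5 / s ^ 2)) := by gcongr
      _ = 50000 / s ^ 3 := by field_simp; norm_num
  have h4 : 10 * t (j + 2) ^ 2 + 2 * u (j + 1) ^ 2 ≤ 300 / s ^ 3 := by
    calc _ ≤ 10 * (5 / s ^ 2) ^ 2 + 2 * (5 / s ^ 2) ^ 2 := by gcongr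
      _ = 300 / s ^ 4 := by field_simp; norm_num
      _ ≤ 300 / s ^ 3 := by
        gcongr
        norm_num
  rw [e]
  refine (abs_add_three _ _ _).trans ?_
  have e3 : ((j : ℝ) + 1) * s = s ^ 3 := by rw [← s4]; ring
  rw [e3]
  have e4 : 60000 / s ^ 3 = 50000 / s ^ 3 + 300 / s ^ 3 + 9700 / s ^ 3 := by ring
  have : 0 < 9700 / s ^ 3 := by positivity
  linarith

theorem summable_bound : Summable (fun j : ℕ => (60000 : ℝ) / ((j + 1) * Real.sqrt (j + 1))) := by
  have h := (summable_nat_add_iff 1).2 (Real.summable_one_div_nat_rpow.2 (by norm_num : (1 : ℝ) < 3 / 2))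
  refine (h.mul_left 60000).congr fun j => ?_
  have hj : (0 : ℝ) < (j : ℝ) + 1 := by positivity
  push_cast
  rw [Real.sqrt_eq_rpow, ← Real.rpow_one_add' hj.le (by norm_num), mul_one_div]
  norm_num

/-- Writing the limit as a series gives its continuity in the parameter by the Weierstrass test. -/
noncomputable def mismatchLimit (t u : ℕ → ℝ) : ℝ :=
  mismatch t u 0 + ∑' j, (mismatch t u (j + 1) - mismatch t u j)

theorem tendsto_mismatch (H : OrbitPair β t u) :
    Tendsto (mismatch t u) atTop (𝓝 (mismatchLimit t u)) := by
  have hs : Summable (fun j => mismatch t u (j + 1) - mismatch t u j) :=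
    Summable.of_norm_bounded summable_bound H.mismatch_step
  refine (hs.hasSum.tendsto_sum_nat.const_add (mismatch t u 0)).congr fun n => ?_
  rw [Finset.sum_range_sub]; ring

theorem tendsto_gap : Tendsto (fun j : ℕ => 10000 / Real.sqrt (j + 1)) atTop (𝓝 0) := by
  refine Tendsto.div_atTop tendsto_const_nhds (Real.tendsto_sqrt_atTop.comp ?_)
  exact tendsto_atTop_add_const_right _ _ tendsto_natCast_atTop_atTop

theorem log_gap (H : OrbitPair β t u) (j : ℕ) :
    |Real.log (1 / t (j + 2)) - Real.log (1 / u j)| ≤ 10000 / Real.sqrt (j + 1) := by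
  have hX : 0 < 1 / t (j + 2) := by have := (H.t_bounds (j + 2)).1; positivity
  have hY : 0 < 1 / u j := by have := H.u_pos j; positivity
  obtain ⟨s1, -, -, s4⟩ := sqrt_bounds j
  have gap := (H.phase_gap j).1
  have hX1 := H.t_growth (j + 2)
  have hY1 := H.u_growth j
  set s := Real.sqrt (j + 1)
  set X := 1 / t (j + 2)
  set Y := 1 / u j
  have hs : 0 < s := by linarith
  have hX2 : s ^ 2 / 5 ≤ X := by rw [s4]; refine le_trans ?_ hX1; push_cast; gcongr; linarith
  have hY2 : s ^ 2 / 5 ≤ Y := by rw [s4]; exact hY1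
  have key : ∀ {A B : ℝ}, 0 < A → s ^ 2 / 5 ≤ B → |A - B| ≤ 2000 * s →
      Real.log A - Real.log B ≤ 10000 / s := by
    intro A B hA hB h
    have hB0 : 0 < B := by have : 0 < s ^ 2 / 5 := by positivity
                           linarith
    rw [← Real.log_div hA.ne' hB0.ne']
    refine (Real.log_le_sub_one_of_pos (by positivity)).trans ?_
    have e : A / B - 1 = (A - B) / B := by field_simp
    rw [e]
    calc (A - B) / B ≤ (2000 * s) / (s ^ 2 / 5) := by
          gcongr; exact (le_abs_self _).trans h
      _ = 10000 / s := by field_simp; norm_num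
  have h1 := key hX hY2 gap
  have h2 := key hY hX2 (by rwa [abs_sub_comm])
  rw [abs_le]; constructor <;> linarith

/-- The expressions `1/t + log t - m` and `1/u - log u - j` are approximate Fatou coordinates. Their
logarithms cancel in the limit by `log_gap`, and the `-2` comes from `2(j + 2) = (j + 2) + j + 2`.
-/
theorem mismatchLimit_ge (H : OrbitPair β t u) {A B : ℝ}
    (hA : ∀ m : ℕ, A ≤ 1 / t (m + 1) + Real.log (t (m + 1)) - (m + 1))
    (hB : ∀ j : ℕ, B ≤ 1 / u (j + 1) - Real.log (u (j + 1)) - (j + 1)) :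
    A + B - 2 ≤ mismatchLimit t u := by
  have h1 : Tendsto (fun j => mismatch t u (j + 1) + 10000 / Real.sqrt ((j + 1 : ℕ) + 1)) atTop
      (𝓝 (mismatchLimit t u + 0)) :=
    ((tendsto_add_atTop_iff_nat 1).2 H.tendsto_mismatch).add
      ((tendsto_add_atTop_iff_nat 1).2 tendsto_gap)
  rw [add_zero] at h1
  refine ge_of_tendsto' h1 fun j => ?_
  have g := (abs_le.1 (H.log_gap (j + 1))).1
  have a := hA (j + 2)
  have b := hB j
  rw [one_div, one_div, Real.log_inv, Real.log_inv] at g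
  have e : j + 1 + 2 = j + 2 + 1 := by omega
  unfold mismatch
  rw [e] at g ⊢
  push_cast at a g ⊢
  linarith

theorem mismatchLimit_le (H : OrbitPair β t u) {A B : ℝ}
    (hA : ∀ m : ℕ, 1 / t (m + 1) + Real.log (t (m + 1)) - (m + 1) ≤ A)
    (hB : ∀ j : ℕ, 1 / u (j + 1) - Real.log (u (j + 1)) - (j + 1) ≤ B) :
    mismatchLimit t u ≤ A + B - 2 := by
  have h1 : Tendsto (fun j => mismatch t u (j + 1) - 10000 / Real.sqrt ((j + 1 : ℕ) + 1)) atTop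
      (𝓝 (mismatchLimit t u - 0)) :=
    ((tendsto_add_atTop_iff_nat 1).2 H.tendsto_mismatch).sub
      ((tendsto_add_atTop_iff_nat 1).2 tendsto_gap)
  rw [sub_zero] at h1
  refine le_of_tendsto' h1 fun j => ?_
  have g := (abs_le.1 (H.log_gap (j + 1))).2
  have a := hA (j + 2)
  have b := hB j
  rw [one_div, one_div, Real.log_inv, Real.log_inv] at g
  have e : j + 1 + 2 = j + 2 + 1 := by omega
  unfold mismatch
  rw [e] at g ⊢
  push_cast at a g ⊢
  linarith

end OrbitPair
end ParabolicImplosion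

/-! ### Numerical sign of the mismatch at the two extreme parameters. -/

namespace ParabolicImplosion
open Filter Topology

/-- This is `θ ≤ sinh θ` at `θ = log x`. It is accurate to second order at `1`, which turns the sign
of a Fatou coordinate increment into a polynomial inequality. -/
theorem log_le_half_sub_inv {x : ℝ} (hx : 1 ≤ x) : Real.log x ≤ (x - x⁻¹) / 2 := by
  rw [← Real.sinh_log (by linarith)]
  exact Real.self_le_sinh_iff.2 (Real.log_nonneg hx)

theorem half_sub_inv_le_log {x : ℝ} (hx0 : 0 < x) (hx : x ≤ 1) : (x - x⁻¹) / 2 ≤ Real.log x := by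
  have := log_le_half_sub_inv ((one_le_inv₀ hx0).2 hx)
  rw [Real.log_inv, inv_inv] at this
  linarith

namespace OrbitPair

variable {β : ℝ} {t u : ℕ → ℝ}

theorem attracting_log_step (H : OrbitPair β t u) (m : ℕ) :
    1 / t (m + 1) + Real.log (t (m + 1)) - (m + 1) - (1 / t m + Real.log (t m) - m) =
      (1 - β * t m ^ 2) / (1 - t m + β * t m ^ 3) - 1 + Real.log (1 - t m + β * t m ^ 3) := by
  obtain ⟨h1, h2⟩ := H.t_bounds m
  obtain ⟨q1, -, -⟩ := attracting_factor H.beta_lower H.beta_upper h1 h2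
  have e : t (m + 1) = t m * (1 - t m + β * t m ^ 3) := by rw [H.t_succ]; ring
  set q := 1 - t m + β * t m ^ 3 with hq
  have hq0 : 0 < q := by linarith
  rw [e, Real.log_mul h1.ne' hq0.ne']
  field_simp
  rw [hq]; ring

theorem repelling_factor (H : OrbitPair β t u) (j : ℕ) :
    0 < 1 - β * u (j + 1) ^ 2 ∧ 1 < 1 + u (j + 1) - β * u (j + 1) ^ 3 ∧
    u j = u (j + 1) * (1 + u (j + 1) - β * u (j + 1) ^ 3) := by
  have h1 := H.u_pos (j + 1)
  have h2 := H.u_upper j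
  have h3 : β * u (j + 1) ^ 2 ≤ 8 / 27 * (4 / 3) ^ 2 := by
    have := H.beta_upper
    gcongr
  have h4 : 0 < 1 - β * u (j + 1) ^ 2 := by linarith
  refine ⟨h4, by nlinarith, by rw [← H.u_succ]; ring⟩

theorem repelling_log_step (H : OrbitPair β t u) (j : ℕ) :
    1 / u (j + 1) - Real.log (u (j + 1)) - (j + 1) - (1 / u j - Real.log (u j) - j) =
      (1 - β * u (j + 1) ^ 2) / (1 + u (j + 1) - β * u (j + 1) ^ 3) - 1 +
        Real.log (1 + u (j + 1) - β * u (j + 1) ^ 3) := by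
  obtain ⟨-, p1, e⟩ := H.repelling_factor j
  have h1 := H.u_pos (j + 1)
  set p := 1 + u (j + 1) - β * u (j + 1) ^ 3 with hp
  have hp0 : 0 < p := by linarith
  rw [e, Real.log_mul h1.ne' hp0.ne']
  field_simp
  rw [hp]; ring

/-- The attracting coordinate starts above `2.2` and never decreases, because `(1 - (8/27)t²)² ≥
16/27` for `t ≤ 9/32`. The repelling coordinate is at least `-0.1` after one step and does not
decrease afterwards, where `u ≤ 3/5`. Finally `2.2 - 0.1 - 2 > 0`. -/
theorem mismatchLimit_pos (H : OrbitPair (8 / 27) t u) (ht : t 0 = 9 / 32) (hu : u 0 = 3 / 2) :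
    0 < mismatchLimit t u := by
  have htle : ∀ m, t m ≤ 9 / 32 := by
    intro m
    induction m with
    | zero => exact ht.le
    | succ m ih => exact (H.t_step m).1.le.trans ih
  have hA : ∀ m : ℕ, 2.2 ≤ 1 / t m + Real.log (t m) - m := by
    intro m
    induction m with
    | zero =>
      have h1 : Real.log (9 / 32) = Real.log (9 / 8) - 2 * Real.log 2 := by
        rw [show (9 / 32 : ℝ) = 9 / 8 / 2 ^ 2 by norm_num, Real.log_div (by norm_num) (by norm_num),
          Real.log_pow]
        norm_num
      have h2 := Real.one_sub_inv_le_log_of_pos (by norm_num : (0 : ℝ) < 9 / 8)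
      have h3 := Real.log_two_lt_d9
      rw [ht, h1]
      norm_num at h2 h3 ⊢
      linarith
    | succ m ih =>
      have e := H.attracting_log_step m
      obtain ⟨h1, h2⟩ := H.t_bounds m
      have h3 := htle m
      obtain ⟨q1, q2, -⟩ := attracting_factor H.beta_lower H.beta_upper h1 h2
      set q := 1 - t m + 8 / 27 * t m ^ 3 with hq
      have hq0 : 0 < q := by linarith
      have h4 := half_sub_inv_le_log hq0 q2.le
      have h5 : 0 ≤ (1 - 8 / 27 * t m ^ 2) / q - 1 + (q - q⁻¹) / 2 := by
        have e2 : (1 - 8 / 27 * t m ^ 2) / q - 1 + (q - q⁻¹) / 2 =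
            t m ^ 2 * ((1 - 8 / 27 * t m ^ 2) ^ 2 - 16 / 27) / (2 * q) := by
          field_simp; rw [hq]; ring
        rw [e2]
        have h6 : t m ^ 2 ≤ (9 / 32) ^ 2 := by gcongr
        have h7 : 0 ≤ (1 - 8 / 27 * t m ^ 2) ^ 2 - 16 / 27 := by nlinarith
        positivity
      push_cast
      linarith
  -- The quartic is increasing on `[23/25, 4/3]` and already exceeds `u 0 = 3/2` at `23/25`. The
  -- bound for `u 2` is obtained in the same way.
  have hu1 : u 1 ≤ 23 / 25 := by
    by_contra! h
    have h1 := H.u_succ 0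
    have h2 := H.u_upper 0
    rw [hu] at h1
    simp only [zero_add] at h1 h2
    nlinarith [mul_pos (sub_pos.2 h) (sub_pos.2 h), pow_pos (H.u_pos 1) 2, pow_pos (H.u_pos 1) 3,
      mul_nonneg (sub_nonneg.2 h.le) (sub_nonneg.2 h2),
      mul_nonneg (mul_nonneg (sub_nonneg.2 h.le) (sub_nonneg.2 h2)) (H.u_pos 1).le,
      mul_nonneg (mul_nonneg (sub_nonneg.2 h.le) (sub_nonneg.2 h2)) (sq_nonneg (u 1))]
  have hu2 : u 2 ≤ 3 / 5 := by
    by_contra! h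
    have h1 := H.u_succ 1
    have h2 : u (1 + 1) ≤ 1 := (H.u_step 1).1.le.trans (by linarith)
    norm_num at h1 h2
    nlinarith [mul_pos (sub_pos.2 h) (sub_pos.2 h), pow_pos (H.u_pos 2) 2, pow_pos (H.u_pos 2) 3,
      mul_nonneg (sub_nonneg.2 h.le) (sub_nonneg.2 h2),
      mul_nonneg (mul_nonneg (sub_nonneg.2 h.le) (sub_nonneg.2 h2)) (H.u_pos 2).le,
      mul_nonneg (mul_nonneg (sub_nonneg.2 h.le) (sub_nonneg.2 h2)) (sq_nonneg (u 2))]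
  have hule : ∀ j, u (j + 2) ≤ 3 / 5 := by
    intro j
    induction j with
    | zero => exact hu2
    | succ j ih => exact (H.u_step (j + 2)).1.le.trans ih
  have hB : ∀ j : ℕ, -0.1 ≤ 1 / u (j + 1) - Real.log (u (j + 1)) - (j + 1) := by
    intro j
    induction j with
    | zero =>
      have e := H.repelling_log_step 0
      obtain ⟨p0, p1, p2⟩ := H.repelling_factor 0
      have h0 := H.u_pos 1
      have h4 := log_le_half_sub_inv (by norm_num : (1 : ℝ) ≤ 3 / 2)
      rw [hu] at e p2
      simp only [zero_add, Nat.cast_zero] at *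
      set p := 1 + u 1 - 8 / 27 * u 1 ^ 3 with hp
      have hp0 : 0 < p := by linarith
      have h5 := Real.one_sub_inv_le_log_of_pos hp0
      have h6 : -0.3 ≤ (1 - 8 / 27 * u 1 ^ 2) / p - p⁻¹ := by
        have e2 : (1 - 8 / 27 * u 1 ^ 2) / p - p⁻¹ = -(8 / 27 * u 1 ^ 2 / p) := by
          field_simp; ring
        rw [e2, neg_le_neg_iff, div_le_iff₀ hp0]
        have : u 1 ^ 2 ≤ (23 / 25) ^ 2 := by gcongr
        norm_num at this ⊢
        linarith
      norm_num at h4 h6 e ⊢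
      linarith
    | succ j ih =>
      have e := H.repelling_log_step (j + 1)
      obtain ⟨p0, p1, -⟩ := H.repelling_factor (j + 1)
      have e1 : j + 1 + 1 = j + 2 := rfl
      rw [e1] at e p0 p1 ⊢
      have h0 := H.u_pos (j + 2)
      have h3 := hule j
      set y := u (j + 2) with hy
      set p := 1 + y - 8 / 27 * y ^ 3 with hp
      have hp0 : 0 < p := by linarith
      have h4 := Real.le_log_one_add_of_nonneg (x := p - 1) (by linarith)
      rw [add_sub_cancel] at h4
      have h5 : 0 ≤ (1 - 8 / 27 * y ^ 2) / p - 1 + 2 * (p - 1) / (p - 1 + 2) := by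
        have e3 : p - 1 + 2 = p + 1 := by ring
        have hp1 : 0 < p + 1 := by linarith
        have e2 : (1 - 8 / 27 * y ^ 2) / p - 1 + 2 * (p - 1) / (p + 1) =
            y ^ 2 * ((1 - 8 / 27 * y ^ 2) ^ 2 - 8 / 27 * (p + 1)) / (p * (p + 1)) := by
          field_simp; rw [hp]; ring
        rw [e3, e2]
        have h6 : y ^ 2 ≤ (3 / 5) ^ 2 := by gcongr
        have h7 : p ≤ 8 / 5 := by
          have : 0 ≤ y ^ 3 := by positivity
          linarith
        have h8 : 0 ≤ (1 - 8 / 27 * y ^ 2) ^ 2 - 8 / 27 * (p + 1) := by nlinarith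
        positivity
      push_cast at e ⊢
      linarith
  have := H.mismatchLimit_ge (A := 2.2) (B := -0.1)
    (fun m => by have := hA (m + 1); push_cast at this; exact this) hB
  norm_num at this
  linarith

/-- Adding `1.7 t` and `0.27 u` turns the two approximate Fatou coordinates into nonincreasing
sequences, so their initial values bound the limits: `1.33 + 0.57 - 2 < 0`. The attracting estimate
starts at `t 1`, where the point is already small. -/
theorem mismatchLimit_neg (H : OrbitPair β t u) (ht : t 1 ≤ 11 / 20)
    (ht' : 27 / 50 ≤ t 1) (hu : u 0 = 33 / 20) :
    mismatchLimit t u < 0 := by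
  have hβ0 := H.beta_lower
  have htle : ∀ m, t (m + 1) ≤ 11 / 20 := by
    intro m
    induction m with
    | zero => exact ht
    | succ m ih => exact (H.t_step (m + 1)).1.le.trans ih
  have hA : ∀ m : ℕ, 1 / t (m + 1) + Real.log (t (m + 1)) - (m + 1) + 1.7 * t (m + 1) ≤ 1.33 := by
    intro m
    induction m with
    | zero =>
      have h0 : 0 < t 1 := by linarith
      have h1 := Real.log_le_sub_one_of_pos h0
      have h2 : 1 / t 1 ≤ 50 / 27 := by
        rw [div_le_div_iff₀ h0 (by norm_num)]; linarith
      have h3 : 1 / t 1 + 2.7 * t 1 ≤ 3.33 := by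
        rw [← sub_nonneg]
        have e : 3.33 - (1 / t 1 + 2.7 * t 1) = (3.33 * t 1 - 1 - 2.7 * t 1 ^ 2) / t 1 := by
          field_simp; ring
        rw [e]
        refine div_nonneg ?_ h0.le
        nlinarith
      simp only [zero_add, Nat.cast_zero]
      norm_num at h3 ⊢
      linarith
    | succ m ih =>
      have e := H.attracting_log_step (m + 1)
      obtain ⟨h1, h2⟩ := H.t_bounds (m + 1)
      have h3 := htle m
      obtain ⟨q1, q2, q3⟩ := attracting_factor H.beta_lower H.beta_upper h1 h2
      have hs := H.t_succ (m + 1)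
      set y := t (m + 1) with hy
      set q := 1 - y + β * y ^ 3 with hq
      have hq0 : 0 < q := by linarith
      have h4 := Real.log_le_sub_one_of_pos hq0
      have h5 : (1 - β * y ^ 2) / q - 1 + (q - 1) ≤ 1.7 * (y - t (m + 1 + 1)) := by
        have e2 : (1 - β * y ^ 2) / q - 1 + (q - 1) = y ^ 2 * (((1 - β * y ^ 2) ^ 2 - β) / q) := by
          field_simp; rw [hq]; ring
        have e3 : 1.7 * (y - t (m + 1 + 1)) = y ^ 2 * (1.7 * (1 - β * y ^ 2)) := by rw [hs]; ring
        rw [e2, e3]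
        gcongr
        rw [div_le_iff₀ hq0]
        have h6 : 0 ≤ β * y ^ 3 := by positivity
        have h7 : 0.45 ≤ q := by norm_num; linarith
        have h8 : 0 ≤ β * y ^ 2 := by positivity
        have h9 : (1 - β * y ^ 2) * 0.45 ≤ (1 - β * y ^ 2) * q := by gcongr
        norm_num at h9 ⊢
        nlinarith
      push_cast at e ⊢
      linarith
  have hB : ∀ j : ℕ, 1 / u j - Real.log (u j) - j + 0.27 * u j ≤ 0.57 := by
    intro j
    induction j with
    | zero =>
      have h4 := Real.le_log_one_add_of_nonneg (x := 13 / 20) (by norm_num)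
      rw [hu]
      norm_num at h4 ⊢
      linarith
    | succ j ih =>
      have e := H.repelling_log_step j
      obtain ⟨p0, p1, p2⟩ := H.repelling_factor j
      have h0 := H.u_pos (j + 1)
      set y := u (j + 1) with hy
      set p := 1 + y - β * y ^ 3 with hp
      have hp0 : 0 < p := by linarith
      have h4 := log_le_half_sub_inv p1.le
      have h5 : (1 - β * y ^ 2) / p - 1 + (p - p⁻¹) / 2 ≤ 0.27 * (u j - y) := by
        have e2 : (1 - β * y ^ 2) / p - 1 + (p - p⁻¹) / 2 =
            y ^ 2 * (((1 - β * y ^ 2) ^ 2 - 2 * β) / (2 * p)) := by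
          field_simp; rw [hp]; ring
        have e3 : 0.27 * (u j - y) = y ^ 2 * (0.27 * (1 - β * y ^ 2)) := by rw [p2]; ring
        rw [e2, e3]
        gcongr
        rw [div_le_iff₀ (by positivity)]
        have h8 : 0 ≤ β * y ^ 2 := by positivity
        have h9 : (1 - β * y ^ 2) * 1 ≤ (1 - β * y ^ 2) * p := by gcongr
        norm_num at h9 ⊢
        nlinarith
      push_cast
      linarith
  have := H.mismatchLimit_le (A := 1.33) (B := 0.57)
    (fun m => by
      have := hA m
      have := (H.t_bounds (m + 1)).1
      linarith)
    (fun j => by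
      have := hB (j + 1)
      have := H.u_pos (j + 1)
      push_cast at *
      linarith)
  norm_num at this
  linarith

end OrbitPair
end ParabolicImplosion

/-! ### Continuity in the critical point and choice of the parameter. -/

namespace ParabolicImplosion
open Filter Topology Set

/-- The absolute value of the quartic coefficient for which `c` is a critical point. -/
noncomputable def critBeta (c : ℝ) : ℝ := (1 + 2 * c) / (4 * c ^ 3)

noncomputable def critValue (c : ℝ) : ℝ := c + c ^ 2 - critBeta c * c ^ 4

/-- Signs are reversed to work with positive numbers: this is minus the orbit of `f(f(c))`. -/
noncomputable def forwardOrbit (c : ℝ) (m : ℕ) : ℝ :=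
  (fun t => t - t ^ 2 + critBeta c * t ^ 4)^[m]
    (-(critValue c + critValue c ^ 2 - critBeta c * critValue c ^ 4))

theorem forwardOrbit_succ (c : ℝ) (m : ℕ) : forwardOrbit c (m + 1) =
    forwardOrbit c m - forwardOrbit c m ^ 2 + critBeta c * forwardOrbit c m ^ 4 := by
  unfold forwardOrbit
  rw [Function.iterate_succ_apply']

theorem continuousOn_critBeta : ContinuousOn critBeta (Icc (3 / 2) (33 / 20)) := by
  unfold critBeta
  refine ContinuousOn.div (by fun_prop) (by fun_prop) fun c hc => ?_
  have : 0 < c := by linarith [hc.1]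
  positivity

theorem continuousOn_forwardOrbit (m : ℕ) :
    ContinuousOn (fun c => forwardOrbit c m) (Icc (3 / 2) (33 / 20)) := by
  have hb := continuousOn_critBeta
  have hv : ContinuousOn critValue (Icc (3 / 2) (33 / 20)) := by unfold critValue; fun_prop
  induction m with
  | zero => unfold forwardOrbit; simp only [Function.iterate_zero, id]; fun_prop
  | succ m ih => simp only [forwardOrbit_succ]; fun_prop

theorem critBeta_bounds {c : ℝ} (hc : c ∈ Icc (3 / 2 : ℝ) (33 / 20)) :
    239 / 1000 ≤ critBeta c ∧ critBeta c ≤ 8 / 27 := by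
  obtain ⟨h1, h2⟩ := hc
  have h0 : 0 < c := by linarith
  unfold critBeta
  rw [div_le_div_iff₀ (by norm_num) (by positivity), div_le_div_iff₀ (by positivity) (by norm_num)]
  constructor
  · have : c ^ 3 ≤ c * (33 / 20) ^ 2 := by
      have : c ^ 2 ≤ (33 / 20) ^ 2 := by gcongr
      nlinarith
    nlinarith [mul_nonneg (sub_nonneg.2 h1) (sub_nonneg.2 h2)]
  · nlinarith [mul_nonneg (sub_nonneg.2 h1) h0.le, mul_nonneg (mul_nonneg (sub_nonneg.2 h1) h0.le) h0.le]

/-- The prefactor is the critical value. In powers of `2c - 3` all coefficients are positive, so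
bounds on the parameter interval follow by monotonicity from its end points. -/
theorem forwardOrbit_zero {c : ℝ} (hc : c ≠ 0) : forwardOrbit c 0 =
    (3 + (2 * c - 3)) * (6 + (2 * c - 3)) / 8 * (1 / 8 + 45 / 32 * (2 * c - 3) +
      37 / 64 * (2 * c - 3) ^ 2 + 22 / 256 * (2 * c - 3) ^ 3 + (2 * c - 3) ^ 4 / 256) := by
  simp only [forwardOrbit, critValue, critBeta, Function.iterate_zero, id]
  field_simp
  ring

theorem forwardOrbit_zero_bounds {c : ℝ} (hc : c ∈ Icc (3 / 2 : ℝ) (33 / 20)) :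
    1 / 4 ≤ forwardOrbit c 0 ∧ forwardOrbit c 0 ≤ 8 / 5 := by
  rw [forwardOrbit_zero (by linarith [hc.1] : c ≠ 0)]
  have h0 : 0 ≤ 2 * c - 3 := by linarith [hc.1]
  have h1 : 2 * c - 3 ≤ 3 / 10 := by linarith [hc.2]
  set s := 2 * c - 3
  constructor
  · calc (1 : ℝ) / 4 ≤ (3 + 0) * (6 + 0) / 8 * (1 / 8 + 45 / 32 * 0 + 37 / 64 * 0 ^ 2 +
          22 / 256 * 0 ^ 3 + 0 ^ 4 / 256) := by norm_num
      _ ≤ _ := by gcongr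
  · calc _ ≤ (3 + 3 / 10) * (6 + 3 / 10) / 8 * (1 / 8 + 45 / 32 * (3 / 10) + 37 / 64 * (3 / 10) ^ 2 +
          22 / 256 * (3 / 10) ^ 3 + (3 / 10 : ℝ) ^ 4 / 256) := by gcongr
      _ ≤ _ := by norm_num

/-- The rescaled quartic `c⁻¹ f (c y)`. -/
noncomputable def rescaled (c y : ℝ) : ℝ := y * (1 + c * y - (1 + 2 * c) * y ^ 3 / 4)

/-- After rescaling, the critical point is `1` for every `c`, and `[0, 4/5]` keeps away from it.
There the slope is at least `1`, so inverse branches do not amplify a change of parameter. -/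
theorem rescaled_expanding {c y y' : ℝ} (hc : 3 / 2 ≤ c) (hy' : 0 ≤ y') (h : y' ≤ y)
    (hy : y ≤ 4 / 5) : y - y' ≤ rescaled c y - rescaled c y' := by
  have e : rescaled c y - rescaled c y' - (y - y') = (y - y') * (c * (y + y') -
      (1 + 2 * c) / 4 * ((y + y') * (y ^ 2 + y' ^ 2))) := by unfold rescaled; ring
  have h0 : 0 ≤ y := hy'.trans h
  have h1 : y ^ 2 + y' ^ 2 ≤ 2 * (4 / 5) ^ 2 := by nlinarith
  have h2 : 0 ≤ c - (1 + 2 * c) / 4 * (y ^ 2 + y' ^ 2) := by nlinarith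
  have h3 : 0 ≤ (y - y') * ((y + y') * (c - (1 + 2 * c) / 4 * (y ^ 2 + y' ^ 2))) :=
    mul_nonneg (by linarith) (mul_nonneg (by linarith) h2)
  have e2 : (y - y') * ((y + y') * (c - (1 + 2 * c) / 4 * (y ^ 2 + y' ^ 2))) =
    (y - y') * (c * (y + y') - (1 + 2 * c) / 4 * ((y + y') * (y ^ 2 + y' ^ 2))) := by ring
  linarith

theorem exists_rescaled_eq {c a : ℝ} (hc : 3 / 2 ≤ c) (ha : 0 < a) (ha1 : a ≤ 1) :
    ∃ y, 0 < y ∧ y ≤ 4 / 5 ∧ rescaled c y = a := by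
  have hcont : ContinuousOn (rescaled c) (Icc 0 (4 / 5)) := by unfold rescaled; fun_prop
  have h0 : rescaled c 0 = 0 := by simp [rescaled]
  have h1 : 1 ≤ rescaled c (4 / 5) := by unfold rescaled; nlinarith
  obtain ⟨y, hy, hya⟩ := intermediate_value_Icc (by norm_num) hcont
    (show a ∈ Icc (rescaled c 0) (rescaled c (4 / 5)) from ⟨by linarith, by linarith⟩)
  refine ⟨y, lt_of_le_of_ne hy.1 ?_, hy.2, hya⟩
  rintro rfl
  linarith

open Classical in
/-- A backward orbit of `1` under the rescaled quartic. -/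
noncomputable def backwardOrbit (c : ℝ) : ℕ → ℝ
  | 0 => 1
  | j + 1 => if h : ∃ y, 0 < y ∧ y ≤ 4 / 5 ∧ rescaled c y = backwardOrbit c j then h.choose else 0

/-- For `c ≥ 3/2` a preimage exists at every stage, so the default value `0` in the definition is
never taken. -/
theorem backwardOrbit_spec {c : ℝ} (hc : 3 / 2 ≤ c) (j : ℕ) :
    (0 < backwardOrbit c j ∧ backwardOrbit c j ≤ 1) ∧ 0 < backwardOrbit c (j + 1) ∧
      backwardOrbit c (j + 1) ≤ 4 / 5 ∧ rescaled c (backwardOrbit c (j + 1)) = backwardOrbit c j := by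
  have key : ∀ j, (0 < backwardOrbit c j ∧ backwardOrbit c j ≤ 1) → 0 < backwardOrbit c (j + 1) ∧
      backwardOrbit c (j + 1) ≤ 4 / 5 ∧
      rescaled c (backwardOrbit c (j + 1)) = backwardOrbit c j := by
    intro j hj
    have h := exists_rescaled_eq hc hj.1 hj.2
    have e : backwardOrbit c (j + 1) = h.choose := by
      rw [backwardOrbit, dif_pos h]
    rw [e]
    exact h.choose_spec
  have main : ∀ j, 0 < backwardOrbit c j ∧ backwardOrbit c j ≤ 1 := by
    intro j
    induction j with
    | zero => simp [backwardOrbit]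
    | succ j ih => obtain ⟨h1, h2, -⟩ := key j ih; exact ⟨h1, by linarith⟩
  exact ⟨main j, key j (main j)⟩

/-- Expansion bounds the gap at stage `j + 1` by the gap at stage `j` plus the effect `|c - c'|` of
changing the map. The chosen preimages thus vary continuously although they are obtained by choice.
-/
theorem backwardOrbit_lipschitz (j : ℕ) {c c' : ℝ} (hc : 3 / 2 ≤ c) (hc' : 3 / 2 ≤ c') :
    |backwardOrbit c j - backwardOrbit c' j| ≤ j * |c - c'| := by
  induction j generalizing c c' with
  | zero => simp [backwardOrbit]
  | succ j ih =>
    wlog hle : backwardOrbit c' (j + 1) ≤ backwardOrbit c (j + 1) generalizing c c'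
    · rw [abs_sub_comm, abs_sub_comm c]
      exact this hc' hc (not_le.1 hle).le
    obtain ⟨-, h1, h2, h3⟩ := backwardOrbit_spec hc j
    obtain ⟨-, h1', h2', h3'⟩ := backwardOrbit_spec hc' j
    set y := backwardOrbit c (j + 1)
    set y' := backwardOrbit c' (j + 1)
    have h4 := rescaled_expanding hc h1'.le hle h2
    have h5 : |rescaled c' y' - rescaled c y'| ≤ |c - c'| := by
      have e : rescaled c' y' - rescaled c y' = (c' - c) * (y' ^ 2 * (1 - y' ^ 2 / 2)) := by
        unfold rescaled; ring
      have hy2 : y' ^ 2 ≤ 1 := by nlinarith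
      rw [e, abs_mul, abs_sub_comm c' c]
      refine mul_le_of_le_one_right (abs_nonneg _) ?_
      rw [abs_of_nonneg (mul_nonneg (sq_nonneg _) (by linarith))]
      nlinarith [sq_nonneg y']
    have h6 := ih hc hc'
    rw [abs_of_nonneg (by linarith)]
    have h7 := le_abs_self (rescaled c' y' - rescaled c y')
    have h8 := le_abs_self (backwardOrbit c j - backwardOrbit c' j)
    rw [h3] at h4
    rw [h3'] at h7 h5
    push_cast
    linarith

theorem continuousOn_backwardOrbit (j : ℕ) :
    ContinuousOn (fun c => backwardOrbit c j) (Icc (3 / 2) (33 / 20)) := by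
  have : LipschitzOnWith (j : NNReal) (fun c => backwardOrbit c j) (Icc (3 / 2) (33 / 20)) :=
    LipschitzOnWith.of_dist_le_mul fun c hc c' hc' => by
      rw [Real.dist_eq, Real.dist_eq]
      exact_mod_cast backwardOrbit_lipschitz j hc.1 hc'.1
  exact this.continuousOn

theorem orbitPair_of_critical {c : ℝ} (hc : c ∈ Icc (3 / 2 : ℝ) (33 / 20)) :
    OrbitPair (critBeta c) (forwardOrbit c) (fun j => c * backwardOrbit c j) := by
  have h0 : 0 < c := by linarith [hc.1]
  refine ⟨(critBeta_bounds hc).1, (critBeta_bounds hc).2, (forwardOrbit_zero_bounds hc).1,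
    (forwardOrbit_zero_bounds hc).2, forwardOrbit_succ c, by simpa [backwardOrbit] using hc.1,
    by simpa [backwardOrbit] using hc.2, fun j => ?_, fun j => ?_, fun j => ?_⟩
  · exact mul_pos h0 (backwardOrbit_spec hc.1 j).1.1
  · obtain ⟨-, h1, h2, -⟩ := backwardOrbit_spec hc.1 j
    calc _ ≤ (33 / 20 : ℝ) * (4 / 5) := mul_le_mul hc.2 h2 h1.le (by norm_num)
      _ ≤ _ := by norm_num
  · obtain ⟨-, -, -, h3⟩ := backwardOrbit_spec hc.1 j
    rw [← h3, rescaled, critBeta]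
    field_simp

theorem continuousOn_mismatchLimit :
    ContinuousOn (fun c => OrbitPair.mismatchLimit (forwardOrbit c) (fun j => c * backwardOrbit c j))
      (Icc (3 / 2) (33 / 20)) := by
  have hm : ∀ j, ContinuousOn (fun c => OrbitPair.mismatch (forwardOrbit c)
      (fun j => c * backwardOrbit c j) j) (Icc (3 / 2) (33 / 20)) := by
    intro j
    have h1 := continuousOn_forwardOrbit (j + 2)
    have h2 := continuousOn_backwardOrbit j
    unfold OrbitPair.mismatch
    refine ((continuousOn_const.div h1 fun c hc => ?_).add
      (continuousOn_const.div (continuousOn_id.mul h2) fun c hc => ?_)).sub continuousOn_const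
    · exact ((orbitPair_of_critical hc).t_bounds _).1.ne'
    · exact ((orbitPair_of_critical hc).u_pos j).ne'
  unfold OrbitPair.mismatchLimit
  refine (hm 0).add (continuousOn_tsum (fun j => (hm (j + 1)).sub (hm j)) OrbitPair.summable_bound ?_)
  intro j c hc
  exact (orbitPair_of_critical hc).mismatch_step j

/-- The zero is not at `3/2`, where the mismatch is positive; this strictness becomes `b > -8/27`.
-/
theorem exists_mismatchLimit_eq_zero : ∃ c, 3 / 2 < c ∧ c ≤ 33 / 20 ∧
    OrbitPair.mismatchLimit (forwardOrbit c) (fun j => c * backwardOrbit c j) = 0 := by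
  have h1 : 0 < OrbitPair.mismatchLimit (forwardOrbit (3 / 2))
      (fun j => 3 / 2 * backwardOrbit (3 / 2) j) := by
    have H := orbitPair_of_critical (c := 3 / 2) ⟨le_rfl, by norm_num⟩
    have e : critBeta (3 / 2) = 8 / 27 := by norm_num [critBeta]
    rw [e] at H
    refine H.mismatchLimit_pos ?_ (by simp [backwardOrbit])
    rw [forwardOrbit_zero (by norm_num)]; norm_num
  have h2 : OrbitPair.mismatchLimit (forwardOrbit (33 / 20))
      (fun j => 33 / 20 * backwardOrbit (33 / 20) j) < 0 := by
    have H := orbitPair_of_critical (c := 33 / 20) ⟨by norm_num, le_rfl⟩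
    have e0 := H.t_succ 0
    rw [forwardOrbit_zero (by norm_num)] at e0
    refine H.mismatchLimit_neg ?_ ?_ (by simp [backwardOrbit])
    · rw [e0]; norm_num [critBeta]
    · rw [e0]; norm_num [critBeta]
  obtain ⟨c, hc, hc0⟩ := intermediate_value_Icc' (by norm_num) continuousOn_mismatchLimit
    ⟨h2.le, h1.le⟩
  refine ⟨c, lt_of_le_of_ne hc.1 ?_, hc.2, hc0⟩
  rintro rfl
  simp only at hc0
  linarith

/-- There is a parameter for which the critical point returns to itself under the limit dynamics. -/
theorem exists_criticalReturn : ∃ b c C : ℝ, ∃ x u : ℕ → ℝ, -8 / 27 < b ∧ b < 0 ∧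
    CriticalReturn b c C x u := by
  obtain ⟨c, hc1, hc2, hT⟩ := exists_mismatchLimit_eq_zero
  have hc0 : 0 < c := by linarith
  have H := orbitPair_of_critical (c := c) ⟨hc1.le, hc2⟩
  have hβ : critBeta c < 8 / 27 := by
    unfold critBeta
    rw [div_lt_div_iff₀ (by positivity) (by norm_num)]
    nlinarith [mul_pos (sub_pos.2 hc1) hc0, mul_pos (mul_pos (sub_pos.2 hc1) hc0) hc0]
  have hβ0 := H.beta_lower
  have hlim := H.tendsto_mismatch
  rw [hT] at hlim
  refine ⟨-critBeta c, c, 344, fun m => -forwardOrbit c m, fun j => c * backwardOrbit c j,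
    by linarith, by linarith, ⟨?_, ?_, ?_, ?_, ?_, ?_, H.u_pos, ?_, by norm_num, ?_, H.u_asymp, ?_⟩⟩
  · rw [abs_neg, abs_of_pos (by linarith)]; linarith
  · unfold critBeta; field_simp; ring
  · simp only [forwardOrbit, Function.iterate_zero, id, critValue, quartic]
    push_cast; ring
  · intro m; linarith [(H.t_bounds m).1]
  · intro m; rw [forwardOrbit_succ]; ring
  · simp [backwardOrbit]
  · intro j; rw [← H.u_succ j]; ring
  · intro m
    simp only [neg_div_neg_eq]
    exact H.t_asymp m
  · refine hlim.congr fun m => ?_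
    simp only [neg_div_neg_eq]
    rfl

end ParabolicImplosion

/-! ### The base dynamics and the assembly of the wandering component. -/

namespace ParabolicImplosion
open Filter Topology Metric Set

/-- It bounds sums of `1/N` by `N^(1/4)`. This slow majorant of the logarithm leaves enough decay in
the error `N^(1/4)/N²`. -/
theorem fourth_root_step {N : ℝ} (hN : 1 ≤ N) :
    Real.sqrt (Real.sqrt N) + 1 / (16 * N) ≤ Real.sqrt (Real.sqrt (N + 1)) := by
  set s := Real.sqrt (Real.sqrt N) with hs
  have h1 : 1 ≤ s := Real.one_le_sqrt.2 (Real.one_le_sqrt.2 hN)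
  have h2 : s ^ 2 = Real.sqrt N := Real.sq_sqrt (Real.sqrt_nonneg _)
  have h4 : s ^ 4 = N := by
    rw [show s ^ 4 = (s ^ 2) ^ 2 by ring, h2, Real.sq_sqrt (by linarith)]
  have hs0 : 0 < s := by linarith
  refine Real.le_sqrt_of_sq_le (Real.le_sqrt_of_sq_le ?_)
  rw [← h4]
  set y := 1 / s with hy
  have hy0 : 0 ≤ y := by positivity
  have hy1 : y ≤ 1 := by rw [hy, div_le_one hs0]; exact h1
  have e : ((s + 1 / (16 * s ^ 4)) ^ 2) ^ 2 =
      s ^ 4 + (y / 4 + 6 / 256 * y ^ 6 + 4 / 4096 * y ^ 11 + y ^ 16 / 65536) := by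
    rw [hy]; field_simp; ring
  rw [e]
  have h6 : y ^ 6 ≤ 1 := pow_le_one₀ hy0 hy1
  have h11 : y ^ 11 ≤ 1 := pow_le_one₀ hy0 hy1
  have h16 : y ^ 16 ≤ 1 := pow_le_one₀ hy0 hy1
  linarith

section Base

/-- In the coordinate `1 / w` the polynomial `w - w² + O(w³)` is `U ↦ U + 1 + O(1 / U)`. -/
theorem recip_step_of_tangent_to_identity {g : Polynomial ℂ} (h0 : g.coeff 0 = 0)
    (h1 : g.coeff 1 = 1) (h2 : g.coeff 2 = -1) :
    ∃ G ≥ 0, ∃ ρ > 0, ∀ w : ℂ, w ≠ 0 → ‖w‖ ≤ ρ →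
      g.eval w ≠ 0 ∧ ‖1 / g.eval w - 1 / w - 1‖ ≤ G * ‖w‖ := by
  set h := g.divX.divX.divX with hh
  have hg : g = ((h * Polynomial.X - 1) * Polynomial.X + 1) * Polynomial.X := by
    have e1 := Polynomial.divX_mul_X_add g
    have e2 := Polynomial.divX_mul_X_add g.divX
    have e3 := Polynomial.divX_mul_X_add g.divX.divX
    rw [Polynomial.coeff_divX, Polynomial.coeff_divX] at e3
    rw [Polynomial.coeff_divX] at e2
    norm_num [h0, h1, h2] at e1 e2 e3
    rw [← hh] at e3
    rw [sub_eq_add_neg, e3, e2, e1]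
  have hev : ∀ w : ℂ, g.eval w = w * (1 - w + w ^ 2 * h.eval w) := by
    intro w
    conv_lhs => rw [hg]
    simp only [Polynomial.eval_mul, Polynomial.eval_add, Polynomial.eval_sub, Polynomial.eval_X,
      Polynomial.eval_one]
    ring
  have c1 : ContinuousAt (fun w : ℂ => 1 - w + w ^ 2 * h.eval w) 0 := by
    have := h.continuous
    exact Continuous.continuousAt (by fun_prop)
  have c2 : ContinuousAt (fun w : ℂ => 1 - h.eval w - w * h.eval w) 0 := by
    have := h.continuous
    exact Continuous.continuousAt (by fun_prop)
  have v1 : ∀ᶠ w : ℂ in 𝓝 0, 1 / 2 < ‖1 - w + w ^ 2 * h.eval w‖ := by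
    refine c1.norm.eventually (lt_mem_nhds ?_)
    norm_num
  set M := ‖(1 : ℂ) - h.eval 0 - 0 * h.eval 0‖ + 1 with hM
  have hM0 : 0 ≤ M := by positivity
  have v2 : ∀ᶠ w : ℂ in 𝓝 0, ‖1 - h.eval w - w * h.eval w‖ < M :=
    c2.norm.eventually (gt_mem_nhds (by rw [hM]; linarith))
  obtain ⟨ρ, hρ, hball⟩ := Metric.eventually_nhds_iff.1 (v1.and v2)
  refine ⟨2 * M, by positivity, ρ / 2, by positivity, fun w hw hwρ => ?_⟩
  obtain ⟨a1, a2⟩ := hball (y := w) (by rw [dist_zero_right]; linarith)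
  set q := 1 - w + w ^ 2 * h.eval w with hq
  have hq0 : q ≠ 0 := by
    intro hq0; rw [hq0, norm_zero] at a1; linarith
  rw [hev w]
  refine ⟨mul_ne_zero hw hq0, ?_⟩
  have e : 1 / (w * q) - 1 / w - 1 = (1 - h.eval w - w * h.eval w) * w / q := by
    field_simp; rw [hq]; ring
  rw [e, norm_div, norm_mul, div_le_iff₀ (by linarith)]
  have : M * ‖w‖ * 1 ≤ M * ‖w‖ * (2 * ‖q‖) := by gcongr; linarith
  calc _ ≤ M * ‖w‖ := by gcongr
    _ ≤ _ := by linarith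

/-- By induction `1/w_k = N_k + O(N_k^(1/4))` with `N_k = n₀² + k`; inverting gives `w_k = 1/N_k +
O(N_k^(-7/4))`. Since `N_k = n² + i ≥ n²`, this is the error `n^(-7/2)` required inside a gate. -/
theorem parabolic_orbit_asymp {g : Polynomial ℂ} (h0 : g.coeff 0 = 0)
    (h1 : g.coeff 1 = 1) (h2 : g.coeff 2 = -1) :
    ∃ B ≥ 0, ∃ n₁ : ℕ, 2 ≤ n₁ ∧ ∀ n₀, n₁ ≤ n₀ → ∀ w : ℂ, w ≠ 0 → ‖1 / w - n₀ ^ 2‖ ≤ 1 → ∀ k : ℕ,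
      ‖(fun w => g.eval w)^[k] w‖ ≤ 2 / ((n₀ : ℝ) ^ 2 + k) ∧
      ∀ n i : ℕ, 0 < n → n ^ 2 + i = n₀ ^ 2 + k →
        ‖(fun w => g.eval w)^[k] w - 1 / (n ^ 2 + i)‖ ≤ B / (n ^ 3 * Real.sqrt n) := by
  obtain ⟨G, hG, ρ, hρ, hstep⟩ := recip_step_of_tangent_to_identity h0 h1 h2
  obtain ⟨n₁, hn₁⟩ := exists_nat_ge (2 + 64 * G + 2 / ρ)
  refine ⟨2 * (1 + 32 * G), by positivity, n₁ + 2, by omega, fun n₀ hn₀ w hw hw0 => ?_⟩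
  set φ : ℂ → ℂ := fun w => g.eval w with hφ
  have hnR : (n₁ : ℝ) + 2 ≤ n₀ := by exact_mod_cast hn₀
  have hρ' : 0 < 2 / ρ := by positivity
  have hn2 : (2 : ℝ) ≤ n₀ := by linarith [(Nat.cast_nonneg n₁ : (0 : ℝ) ≤ n₁)]
  set N : ℕ → ℝ := fun k => (n₀ : ℝ) ^ 2 + k with hN
  set s : ℕ → ℝ := fun k => Real.sqrt (Real.sqrt (N k)) with hs
  have hNn : ∀ k, (n₀ : ℝ) ^ 2 ≤ N k := fun k => by simp [hN]
  have hN1 : ∀ k, 1 ≤ N k := fun k => le_trans (by nlinarith) (hNn k)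
  have hs1 : ∀ k, 1 ≤ s k := fun k => Real.one_le_sqrt.2 (Real.one_le_sqrt.2 (hN1 k))
  have hs2 : ∀ k, s k ^ 2 = Real.sqrt (N k) := fun k => Real.sq_sqrt (Real.sqrt_nonneg _)
  have hs4 : ∀ k, s k ^ 4 = N k := fun k => by
    rw [show s k ^ 4 = (s k ^ 2) ^ 2 by ring, hs2, Real.sq_sqrt (by linarith [hN1 k])]
  have hsn : ∀ k, (n₀ : ℝ) ≤ s k ^ 2 := fun k => by
    rw [hs2]; exact Real.le_sqrt_of_sq_le (hNn k)
  have hhalf : ∀ k, (1 + 32 * G) * s k ≤ N k / 2 := by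
    intro k
    have h3 : 2 + 64 * G ≤ s k ^ 3 := by
      have : s k ^ 2 * 1 ≤ s k ^ 2 * s k := by gcongr; exact hs1 k
      have := hsn k
      nlinarith
    rw [← hs4]
    nlinarith [hs1 k]
  have hlow : ∀ k (U : ℂ), ‖U - N k‖ ≤ (1 + 32 * G) * s k → N k / 2 ≤ ‖U‖ := by
    intro k U hU
    have h3 := norm_sub_norm_le (N k : ℂ) U
    rw [norm_sub_rev, Complex.norm_real, Real.norm_of_nonneg (by linarith [hN1 k])] at h3
    linarith [hhalf k]
  have hsmall : ∀ {k} {v : ℂ}, v ≠ 0 → N k / 2 ≤ ‖1 / v‖ → ‖v‖ ≤ 2 / N k := by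
    intro k v hv h
    have := hN1 k
    rw [norm_div, norm_one, le_div_iff₀ (norm_pos_iff.2 hv)] at h
    rw [le_div_iff₀ (by linarith)]
    linarith
  have main : ∀ k, φ^[k] w ≠ 0 ∧ ‖1 / φ^[k] w - N k‖ ≤ (1 + 32 * G) * s k := by
    suffices h : ∀ k, φ^[k] w ≠ 0 ∧ ‖1 / φ^[k] w - N k‖ ≤ 1 + 32 * G * s k by
      intro k
      refine ⟨(h k).1, (h k).2.trans ?_⟩
      linarith [hs1 k]
    intro k
    induction k with
    | zero =>
      refine ⟨hw, ?_⟩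
      have : 0 ≤ 32 * G * s 0 := by have := hs1 0; positivity
      have e : ((N 0 : ℝ) : ℂ) = (n₀ : ℂ) ^ 2 := by simp [hN]
      rw [e]
      exact hw0.trans (by linarith)
    | succ k ih =>
      have hU := hlow k _ (ih.2.trans (by linarith [hs1 k]))
      have hv := hsmall ih.1 hU
      have hNρ : 2 / N k ≤ ρ := by
        rw [div_le_iff₀ (by linarith [hN1 k])]
        have h3 : 2 / ρ ≤ N k := by
          refine le_trans ?_ (hNn k)
          nlinarith
        rw [div_le_iff₀ hρ] at h3
        linarith
      obtain ⟨s1, s2⟩ := hstep _ ih.1 (hv.trans hNρ)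
      rw [Function.iterate_succ_apply']
      refine ⟨s1, ?_⟩
      have e : ((N (k + 1) : ℝ) : ℂ) = (N k : ℂ) + 1 := by simp [hN]; ring
      have eR : N (k + 1) = N k + 1 := by simp [hN]; ring
      have e2 : 1 / φ (φ^[k] w) - N (k + 1) =
          (1 / g.eval (φ^[k] w) - 1 / φ^[k] w - 1) + (1 / φ^[k] w - N k) := by
        rw [e]; simp only [hφ]; ring
      have h5 := fourth_root_step (hN1 k)
      rw [← eR] at h5
      have h6 : G * ‖φ^[k] w‖ ≤ 32 * G * (1 / (16 * N k)) := by
        calc _ ≤ G * (2 / N k) := by gcongr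
          _ = _ := by have := hN1 k; field_simp; ring
      have h7 : 32 * G * (s k + 1 / (16 * N k)) ≤ 32 * G * s (k + 1) := by gcongr
      rw [e2]
      refine (norm_add_le_of_le (s2.trans h6) ih.2).trans ?_
      linarith
  intro k
  obtain ⟨m1, m2⟩ := main k
  have hU := hlow k _ m2
  have hv := hsmall m1 hU
  refine ⟨hv, fun n i hn hni => ?_⟩
  have hcast : ((n : ℝ) ^ 2 + i) = N k := by simp only [hN]; exact_mod_cast hni
  have hcastC : ((n : ℂ) ^ 2 + i) = (N k : ℂ) := by rw [← hcast]; push_cast; ring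
  have hN0 : 0 < N k := by linarith [hN1 k]
  have hNC : (N k : ℂ) ≠ 0 := by exact_mod_cast hN0.ne'
  have hn0 : (0 : ℝ) < n := by exact_mod_cast hn
  have e : φ^[k] w - 1 / (N k : ℂ) = -((1 / φ^[k] w - N k) * (φ^[k] w / N k)) := by
    field_simp
    ring
  have hs0 : 0 < s k := by linarith [hs1 k]
  rw [hcastC, e, norm_neg, norm_mul, norm_div, Complex.norm_real, Real.norm_of_nonneg hN0.le]
  have hnN : (n : ℝ) ≤ s k ^ 2 := by
    rw [hs2]
    refine Real.le_sqrt_of_sq_le ?_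
    rw [← hcast]
    have : (0 : ℝ) ≤ i := by positivity
    linarith
  have hsq : Real.sqrt n ≤ s k := by
    rw [Real.sqrt_le_left hs0.le]; exact hnN
  calc _ ≤ (1 + 32 * G) * s k * (2 / N k / N k) := by gcongr
    _ = 2 * (1 + 32 * G) / ((s k ^ 2) ^ 3 * s k) := by rw [← hs4]; field_simp
    _ ≤ _ := by gcongr

end Base

section Fibers

/-- A polynomial with nonzero leading coefficient pushes large points outwards. -/
theorem quartic_escape {b z ω : ℂ} {R : ℝ} (hb : b ≠ 0) (hR1 : 1 ≤ R) (hR : 6 / ‖b‖ ≤ R)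
    (hz : R < ‖z‖) (hω : ‖ω‖ ≤ 3) : R < ‖quartic b z + ω‖ := by
  have hb0 : 0 < ‖b‖ := norm_pos_iff.2 hb
  have e : quartic b z + ω = b * z ^ 4 + (z + z ^ 2 + ω) := by rw [quartic]; ring
  have h1 := norm_sub_le (b * z ^ 4 + (z + z ^ 2 + ω)) (z + z ^ 2 + ω)
  rw [add_sub_cancel_right, norm_mul, norm_pow] at h1
  have h2 : ‖z + z ^ 2 + ω‖ ≤ ‖z‖ + ‖z‖ ^ 2 + 3 := by
    refine norm_add_le_of_le (norm_add_le_of_le le_rfl ?_) hω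
    rw [norm_pow]
  rw [div_le_iff₀ hb0] at hR
  rw [e]
  set x := ‖z‖
  have hx1 : 1 ≤ x := by linarith
  have h3 : 6 * x ^ 2 ≤ ‖b‖ * x ^ 4 := by
    have h4 : 6 ≤ ‖b‖ * x := by nlinarith
    have h5 : ‖b‖ * x * 1 ≤ ‖b‖ * x * x := by gcongr
    calc 6 * x ^ 2 ≤ (‖b‖ * x * x) * x ^ 2 := by gcongr; linarith
      _ = _ := by ring
  nlinarith

theorem contraction_iterate {d : ℕ → ℝ} {η : ℝ} (hη : 0 ≤ η) {n : ℕ}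
    (h : ∀ m, n ≤ m → d (m + 1) ≤ d m / 2 + η / 4) (i : ℕ) :
    d (n + i) ≤ d n / 2 ^ i + η / 2 := by
  induction i with
  | zero => simp; linarith
  | succ i ih =>
    have := h (n + i) (by omega)
    rw [← add_assoc, pow_succ, ← div_div]
    linarith

variable {b c C : ℝ} {x u : ℕ → ℝ}

/-- The orbit tends to `0` because `1/x m` is unbounded, whereas a periodic orbit would return to `x
0` at arbitrarily late times. -/
theorem CriticalReturn.x_aperiodic (D : CriticalReturn b c C x u) {d : ℕ} (hd : d ≠ 0) :
    (quartic b)^[d] (x 0) ≠ x 0 := by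
  intro h
  obtain ⟨M, hM⟩ := eventually_atTop.1 D.eventually_lower
  obtain ⟨k, hk⟩ := exists_nat_gt (2 * ‖(1 : ℂ) / x 0‖)
  have h1 : x (d * (M + k)) = x 0 := by
    have h2 := D.iterate_x (d * (M + k))
    rw [Function.iterate_mul, Function.iterate_fixed h] at h2
    exact_mod_cast h2.symm
  have hle : M + k ≤ d * (M + k) := Nat.le_mul_of_pos_left _ (Nat.pos_of_ne_zero hd)
  have h2 := (hM (d * (M + k)) (by omega)).1
  rw [h1] at h2
  have h3 : (k : ℝ) ≤ (d * (M + k) : ℕ) := by exact_mod_cast (by omega : k ≤ d * (M + k))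
  linarith

theorem skewProduct_iterate_snd (f g : Polynomial ℂ) (p : ℂ × ℂ) (k : ℕ) :
    ((skewProduct f g)^[k] p).2 = (fun w => g.eval w)^[k] p.2 := by
  induction k with
  | zero => rfl
  | succ k ih => rw [Function.iterate_succ_apply', Function.iterate_succ_apply', ← ih]; rfl

open Polynomial in
set_option maxHeartbeats 1000000 in
/-- Over a base polynomial tangent to the identity at a parabolic point, the skew product has a
wandering component meeting the real plane. -/
theorem CriticalReturn.exists_wandering (D : CriticalReturn b c C x u) (hb : b ≠ 0)
    {g : Polynomial ℂ} (h0 : g.coeff 0 = 0) (h1 : g.coeff 1 = 1) (h2 : g.coeff 2 = -1) :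
    ∃ Ω : Set (ℂ × ℂ),
      IsWanderingFatouComponent
        (skewProduct (Polynomial.X + Polynomial.X ^ 2 +
          Polynomial.C (b : ℂ) * Polynomial.X ^ 4) g) Ω ∧
      ∃ x y : ℝ, ((x : ℂ), (y : ℂ)) ∈ Ω := by
  set f : Polynomial ℂ := X + X ^ 2 + Polynomial.C (b : ℂ) * X ^ 4 with hf
  set P := skewProduct f g with hPdef
  have hfe : ∀ z, f.eval z = quartic b z := fun z => by simp [hf, quartic]
  have hPz : ∀ p k, (P^[k + 1] p).1 =
      quartic b (P^[k] p).1 + (Real.pi : ℂ) ^ 2 / 4 * (P^[k] p).2 := by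
    intro p k
    rw [Function.iterate_succ_apply', ← hfe]; rfl
  have hf1 : f.coeff 1 ≠ 0 := by
    simp [hf, coeff_X, coeff_X_pow]
  have hP : Differentiable ℂ P := differentiable_skewProduct f g
  have ho : IsOpenMap P := isOpenMap_skewProduct hf1 (by rw [h1]; exact one_ne_zero)
  have hpi : ‖(Real.pi : ℂ) ^ 2 / 4‖ ≤ 3 := by
    rw [norm_div, norm_pow, Complex.norm_real, Real.norm_of_nonneg Real.pi_pos.le]
    norm_num
    nlinarith [Real.pi_lt_d2, Real.pi_pos]
  obtain ⟨B, hB, n₁, hn₁, horb⟩ := parabolic_orbit_asymp h0 h1 h2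
  obtain ⟨r, hr, hret⟩ := D.return_contracts (B := 3 * B) (by positivity)
  -- With `ε = r/4`, a distance at most `r` becomes at most `3r/4`, so the disc of radius `r` is
  -- preserved from block to block.
  obtain ⟨n₂, hn₂⟩ := hret (r / 4) (by positivity)
  set n₀ := n₁ + n₂ with hn₀
  have hn₀2 : 2 ≤ n₀ := by omega
  have hn₀R : (2 : ℝ) ≤ n₀ := by exact_mod_cast hn₀2
  have hnC : (n₀ : ℂ) ≠ 0 := by exact_mod_cast (by omega : n₀ ≠ 0)
  have hw : ∀ᶠ w : ℂ in 𝓝 (1 / (n₀ : ℂ) ^ 2), w ≠ 0 ∧ ‖1 / w - n₀ ^ 2‖ < 1 := by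
    have hne : (1 : ℂ) / (n₀ : ℂ) ^ 2 ≠ 0 := one_div_ne_zero (pow_ne_zero 2 hnC)
    have hc : ContinuousAt (fun w : ℂ => ‖1 / w - n₀ ^ 2‖) (1 / (n₀ : ℂ) ^ 2) :=
      ((continuousAt_const.div continuousAt_id hne).sub continuousAt_const).norm
    refine (eventually_ne_nhds hne).and (hc.eventually (gt_mem_nhds ?_))
    simp
  obtain ⟨ρ, hρ, hwball⟩ := Metric.eventually_nhds_iff_ball.1 hw
  set U := ball ((x 0 : ℝ) : ℂ) r ×ˢ ball (1 / (n₀ : ℂ) ^ 2) ρ with hU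
  have hUo : IsOpen U := isOpen_ball.prod isOpen_ball
  -- the times at which the orbit returns
  set T : ℕ → ℕ := fun n => n ^ 2 - n₀ ^ 2 with hT
  have hTadd : ∀ n, n₀ ≤ n → n₀ ^ 2 + T n = n ^ 2 := fun n hn => by
    have := Nat.pow_le_pow_left hn 2
    simp only [hT]; omega
  have hTsucc : ∀ n, n₀ ≤ n → T (n + 1) = T n + (2 * n + 1) := fun n hn => by
    have a1 := hTadd n hn
    have a2 := hTadd (n + 1) (by omega)
    have e : (n + 1) ^ 2 = n ^ 2 + (2 * n + 1) := by ring
    omega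
  have hbase : ∀ p ∈ U, ∀ k : ℕ, ‖(P^[k] p).2‖ ≤ 2 / ((n₀ : ℝ) ^ 2 + k) ∧
      ∀ n i : ℕ, 0 < n → n ^ 2 + i = n₀ ^ 2 + k →
        ‖(P^[k] p).2 - 1 / (n ^ 2 + i)‖ ≤ B / (n ^ 3 * Real.sqrt n) := by
    intro p hp k
    obtain ⟨a1, a2⟩ := hwball p.2 hp.2
    rw [hPdef, skewProduct_iterate_snd]
    exact horb n₀ (by omega) p.2 a1 a2.le k
  have hgate : ∀ p ∈ U, ∀ n, n₀ ≤ n → GateOrbit b (3 * B) n (fun i => (P^[T n + i] p).1)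
      (fun i => (Real.pi : ℂ) ^ 2 / 4 * ((P^[T n + i] p).2 - 1 / (n ^ 2 + i))) := by
    intro p hp n hn i _
    have a1 := (hbase p hp (T n + i)).2 n i (by omega) (by have := hTadd n hn; omega)
    constructor
    · simp only []
      rw [← add_assoc, hPz, quartic]
      ring
    · rw [norm_mul]
      calc _ ≤ 3 * (B / (n ^ 3 * Real.sqrt n)) := by gcongr
        _ = _ := by ring
  set d : ℂ × ℂ → ℕ → ℝ := fun p n => ‖(P^[T n] p).1 - x 0‖ with hd
  have hcontr : ∀ ε > 0, ∃ n₃, ∀ p ∈ U, ∀ n, n₀ ≤ n → n₃ ≤ n → d p n ≤ r →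
      d p (n + 1) ≤ d p n / 2 + ε := by
    intro ε hε
    obtain ⟨n₃, hn₃⟩ := hret ε hε
    refine ⟨n₃, fun p hp n hn hn' hdn => ?_⟩
    have := hn₃ n hn' _ _ (hgate p hp n hn) (by simpa using hdn)
    simp only [add_zero] at this
    rw [← hTsucc n hn] at this
    exact this
  have hdr : ∀ p ∈ U, ∀ n, n₀ ≤ n → d p n ≤ r := by
    intro p hp n hn
    induction n, hn using Nat.le_induction with
    | base =>
      have : T n₀ = 0 := by simp [hT]
      simp only [hd, this, Function.iterate_zero, id]
      have := hp.1
      rw [mem_ball, dist_eq_norm] at this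
      exact this.le
    | succ n hn ih =>
      have a := hn₂ n (by omega) _ _ (hgate p hp n hn) (by simpa using ih)
      simp only [add_zero] at a
      rw [← hTsucc n hn] at a
      change d p (n + 1) ≤ d p n / 2 + r / 4 at a
      linarith
  have hdlim : ∀ η > 0, ∃ n₄, ∀ n, n₄ ≤ n → ∀ p ∈ U, d p n ≤ η := by
    intro η hη
    obtain ⟨n₃, hn₃⟩ := hcontr (η / 4) (by positivity)
    obtain ⟨i₀, hi₀⟩ := exists_pow_lt_of_lt_one (show 0 < η / (2 * r) by positivity)
      (by norm_num : (1 / 2 : ℝ) < 1)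
    refine ⟨n₀ + n₃ + i₀, fun n hn p hp => ?_⟩
    obtain ⟨i, rfl⟩ : ∃ i, n = n₀ + n₃ + i := ⟨n - (n₀ + n₃), by omega⟩
    have a := contraction_iterate (d := d p) hη.le (n := n₀ + n₃)
      (fun m hm => hn₃ p hp m (by omega) (by omega) (hdr p hp m (by omega))) i
    have a2 := hdr p hp (n₀ + n₃) (by omega)
    have a3 : (1 / 2 : ℝ) ^ i ≤ (1 / 2) ^ i₀ :=
      pow_le_pow_of_le_one (by norm_num) (by norm_num) (by omega)
    have a4 : d p (n₀ + n₃) / 2 ^ i ≤ η / 2 := by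
      calc d p (n₀ + n₃) / 2 ^ i ≤ r / 2 ^ i := by gcongr
        _ = r * (1 / 2) ^ i := by rw [one_div, inv_pow]; rfl
        _ ≤ r * (η / (2 * r)) := by gcongr; linarith
        _ = η / 2 := by field_simp
    linarith
  -- bounded orbits
  set R := 1 + 6 / ‖(b : ℂ)‖ + ‖((x 0 : ℝ) : ℂ)‖ + r with hR
  have hbC : (b : ℂ) ≠ 0 := by exact_mod_cast hb
  have hq0 : 0 ≤ 6 / ‖(b : ℂ)‖ := by positivity
  have hx00 : 0 ≤ ‖((x 0 : ℝ) : ℂ)‖ := norm_nonneg _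
  have hw1 : ∀ p ∈ U, ∀ k, ‖(P^[k] p).2‖ ≤ 1 := by
    intro p hp k
    refine (hbase p hp k).1.trans ?_
    have : (0 : ℝ) ≤ k := by positivity
    rw [div_le_one (by positivity)]
    nlinarith
  -- No estimate within the blocks is needed: an orbit that leaves the disc of radius `R` stays
  -- outside it, since `b ≠ 0`, whereas at every return time it lies within `r` of `x 0`.
  have hz1 : ∀ p ∈ U, ∀ k, ‖(P^[k] p).1‖ ≤ R := by
    intro p hp k
    by_contra! hk
    have hesc : ∀ i, R < ‖(P^[k + i] p).1‖ := by
      intro i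
      induction i with
      | zero => exact hk
      | succ i ih =>
        rw [← add_assoc, hPz]
        refine quartic_escape hbC (by linarith) (by linarith) ih ?_
        rw [norm_mul]
        calc _ ≤ 3 * (1 : ℝ) := mul_le_mul hpi (hw1 p hp _) (norm_nonneg _) (by norm_num)
          _ = 3 := by norm_num
    have hTk : k ≤ T (n₀ + k) := by
      have := hTadd (n₀ + k) (by omega)
      have e : (n₀ + k) ^ 2 = n₀ ^ 2 + (2 * n₀ * k + k ^ 2) := by ring
      nlinarith
    have a1 := hesc (T (n₀ + k) - k)
    rw [Nat.add_sub_cancel' hTk] at a1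
    have a2 := hdr p hp (n₀ + k) (by omega)
    have a3 := norm_add_le_of_le a2 (le_refl ‖((x 0 : ℝ) : ℂ)‖)
    rw [sub_add_cancel] at a3
    linarith
  have hbdd : ∀ p ∈ U, ∀ n, ‖P^[n] p‖ ≤ R := fun p hp n =>
    max_le (hz1 p hp n) ((hw1 p hp n).trans (by linarith))
  -- convergence along the return times
  have hTn : ∀ n, n ≤ T (n₀ + n) := fun n => by
    have := hTadd (n₀ + n) (by omega)
    have e : (n₀ + n) ^ 2 = n₀ ^ 2 + (2 * n₀ * n + n ^ 2) := by ring
    nlinarith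
  have hTtop : Tendsto (fun n => T (n₀ + n)) atTop atTop := tendsto_atTop_mono hTn tendsto_id
  have hlim : TendstoUniformlyOn (fun n => P^[T (n₀ + n)]) (fun _ => (((x 0 : ℝ) : ℂ), (0 : ℂ)))
      atTop U := by
    rw [Metric.tendstoUniformlyOn_iff]
    intro ε hε
    obtain ⟨n₄, hn₄⟩ := hdlim (ε / 2) (half_pos hε)
    obtain ⟨n₅, hn₅⟩ := exists_nat_gt (2 / ε)
    filter_upwards [eventually_ge_atTop (n₄ + n₅)] with n hn p hp
    rw [dist_comm, dist_eq_norm]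
    refine max_lt ?_ ?_
    · have := hn₄ (n₀ + n) (by omega) p hp
      exact this.trans_lt (by linarith)
    · show ‖(P^[T (n₀ + n)] p).2 - 0‖ < ε
      rw [sub_zero]
      refine (hbase p hp _).1.trans_lt ?_
      have a1 : (n₅ : ℝ) ≤ T (n₀ + n) := by
        exact_mod_cast (by omega : n₅ ≤ n).trans (hTn n)
      rw [div_lt_iff₀ (by positivity)]
      rw [div_lt_iff₀ hε] at hn₅
      nlinarith
  -- The fibre `w = 0` is invariant and carries the unperturbed quartic.
  have hper : ∀ k, k ≠ 0 → P^[k] (((x 0 : ℝ) : ℂ), (0 : ℂ)) ≠ (((x 0 : ℝ) : ℂ), (0 : ℂ)) := by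
    intro k hk h
    have hg0 : g.eval 0 = 0 := by rw [← coeff_zero_eq_eval_zero, h0]
    have hit : ∀ k, P^[k] (((x 0 : ℝ) : ℂ), (0 : ℂ)) = ((quartic b)^[k] (x 0), 0) := by
      intro k
      induction k with
      | zero => rfl
      | succ k ih =>
        rw [Function.iterate_succ_apply', ih, Function.iterate_succ_apply', hPdef, skewProduct]
        simp only [hfe, hg0, mul_zero, add_zero]
    rw [hit] at h
    exact D.x_aperiodic hk (Prod.ext_iff.1 h).1
  have hp₀ : (((x 0 : ℝ) : ℂ), ((1 / (n₀ : ℝ) ^ 2 : ℝ) : ℂ)) ∈ U := by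
    refine ⟨mem_ball_self hr, ?_⟩
    push_cast
    exact mem_ball_self hρ
  refine ⟨_, isWandering_of_return hP ho hUo hp₀ hbdd hTtop hlim hper, x 0, 1 / (n₀ : ℝ) ^ 2, ?_⟩
  exact mem_connectedComponentIn (subset_fatouSet_of_bounded hP hUo hbdd hp₀)

end Fibers

end ParabolicImplosion

theorem mainTheorem7 :
    ∃ b : ℝ, -8 / 27 < b ∧ b < 0 ∧
      ∀ g : Polynomial ℂ, g.coeff 0 = 0 → g.coeff 1 = 1 → g.coeff 2 = -1 →
        ∃ Ω : Set (ℂ × ℂ),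
          IsWanderingFatouComponent
            (skewProduct (Polynomial.X + Polynomial.X ^ 2 +
              Polynomial.C (b : ℂ) * Polynomial.X ^ 4) g) Ω ∧
          ∃ x y : ℝ, ((x : ℂ), (y : ℂ)) ∈ Ω := by
  obtain ⟨b, c, C, x, u, hb, hb0, D⟩ := ParabolicImplosion.exists_criticalReturn
  exact ⟨b, hb, hb0, fun g h0 h1 h2 => D.exists_wandering hb0.ne h0 h1 h2⟩
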